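/- **Setting.** Let $G$ be a finite directed plane graph with source $s$ and sink $t$ such that: the embedding has no clockwise (directed, simple) cycle; $s$ has no incoming arc and exactly one outgoing arc; every vertex other than $s$ and $t$ has degree (indegree plus outdegree) exactly $3$; and $t$ lies on the unbounded face. An arc is *useful* if it lies on some simple directed $s,t$-path, and *useless* otherwise. Let $C$ be a strongly connected component of $G$ with $t\notin V(C)$ such that $s$ lies in the unbounded face of $C$ (the outside case). A vertex $v$ of $C$ is an *entrance* (*exit*) if there is an $s,v$-path (a $v,t$-path) meeting $C$ only in $v$. Let the boundary of $C$ (the arcs of $C$ on the unbounded face of $C$) be the cycle that consists of a path $F^*$ from an entrance $s_C$ to an exit $t_C$ followed by a path $Q_2$ from $t_C$ back to $s_C$ none of whose internal vertices is an entrance or an exit. Let $U^*=(s_C,u^*,t_C)$ be a dummy ceiling, where $u^*$ is a new vertex, drawn outside $C$ alongside $Q_2$. So $C$ becomes a strip with ceiling $U^*$ and floor $F^*$, in which the arcs of $Q_2$ are inner arcs. **Strips.** A strip $C_{U,F}$ consists of the vertices and arcs of $C$ in the closed region enclosed by two paths $U$ (ceiling) and $F$ (floor) with the same start $s'$ and the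 same end $t'$. Its *boundary arcs* are the arcs of $U$ and $F$ (those of the dummy ceiling are not arcs of $G$), and its other arcs are its *inner arcs*. A *slicing path* is a simple path $P$ in $C_{U,F}$, consisting of inner arcs and without boundary vertices other than its ends, from a vertex $u\neq t'$ of $F$ to either a vertex $v$ that is after $u$ on $F$ (a forward path) or an internal vertex $v$ of $U$ (an up-cross path). If $P$ is a forward path, slicing by $P$ gives the up-strip with ceiling $U$ and with floor $F$ in which the $u,v$-subpath is replaced by $P$, and the down-strip with ceiling $P$ and with the $u,v$-subpath of $F$ as floor. If $P$ is an up-cross path, it gives the up-strip with ceiling $U[s',v]$ and floor $F[s',u]\cdot P$, and the down-strip with ceiling $P\cdot U[v,t']$ and floor $F[u,t']$. **Decomposition.** The strip-slicing decomposition starts with $C_{U^*,F^*}$. If the current strip has a slicing path, the algorithm chooses a floor vertex $u$ at which a slicing path starts, slices the strip by the right-most slicing path that starts at $u$ (the one preferred by right-first search: no slicing path from $u$ branches off to its right), and recurses on the up-strip and the down-strip. Otherwise it outputs the current strip. Let $\mathcal S$ be the collection of output strips of any run. **Claim.** For every strip $C_{U,F}\in\mathcal S$, every inner arc of $C_{U,F}$,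 i.e. every $e\in E(C_{U,F})\setminus E(U\cup F)$, is useless. Consequently only boundary arcs of strips can be useful: every useful arc of $C$ is a boundary arc of some strip in $\mathcal S$. -/

import Mathlib

/-- A directed plane graph with vertex set `V`, arc set `A` and face set `Φ` (loops and parallel
arcs are allowed, and the graph need not be connected), given by the counterclockwise order of the
arcs around every vertex and by its faces.

A pair `(a, b) : A × Bool` is a *dart*: `(a, true)` is the arc `a` traversed from its tail to its
head, `(a, false)` is `a` traversed from its head to its tail. A dart is *based* at the vertex from
which it points away. `rot d` is the dart that follows `d` in the counterclockwise order around the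
vertex at which `d` is based, and `face d` is the face on the left-hand side of `d`.
Planarity is Euler's formula `|V| - |A| + |Φ| = 1 + #components`. -/
structure PlaneDigraph (V A Φ : Type*) where
  tail : A → V
  head : A → V
  rot : Equiv.Perm (A × Bool)
  face : A × Bool → Φ
  /-- the unbounded face -/
  outer : Φ
  /-- the cycles of `rot` are exactly the sets of darts based at a common vertex -/
  rot_sameCycle : ∀ d e : A × Bool, rot.SameCycle d e ↔
    (if d.2 then tail d.1 else head d.1) = (if e.2 then tail e.1 else head e.1)
  /-- the corner between `d` and `rot d` is on the left of `d` and on the right of `rot d` -/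
  face_rot : ∀ d : A × Bool, face ((rot d).1, !(rot d).2) = face d
  /-- any two faces are joined by a sequence of faces that are consecutively adjacent -/
  face_connected : ∀ f g : Φ,
    Relation.ReflTransGen (fun x y => ∃ d : A × Bool, face d = x ∧ face (d.1, !d.2) = y) f g
  euler : Nat.card V + Nat.card Φ =
    Nat.card A + 1 + Nat.card (Quot fun x y : V => ∃ a : A, tail a = x ∧ head a = y)

/-- The combinatorial data of a strip: its common start vertex and end vertex, its ceiling and its
floor, both as lists of arcs. The ceiling `none` is the dummy ceiling: a path from `start` to
`finish` through one new vertex that is not a vertex of the graph, whose two arcs are not arcs of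
the graph either. -/
structure Strip (V A : Type*) where
  start : V
  finish : V
  ceiling : Option (List A)
  floor : List A

namespace PlaneDigraph

variable {V A Φ : Type*} (G : PlaneDigraph V A Φ)

/-! ### Walks, paths, cycles, strongly connected components -/

/-- The vertex at which a dart is based. -/
def base (d : A × Bool) : V := if d.2 then G.tail d.1 else G.head d.1

/-- The degree of a vertex: indegree plus outdegree (a loop counts twice). -/
noncomputable def degree (v : V) : ℕ := Nat.card {d : A × Bool // G.base d = v}

/-- `G.IsWalk u p v`: the list of arcs `p` is a directed walk from `u` to `v`. -/
def IsWalk : V → List A → V → Prop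
  | u, [], v => u = v
  | u, a :: p, v => G.tail a = u ∧ IsWalk (G.head a) p v

/-- The list of vertices of a walk `p` that starts at `u`. -/
def verts (u : V) (p : List A) : List V := u :: p.map G.head

/-- The list of the internal vertices of a walk (all vertices but the first and the last one). -/
def internalVerts (p : List A) : List V := (p.map G.head).dropLast

/-- `p` is a simple directed path from `u` to `v`. -/
def IsPath (u : V) (p : List A) (v : V) : Prop := G.IsWalk u p v ∧ (G.verts u p).Nodup

/-- `c` is a (simple, directed) cycle: a closed walk with at least one arc that repeats no vertex
apart from returning to its start. -/
def IsCycle (c : List A) : Prop :=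
  c ≠ [] ∧ (∃ u, G.IsWalk u c u) ∧ (c.map G.tail).Nodup

/-- `v` can be reached from `u` by a directed walk. -/
def Reaches (u v : V) : Prop := ∃ p, G.IsWalk u p v

/-- `C` is the vertex set of a strongly connected component. -/
def IsSCC (C : Set V) : Prop := ∃ v, C = {w | G.Reaches v w ∧ G.Reaches w v}

/-- The arcs of the component with vertex set `C`. -/
def arcsOf (C : Set V) : Set A := {a | G.tail a ∈ C ∧ G.head a ∈ C}

/-- The arc `a` is useful: it is contained in a simple path from `s` to `t`. -/
def Useful (s t : V) (a : A) : Prop := ∃ p, G.IsPath s p t ∧ a ∈ p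

/-! ### Regions -/

/-- The face on the left of an arc. -/
def leftFace (a : A) : Φ := G.face (a, true)

/-- The face on the right of an arc. -/
def rightFace (a : A) : Φ := G.face (a, false)

/-- The face `f` lies in the unbounded region of the plane minus the arcs in `S`: it can be joined
to the unbounded face by crossing only arcs that are not in `S`. -/
def InOuterRegion (S : Set A) (f : Φ) : Prop :=
  Relation.ReflTransGen
    (fun x y => ∃ d : A × Bool, d.1 ∉ S ∧ G.face d = x ∧ G.face (d.1, !d.2) = y) G.outer f

/-- A cycle is clockwise if the unbounded region is on its left-hand side. -/
def IsClockwiseCycle (c : List A) : Prop :=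
  G.IsCycle c ∧ ∀ a ∈ c, G.InOuterRegion {b | b ∈ c} (G.leftFace a)

/-- The vertex `v` is on the unbounded face of the plane graph. -/
def OnOuterFace (v : V) : Prop := ∃ d, G.base d = v ∧ G.face d = G.outer

/-- The vertex `v` (not in `C`) lies in the unbounded face of the component `C`, that is,
`C` does not enclose `v`. -/
def LiesOutside (C : Set V) (v : V) : Prop :=
  v ∉ C ∧ ∃ d, G.base d = v ∧ G.InOuterRegion (G.arcsOf C) (G.face d)

/-- The boundary arcs of the component `C`: its arcs on the unbounded face of `C`. -/
def componentBoundary (C : Set V) : Set A :=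
  {a | a ∈ G.arcsOf C ∧ (G.InOuterRegion (G.arcsOf C) (G.leftFace a) ∨
    G.InOuterRegion (G.arcsOf C) (G.rightFace a))}

/-- `v` is an entrance of `C`: there is a path from `s` to `v` that meets `C` only in `v`. -/
def IsEntrance (s : V) (C : Set V) (v : V) : Prop :=
  v ∈ C ∧ ∃ p, G.IsPath s p v ∧ ∀ x ∈ G.verts s p, x ∈ C → x = v

/-- `v` is an exit of `C`: there is a path from `v` to `t` that meets `C` only in `v`. -/
def IsExit (t : V) (C : Set V) (v : V) : Prop :=
  v ∈ C ∧ ∃ p, G.IsPath v p t ∧ ∀ x ∈ G.verts v p, x ∈ C → x = v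

/-- The boundary of `C` is a cycle that consists of the path `F` from `sC` to `tC` followed by the
path `Q` from `tC` to `sC`, where `sC` is an entrance, `tC` is an exit and no internal vertex of
`Q` is an entrance or an exit. In other words `F` goes along the boundary from the first entrance
to the last exit; it is the lowest floor. -/
def IsLowestFloor (s t : V) (C : Set V) (sC tC : V) (F Q : List A) : Prop :=
  G.IsCycle (F ++ Q) ∧ (∀ a, a ∈ F ++ Q ↔ a ∈ G.componentBoundary C) ∧
  G.IsPath sC F tC ∧ G.IsPath tC Q sC ∧
  G.IsEntrance s C sC ∧ G.IsExit t C tC ∧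
  ∀ x ∈ G.internalVerts Q, ¬ G.IsEntrance s C x ∧ ¬ G.IsExit t C x

/-! ### Strips of a component

Throughout, `C` is the component that is decomposed and `Q` is the part of its boundary above which
the dummy ceiling is drawn: the dummy ceiling encloses the same faces as `Q`, but the arcs of `Q`
are inner arcs of a strip with dummy ceiling. -/

/-- The boundary arcs of a strip (the arcs of its floor and of its ceiling). -/
def boundaryArcs (S : Strip V A) : Set A := {a | a ∈ S.floor ∨ ∃ U ∈ S.ceiling, a ∈ U}

/-- The vertices on the floor. -/
def floorVerts (S : Strip V A) : Set V := {v | v ∈ G.verts S.start S.floor}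

/-- The inner vertices of the ceiling that are vertices of the graph. -/
def ceilingInnerVerts (S : Strip V A) : Set V := {v | ∃ U ∈ S.ceiling, v ∈ G.internalVerts U}

/-- The boundary vertices of a strip. -/
def boundaryVerts (S : Strip V A) : Set V := G.floorVerts S ∪ G.ceilingInnerVerts S

/-- The closed curve that encloses the region of a strip. -/
def stripCurve (Q : List A) (S : Strip V A) : Set A :=
  {a | a ∈ S.floor ∨ a ∈ S.ceiling.getD Q}

/-- The arcs of a strip: the arcs of `C` in the closed region enclosed by its floor and its
ceiling, i.e. those with an enclosed face on at least one of their sides. -/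
def stripArcs (C : Set V) (Q : List A) (S : Strip V A) : Set A :=
  {a | a ∈ G.arcsOf C ∧ (¬ G.InOuterRegion (stripCurve Q S) (G.leftFace a) ∨
    ¬ G.InOuterRegion (stripCurve Q S) (G.rightFace a))}

/-- The inner arcs of a strip. -/
def innerArcs (C : Set V) (Q : List A) (S : Strip V A) : Set A :=
  G.stripArcs C Q S \ boundaryArcs S

/-- `p` is a link from `u` to `v` in the strip `S`: a path inside `S` (without boundary arcs) that
starts and ends at boundary vertices and whose other vertices are inner vertices. -/
def IsLink (C : Set V) (Q : List A) (S : Strip V A) (u : V) (p : List A) (v : V) : Prop :=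
  p ≠ [] ∧ G.IsPath u p v ∧ (∀ a ∈ p, a ∈ G.innerArcs C Q S) ∧
  u ∈ G.boundaryVerts S ∧ v ∈ G.boundaryVerts S ∧
  ∀ x ∈ G.internalVerts p, x ∉ G.boundaryVerts S

/-- `G.Slices C Q S u f p S₁ S₂`: the path `p` is a slicing path (a forward path or an up-cross
path) of the strip `S` that starts at the floor vertex `u`, the floor arc leaving `u` is `f`, and
slicing `S` by `p` yields the up-strip `S₁` and the down-strip `S₂`. -/
inductive Slices (C : Set V) (Q : List A) :
    Strip V A → V → A → List A → Strip V A → Strip V A → Prop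
  /-- `p` is a forward path: it goes from `u` to a vertex `v` after `u` on the floor. -/
  | forward {s' t' u v : V} {U : Option (List A)} {F₁ F₂ F₃ p : List A} {f : A}
      (hp : G.IsLink C Q ⟨s', t', U, F₁ ++ (f :: F₂) ++ F₃⟩ u p v)
      (h₁ : G.IsWalk s' F₁ u) (h₂ : G.IsWalk u (f :: F₂) v) (h₃ : G.IsWalk v F₃ t') :
      Slices C Q ⟨s', t', U, F₁ ++ (f :: F₂) ++ F₃⟩ u f p
        ⟨s', t', U, F₁ ++ p ++ F₃⟩ ⟨u, v, some p, f :: F₂⟩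
  /-- `p` is an up-cross path: it goes from the floor vertex `u` to an inner vertex `v` of the
  ceiling. -/
  | upCross {s' t' u v : V} {U₁ U₂ F₁ F₂ p : List A} {f : A}
      (hp : G.IsLink C Q ⟨s', t', some (U₁ ++ U₂), F₁ ++ (f :: F₂)⟩ u p v)
      (h₁ : G.IsWalk s' F₁ u) (h₂ : G.IsWalk u (f :: F₂) t')
      (k₁ : G.IsWalk s' U₁ v) (k₂ : G.IsWalk v U₂ t') (n₁ : U₁ ≠ []) (n₂ : U₂ ≠ []) :
      Slices C Q ⟨s', t', some (U₁ ++ U₂), F₁ ++ (f :: F₂)⟩ u f p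
        ⟨s', v, some U₁, F₁ ++ p⟩ ⟨u, t', some (p ++ U₂), f :: F₂⟩

/-- When turning counterclockwise around a vertex, starting from the dart `d`, one meets the dart
`x` strictly before the dart `y` (and `y` before returning to `d`). -/
def CcwBefore (d x y : A × Bool) : Prop :=
  ∃ j k : ℕ, 0 < j ∧ j < k ∧ (G.rot ^ j) d = x ∧ (G.rot ^ k) d = y ∧
    ∀ i, 0 < i → i ≤ k → (G.rot ^ i) d ≠ d

/-- The path `p'` branches off to the right of the path `p`, where both start at the tail of the
floor arc `f`: after a common initial part `c`, the next arc `b'` of `p'` precedes the next arc `b`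
of `p` in the counterclockwise order around their common tail that starts with the arc through
which this vertex has been entered (with the floor arc `f` if `c` is empty). -/
def BranchesRight (f : A) (p' p : List A) : Prop :=
  ∃ (c r r' : List A) (b b' : A), p' = c ++ b' :: r' ∧ p = c ++ b :: r ∧
    G.CcwBefore ((c.getLast?.map fun a => (a, false)).getD (f, true)) (b', true) (b, true)

/-- `p` slices `S` into `S₁` and `S₂` and is the right-most slicing path with its start vertex. -/
def RightmostSlices (C : Set V) (Q : List A) (S : Strip V A) (p : List A) (S₁ S₂ : Strip V A) :
    Prop :=
  ∃ u f, G.Slices C Q S u f p S₁ S₂ ∧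
    ∀ p' T₁ T₂, G.Slices C Q S u f p' T₁ T₂ → ¬ G.BranchesRight f p' p

/-- `G.Decomposition C Q S 𝒮`: some run of the strip-slicing decomposition algorithm on the strip
`S` outputs the collection `𝒮`. A strip without a slicing path is output as it is; otherwise a
floor vertex is chosen at which a slicing path starts, the strip is sliced by the right-most
slicing path from there, and the two parts are decomposed recursively. -/
inductive Decomposition (C : Set V) (Q : List A) : Strip V A → List (Strip V A) → Prop
  | minimal {S : Strip V A} (h : ∀ u f p S₁ S₂, ¬ G.Slices C Q S u f p S₁ S₂) :
      Decomposition C Q S [S]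
  | slice {S S₁ S₂ : Strip V A} {p : List A} {L₁ L₂ : List (Strip V A)}
      (h : G.RightmostSlices C Q S p S₁ S₂)
      (h₁ : Decomposition C Q S₁ L₁) (h₂ : Decomposition C Q S₂ L₂) :
      Decomposition C Q S (L₁ ++ L₂)

end PlaneDigraph

namespace PlaneDigraph

variable {V A Φ : Type*} {G : PlaneDigraph V A Φ}

/-! ### Walks -/

/-! Plane topology enters only through potentials. Every circulation on the arcs is the jump, from
right to left, of a function on the faces (`exists_potential_of_circulation`, a dimension count with
Euler's formula). For a simple closed curve this function takes two values and separates the inside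
from the outside (`jordan`). Without clockwise cycles, every closed walk has a nonnegative potential
(`IsWalk.exists_nonneg_potential`). Many contradictions have the same form: next to an arc of a
closed walk a face of value 0 is found on the left, so the face on the right has a negative value.

Every strip of the decomposition is `Regular`: it is bounded by a simple closed curve and lies on
the left of its floor, and disjoint walks lead from `s` to its start and from its end to `t` without
entering the strip. Since degrees are three, a boundary vertex then has at most one inner dart
(`Regular.inner_unique`).

Now let a simple path `P` from `s` to `t` use an inner arc of an output strip. Around this arc `P`
follows inner arcs until it meets the boundary in both directions (`Regular.exists_boundary_before`,
`Regular.exists_boundary_after`): leaving the component earlier would take an entrance or exit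
inside `Q`, or a way out of an enclosed face. So `P` contains a link `L` from a boundary vertex `u`
to a boundary vertex `v`.

The vertex `u` is on the floor, because no inner arc leaves an inner vertex of a ceiling. This
invariant (`CeilingClosed`) is what right-most slicing is for: an inner arc that left the slicing
path into the down-strip would start a detour that is itself a slicing path further to the right
(`exists_branchesRight`).

If `v` is after `u` on the floor, or inside the ceiling with `u` not the end of the strip, then `L`
is a slicing path, and none is left. If `u` is the end of the strip and `v` is inside the ceiling,
then `L` and the ceiling form a closed walk of the kind that `Solid.no_closed_walk` excludes.

It remains that `v` is before `u` on the floor (`no_backward_link`). Let `B₀` be the walk from `s`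
along the floor to `v`, and `B₁` the one from `u` along the floor to `t`; they are disjoint, and `L`
is on their left. Let `z` be the last vertex of `P` before `L`, and `y` the first one after `L`, on
these walks. If `z` is on `B₁` or `y` is on `B₀`, a closed walk with a negative potential value
arises. Otherwise consider the potential of `B₁` from `u` to `y` minus that of `L` and `P` from `u`
to `y`. Its value at `z` is transported along `P` to the left side of `L` at `u`, and along `B₀` to
the right side of `L` at `v`; but these values must differ by one. -/

theorem IsWalk.append {u v w : V} {p q : List A} (hp : G.IsWalk u p v) (hq : G.IsWalk v q w) :
    G.IsWalk u (p ++ q) w := by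
  induction p generalizing u with
  | nil => cases hp; exact hq
  | cons a p ih => exact ⟨hp.1, ih hp.2⟩

theorem isWalk_append {u w : V} {p q : List A} :
    G.IsWalk u (p ++ q) w ↔ ∃ v, G.IsWalk u p v ∧ G.IsWalk v q w := by
  refine ⟨fun h => ?_, fun ⟨v, hp, hq⟩ => hp.append hq⟩
  induction p generalizing u with
  | nil => exact ⟨u, rfl, h⟩
  | cons a p ih =>
    obtain ⟨v, hp, hq⟩ := ih h.2
    exact ⟨v, ⟨h.1, hp⟩, hq⟩

theorem IsWalk.unique {u v w : V} {p : List A} (h : G.IsWalk u p v) (h' : G.IsWalk u p w) :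
    v = w := by
  induction p generalizing u with
  | nil => exact h.symm.trans h'
  | cons a p ih => exact ih h.2 h'.2

theorem IsWalk.verts_eq {u v : V} {p : List A} (h : G.IsWalk u p v) :
    G.verts u p = p.map G.tail ++ [v] := by
  induction p generalizing u with
  | nil => cases h; rfl
  | cons a p ih =>
    have := ih h.2
    simp only [verts, List.map_cons, List.cons_append] at this ⊢
    rw [h.1, this]

theorem mem_verts {u x : V} {p : List A} : x ∈ G.verts u p ↔ x = u ∨ ∃ a ∈ p, G.head a = x := by
  simp [verts]

theorem IsWalk.mem_verts {u v x : V} {p : List A} (h : G.IsWalk u p v) :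
    x ∈ G.verts u p ↔ x = v ∨ ∃ a ∈ p, G.tail a = x := by
  rw [h.verts_eq]; simp [or_comm]

theorem start_mem_verts {u : V} {p : List A} : u ∈ G.verts u p := by simp [verts]

theorem IsWalk.end_mem_verts {u v : V} {p : List A} (h : G.IsWalk u p v) : v ∈ G.verts u p :=
  h.mem_verts.2 (Or.inl rfl)

theorem head_mem_verts {u : V} {p : List A} {a : A} (ha : a ∈ p) : G.head a ∈ G.verts u p :=
  PlaneDigraph.mem_verts.2 (Or.inr ⟨a, ha, rfl⟩)

theorem IsWalk.tail_mem_verts {u v : V} {p : List A} (h : G.IsWalk u p v) {a : A} (ha : a ∈ p) :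
    G.tail a ∈ G.verts u p :=
  h.mem_verts.2 (Or.inr ⟨a, ha, rfl⟩)

theorem verts_append {u v : V} {p q : List A} (hp : G.IsWalk u p v) {x : V} :
    x ∈ G.verts u (p ++ q) ↔ x ∈ G.verts u p ∨ x ∈ G.verts v q := by
  have := hp.end_mem_verts
  simp only [verts, List.mem_cons, List.map_append, List.mem_append, List.mem_map] at this ⊢
  grind

theorem IsWalk.split_mem {u v x : V} {p : List A} (h : G.IsWalk u p v) (hx : x ∈ G.verts u p) :
    ∃ p₁ p₂, p = p₁ ++ p₂ ∧ G.IsWalk u p₁ x ∧ G.IsWalk x p₂ v := by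
  rcases PlaneDigraph.mem_verts.1 hx with rfl | ⟨a, ha, rfl⟩
  · exact ⟨[], p, rfl, rfl, h⟩
  · obtain ⟨p₁, p₂, rfl⟩ := List.append_of_mem ha
    obtain ⟨y, h₁, h₂⟩ := isWalk_append.1 h
    exact ⟨p₁ ++ [a], p₂, by simp, h₁.append ⟨h₂.1, rfl⟩, h₂.2⟩

theorem IsWalk.cons_of_ne {u v : V} {p : List A} (h : G.IsWalk u p v) (huv : u ≠ v) :
    ∃ a q, p = a :: q ∧ G.tail a = u ∧ G.IsWalk (G.head a) q v := by
  cases p with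
  | nil => exact absurd h huv
  | cons a q => exact ⟨a, q, rfl, h.1, h.2⟩

theorem isWalk_concat {u v : V} {p : List A} {a : A} :
    G.IsWalk u (p ++ [a]) v ↔ G.IsWalk u p (G.tail a) ∧ G.head a = v := by
  rw [isWalk_append]
  constructor
  · rintro ⟨x, h, rfl, h'⟩; exact ⟨h, h'⟩
  · rintro ⟨h, h'⟩; exact ⟨_, h, rfl, h'⟩

theorem IsWalk.concat_of_ne_nil {u v : V} {p : List A} (h : G.IsWalk u p v) (hp : p ≠ []) :
    ∃ q a, p = q ++ [a] ∧ G.IsWalk u q (G.tail a) ∧ G.head a = v := by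
  obtain ⟨q, a, rfl⟩ := (List.eq_nil_or_concat' p).resolve_left hp
  exact ⟨q, a, rfl, isWalk_concat.1 h⟩

/-! ### First and last hits -/

theorem IsWalk.exists_first {u v : V} {p : List A} (h : G.IsWalk u p v) (H : V → Prop)
    (hv : H v) : ∃ p₁ p₂ y, p = p₁ ++ p₂ ∧ G.IsWalk u p₁ y ∧ G.IsWalk y p₂ v ∧ H y ∧
      ∀ a ∈ p₁, ¬ H (G.tail a) := by
  induction p generalizing u with
  | nil => cases h; exact ⟨[], [], _, rfl, rfl, rfl, hv, by simp⟩
  | cons a p ih =>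
    by_cases hu : H u
    · exact ⟨[], a :: p, u, rfl, rfl, h, hu, by simp⟩
    · obtain ⟨p₁, p₂, y, rfl, h₁, h₂, hy, hp⟩ := ih h.2
      refine ⟨a :: p₁, p₂, y, rfl, ⟨h.1, h₁⟩, h₂, hy, ?_⟩
      intro b hb
      rcases List.mem_cons.1 hb with rfl | hb
      · rw [h.1]; exact hu
      · exact hp b hb

theorem IsWalk.exists_last {u v : V} {p : List A} (h : G.IsWalk u p v) (H : V → Prop)
    (hu : H u) : ∃ p₁ p₂ y, p = p₁ ++ p₂ ∧ G.IsWalk u p₁ y ∧ G.IsWalk y p₂ v ∧ H y ∧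
      ∀ a ∈ p₂, ¬ H (G.head a) := by
  induction p using List.reverseRecOn generalizing v with
  | nil => cases h; exact ⟨[], [], u, rfl, rfl, rfl, hu, by simp⟩
  | append_singleton p a ih =>
    obtain ⟨h₁, h₂⟩ := isWalk_concat.1 h
    by_cases hv : H v
    · exact ⟨p ++ [a], [], v, by simp, h, rfl, hv, by simp⟩
    · obtain ⟨p₁, p₂, y, rfl, k₁, k₂, hy, hp⟩ := ih h₁
      refine ⟨p₁, p₂ ++ [a], y, by simp, k₁, isWalk_concat.2 ⟨k₂, h₂⟩, hy, ?_⟩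
      intro b hb
      rcases List.mem_append.1 hb with hb | hb
      · exact hp b hb
      · rw [List.mem_singleton.1 hb, h₂]; exact hv

/-! ### Paths -/

theorem IsPath.of_append_left {u v w : V} {p q : List A} (h : G.IsPath u (p ++ q) w)
    (hp : G.IsWalk u p v) : G.IsPath u p v := by
  refine ⟨hp, ?_⟩
  have := h.2
  rw [verts, List.map_append, ← List.cons_append] at this
  exact this.of_append_left

theorem IsPath.of_append_right {u v w : V} {p q : List A} (h : G.IsPath u (p ++ q) w)
    (hp : G.IsWalk u p v) : G.IsPath v q w := by
  obtain ⟨v', h₁, h₂⟩ := isWalk_append.1 h.1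
  cases hp.unique h₁
  refine ⟨h₂, ?_⟩
  have := h.2
  rw [(h.1).verts_eq, List.map_append, List.append_assoc, ← h₂.verts_eq] at this
  exact this.of_append_right

theorem IsPath.append {u v w : V} {p q : List A} (hp : G.IsPath u p v) (hq : G.IsPath v q w)
    (h : ∀ a ∈ q, G.head a ∉ G.verts u p) : G.IsPath u (p ++ q) w := by
  refine ⟨hp.1.append hq.1, ?_⟩
  have e : G.verts u (p ++ q) = G.verts u p ++ q.map G.head := by simp [verts]
  rw [e, List.nodup_append]
  refine ⟨hp.2, (List.nodup_cons.1 hq.2).2, ?_⟩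
  rintro x hx y hy rfl
  obtain ⟨a, ha, rfl⟩ := List.mem_map.1 hy
  exact h a ha hx

/-- The first part and the second part of a path share only the vertex at which they meet. -/
theorem IsPath.append_disjoint {u w : V} {p q : List A} (h : G.IsPath u (p ++ q) w)
    {a : A} (ha : a ∈ q) : G.head a ∉ G.verts u p := by
  have := h.2
  have e : G.verts u (p ++ q) = G.verts u p ++ q.map G.head := by simp [verts]
  rw [e, List.nodup_append] at this
  exact fun hx => this.2.2 _ hx _ (List.mem_map_of_mem ha) rfl

theorem IsPath.append_disjoint_tail {u v w : V} {p q : List A} (h : G.IsPath u (p ++ q) w)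
    (hp : G.IsWalk u p v) {a : A} (ha : a ∈ p) : G.tail a ∉ G.verts v q := by
  obtain ⟨v', h₁, h₂⟩ := isWalk_append.1 h.1
  cases hp.unique h₁
  have := h.2
  rw [(h.1).verts_eq, List.map_append, List.append_assoc, ← h₂.verts_eq, List.nodup_append] at this
  exact fun hx => this.2.2 _ (List.mem_map_of_mem ha) _ hx rfl

theorem IsPath.eq_of_mem_mem {u v w x : V} {p q : List A} (h : G.IsPath u (p ++ q) w)
    (hp : G.IsWalk u p v) (hx : x ∈ G.verts u p) (hx' : x ∈ G.verts v q) : x = v := by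
  rcases PlaneDigraph.mem_verts.1 hx' with rfl | ⟨a, ha, rfl⟩
  · rfl
  · exact absurd hx (h.append_disjoint ha)

theorem IsPath.nodup {u v : V} {p : List A} (h : G.IsPath u p v) : p.Nodup :=
  List.Nodup.of_map _ (List.nodup_cons.1 h.2).2

theorem IsPath.start_notMem {u v : V} {p : List A} (h : G.IsPath u p v) {a : A} (ha : a ∈ p) :
    G.head a ≠ u := by
  rintro e
  exact (List.nodup_cons.1 h.2).1 (e ▸ List.mem_map_of_mem ha)

theorem IsPath.end_notMem {u v : V} {p : List A} (h : G.IsPath u p v) {a : A} (ha : a ∈ p) :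
    G.tail a ≠ v := by
  rintro e
  have := h.2
  rw [h.1.verts_eq, List.nodup_append] at this
  exact this.2.2 _ (List.mem_map_of_mem ha) _ (List.mem_singleton_self v) e

theorem IsPath.ne {u v : V} {p : List A} (h : G.IsPath u p v) (hp : p ≠ []) : u ≠ v := by
  obtain ⟨q, a, rfl, -, rfl⟩ := h.1.concat_of_ne_nil hp
  exact (h.start_notMem (by simp)).symm

theorem IsWalk.exists_path {u v : V} {p : List A} (h : G.IsWalk u p v) :
    ∃ q, G.IsPath u q v ∧ ∀ a ∈ q, a ∈ p := by
  induction p generalizing u with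
  | nil => exact ⟨[], ⟨h, by simp [verts]⟩, by simp⟩
  | cons a p ih =>
    obtain ⟨q, hq, hs⟩ := ih h.2
    by_cases hu : u ∈ G.verts (G.head a) q
    · obtain ⟨q₁, q₂, rfl, h₁, h₂⟩ := hq.1.split_mem hu
      exact ⟨q₂, hq.of_append_right h₁, fun b hb => by simp [hs b (by simp [hb])]⟩
    · refine ⟨a :: q, ⟨⟨h.1, hq.1⟩, ?_⟩, ?_⟩
      · have : G.verts u (a :: q) = u :: G.verts (G.head a) q := by simp [verts]
        rw [this]; exact List.nodup_cons.2 ⟨hu, hq.2⟩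
      · intro b hb
        rcases List.mem_cons.1 hb with rfl | hb
        · simp
        · simp [hs b hb]

/-! ### Internal vertices -/

theorem mem_internalVerts {u v x : V} {p : List A} (h : G.IsWalk u p v) :
    x ∈ G.internalVerts p ↔ ∃ p₁ p₂, p₁ ≠ [] ∧ p₂ ≠ [] ∧ p = p₁ ++ p₂ ∧ G.IsWalk u p₁ x ∧
      G.IsWalk x p₂ v := by
  rcases List.eq_nil_or_concat' p with rfl | ⟨q, a, rfl⟩
  · simp [internalVerts]
  · obtain ⟨h₁, h₂⟩ := isWalk_concat.1 h
    simp only [internalVerts, List.map_append, List.map_cons, List.map_nil,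
      List.dropLast_concat, List.mem_map]
    constructor
    · rintro ⟨b, hb, rfl⟩
      obtain ⟨q₁, q₂, rfl⟩ := List.append_of_mem hb
      obtain ⟨y, k₁, k₂⟩ := isWalk_append.1 h₁
      refine ⟨q₁ ++ [b], q₂ ++ [a], by simp, by simp, by simp, k₁.append ⟨k₂.1, rfl⟩, ?_⟩
      exact isWalk_concat.2 ⟨k₂.2, h₂⟩
    · rintro ⟨p₁, p₂, n₁, n₂, e, k₁, k₂⟩
      obtain ⟨p₃, b, rfl, -, rfl⟩ := k₁.concat_of_ne_nil n₁
      obtain ⟨p₄, c, rfl⟩ := (List.eq_nil_or_concat' p₂).resolve_left n₂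
      rw [← List.append_assoc] at e
      have := (List.append_inj' e rfl).1
      exact ⟨b, by simp [this], rfl⟩

theorem head_mem_internalVerts {p q : List A} {a : A}
    (hq : q ≠ []) (ha : a ∈ p) : G.head a ∈ G.internalVerts (p ++ q) := by
  obtain ⟨r, b, rfl⟩ := (List.eq_nil_or_concat' q).resolve_left hq
  rw [← List.append_assoc]
  simp only [internalVerts, List.map_append, List.map_cons, List.map_nil, List.dropLast_concat]
  exact List.mem_append_left _ (List.mem_map_of_mem ha)

theorem IsWalk.mem_verts_iff_internal {u v x : V} {p : List A} (h : G.IsWalk u p v) :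
    x ∈ G.verts u p ↔ x = u ∨ x = v ∨ x ∈ G.internalVerts p := by
  rcases List.eq_nil_or_concat' p with rfl | ⟨q, a, rfl⟩
  · cases h; simp [verts, internalVerts]
  · obtain ⟨h₁, h₂⟩ := isWalk_concat.1 h
    simp only [verts, internalVerts, List.map_append, List.map_cons, List.map_nil,
      List.dropLast_concat, List.mem_cons, List.mem_append, h₂]
    simp only [List.mem_map, List.not_mem_nil, or_false]; grind

theorem IsWalk.head_cases {u v : V} {p : List A} (h : G.IsWalk u p v) {a : A} (ha : a ∈ p) :
    G.head a = v ∨ G.head a ∈ G.internalVerts p := by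
  rcases List.eq_nil_or_concat' p with rfl | ⟨q, b, rfl⟩
  · simp at ha
  · obtain ⟨h₁, h₂⟩ := isWalk_concat.1 h
    rcases List.mem_append.1 ha with ha | ha
    · exact Or.inr (head_mem_internalVerts (by simp) ha)
    · rw [List.mem_singleton.1 ha]; exact Or.inl h₂

theorem IsWalk.tail_cases {u v : V} {p : List A} (h : G.IsWalk u p v) {a : A} (ha : a ∈ p) :
    G.tail a = u ∨ G.tail a ∈ G.internalVerts p := by
  obtain ⟨p₁, p₂, rfl⟩ := List.append_of_mem ha
  obtain ⟨y, h₁, h₂⟩ := isWalk_append.1 h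
  have hy : G.tail a = y := h₂.1
  rcases p₁.eq_nil_or_concat' with rfl | ⟨q, b, rfl⟩
  · exact Or.inl (hy.trans (id h₁ : u = y).symm)
  · right
    rw [hy, ← (isWalk_concat.1 h₁).2]
    exact head_mem_internalVerts (by simp) (by simp)

theorem IsPath.internal_ne {u v x : V} {p : List A} (h : G.IsPath u p v)
    (hx : x ∈ G.internalVerts p) : x ≠ u ∧ x ≠ v := by
  obtain ⟨p₁, p₂, n₁, n₂, rfl, k₁, k₂⟩ := (mem_internalVerts h.1).1 hx
  exact ⟨((h.of_append_left k₁).ne n₁).symm, (h.of_append_right k₁).ne n₂⟩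

theorem IsWalk.reaches_of_mem {u v x : V} {p : List A} (h : G.IsWalk u p v)
    (hx : x ∈ G.verts u p) : G.Reaches u x ∧ G.Reaches x v := by
  obtain ⟨p₁, p₂, -, h₁, h₂⟩ := h.split_mem hx
  exact ⟨⟨_, h₁⟩, ⟨_, h₂⟩⟩

theorem Reaches.trans {u v w : V} (h : G.Reaches u v) (h' : G.Reaches v w) : G.Reaches u w := by
  obtain ⟨p, hp⟩ := h
  obtain ⟨q, hq⟩ := h'
  exact ⟨_, hp.append hq⟩

theorem IsSCC.reaches {C : Set V} (h : G.IsSCC C) {x y : V} (hx : x ∈ C) (hy : y ∈ C) :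
    G.Reaches x y := by
  obtain ⟨v, rfl⟩ := h
  exact hx.2.trans hy.1

theorem IsSCC.mem_of_between {C : Set V} (h : G.IsSCC C) {x y z : V} (hx : x ∈ C) (hz : z ∈ C)
    (h₁ : G.Reaches x y) (h₂ : G.Reaches y z) : y ∈ C := by
  obtain ⟨v, rfl⟩ := h
  exact ⟨hx.1.trans h₁, h₂.trans hz.2⟩

theorem IsSCC.mem_of_walk {C : Set V} (h : G.IsSCC C) {x y z : V} {p : List A}
    (hp : G.IsWalk x p z) (hx : x ∈ C) (hz : z ∈ C) (hy : y ∈ G.verts x p) : y ∈ C :=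
  h.mem_of_between hx hz (hp.reaches_of_mem hy).1 (hp.reaches_of_mem hy).2

theorem IsSCC.arcs_of_walk {C : Set V} (h : G.IsSCC C) {x z : V} {p : List A}
    (hp : G.IsWalk x p z) (hx : x ∈ C) (hz : z ∈ C) {a : A} (ha : a ∈ p) : a ∈ G.arcsOf C :=
  ⟨h.mem_of_walk hp hx hz (hp.tail_mem_verts ha), h.mem_of_walk hp hx hz (head_mem_verts ha)⟩

/-! ### Multiplicities -/

open Classical in
/-- The number of times that the walk `p` uses the arc `a`, as a rational number. -/
noncomputable def mult (p : List A) (a : A) : ℚ := (p.map fun b => if b = a then (1 : ℚ) else 0).sum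

@[simp] theorem mult_nil (a : A) : mult [] a = 0 := by simp [mult]

theorem mult_append (p q : List A) (a : A) : mult (p ++ q) a = mult p a + mult q a := by
  simp [mult]

open Classical in
theorem mult_cons (b : A) (p : List A) (a : A) :
    mult (b :: p) a = (if b = a then 1 else 0) + mult p a := by
  simp [mult]

theorem mult_nonneg (p : List A) (a : A) : 0 ≤ mult p a := by
  induction p with
  | nil => simp
  | cons b p ih => rw [mult_cons]; split_ifs <;> linarith

theorem mult_of_notMem {p : List A} {a : A} (h : a ∉ p) : mult p a = 0 := by
  induction p with
  | nil => simp
  | cons b p ih =>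
    rw [mult_cons, ih (fun h' => h (by simp [h'])), if_neg (fun e => h (by simp [e]))]; simp

theorem one_le_mult {p : List A} {a : A} (h : a ∈ p) : 1 ≤ mult p a := by
  obtain ⟨q, r, rfl⟩ := List.append_of_mem h
  rw [mult_append, mult_cons, if_pos rfl]
  linarith [mult_nonneg q a, mult_nonneg r a]

theorem mult_of_mem {p : List A} (hp : p.Nodup) {a : A} (h : a ∈ p) : mult p a = 1 := by
  obtain ⟨q, r, rfl⟩ := List.append_of_mem h
  have h₁ : a ∉ q ∧ a ∉ r := by
    rw [List.nodup_append] at hp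
    exact ⟨fun h => hp.2.2 _ h a (by simp) rfl, (List.nodup_cons.1 hp.2.1).1⟩
  rw [mult_append, mult_cons, if_pos rfl, mult_of_notMem h₁.1, mult_of_notMem h₁.2]
  norm_num

/-- The sum telescopes along the walk. Hence a closed walk, or the difference of two walks with
common ends, is a circulation. -/
theorem IsWalk.sum_mult [Fintype A] [DecidableEq V] {u v : V} {p : List A} (h : G.IsWalk u p v)
    (x : V) : ∑ a, ((if G.head a = x then 1 else 0) - (if G.tail a = x then 1 else 0)) * mult p a =
      (if v = x then (1 : ℚ) else 0) - (if u = x then 1 else 0) := by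
  classical
  induction p generalizing u with
  | nil => cases h; simp
  | cons a p ih =>
    have := ih h.2
    simp only [mult_cons, mul_add, Finset.sum_add_distrib, this]
    simp [h.1]

/-! ### Potentials -/

/-- `h` is the potential on the faces, normalized by `h G.outer = 0`, whose jump from the right to
the left of the arc `a` is `c a`. -/
def IsPotential (G : PlaneDigraph V A Φ) (h : Φ → ℚ) (c : A → ℚ) : Prop :=
  h G.outer = 0 ∧ ∀ a, h (G.leftFace a) - h (G.rightFace a) = c a

theorem IsPotential.add {h h' : Φ → ℚ} {c c' : A → ℚ} (H : G.IsPotential h c)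
    (H' : G.IsPotential h' c') : G.IsPotential (h + h') (c + c') := by
  refine ⟨by simp [H.1, H'.1], fun a => ?_⟩
  have h₁ := H.2 a
  have h₂ := H'.2 a
  simp only [Pi.add_apply]
  linarith

/-- The jumps determine the value across each dart, and every face is reached from the outer one,
where the value is fixed. -/
theorem IsPotential.unique {h h' : Φ → ℚ} {c : A → ℚ} (H : G.IsPotential h c)
    (H' : G.IsPotential h' c) : h = h' := by
  funext f
  induction G.face_connected G.outer f with
  | refl => rw [H.1, H'.1]
  | tail _ hd ih =>
    obtain ⟨⟨a, b⟩, rfl, rfl⟩ := hd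
    have h₁ := H.2 a
    have h₂ := H'.2 a
    simp only [leftFace, rightFace] at h₁ h₂
    cases b <;> simp only [Bool.not_true, Bool.not_false] at * <;> linarith

theorem base_rot (d : A × Bool) : G.base (G.rot d) = G.base d :=
  ((G.rot_sameCycle d (G.rot d)).1 (Equiv.Perm.sameCycle_apply_right.2 (.refl _ _))).symm

/-- The jumps of a potential around a vertex cancel out. -/
theorem sum_jump [Fintype A] [DecidableEq V] (h : Φ → ℚ) (x : V) :
    ∑ a, ((if G.head a = x then 1 else 0) - (if G.tail a = x then (1 : ℚ) else 0)) *
      (h (G.leftFace a) - h (G.rightFace a)) = 0 := by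
  -- The face on the left of `d` is the face on the right of `rot d`, and `rot` permutes the darts
  -- at `x`; so left and right faces have the same total.
  have key : ∑ d : A × Bool, (if G.base d = x then h (G.face d) else 0) =
      ∑ d : A × Bool, (if G.base d = x then h (G.face (d.1, !d.2)) else 0) := by
    rw [← Equiv.sum_comp G.rot (fun d => if G.base d = x then h (G.face (d.1, !d.2)) else 0)]
    exact Finset.sum_congr rfl fun d _ => by rw [base_rot, G.face_rot]
  rw [Fintype.sum_prod_type, Fintype.sum_prod_type] at key
  simp only [Fintype.sum_bool, base, Bool.not_true, Bool.not_false, if_true,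
    Bool.false_eq_true, if_false] at key
  rw [← sub_eq_zero, ← Finset.sum_sub_distrib] at key
  rw [← neg_eq_zero, ← Finset.sum_neg_distrib]
  refine Eq.trans ?_ key
  refine Finset.sum_congr rfl fun a _ => ?_
  simp only [leftFace, rightFace]
  split_ifs <;> ring

/-- Every circulation is the jump of a potential on the faces. -/
theorem exists_potential_of_circulation [Finite V] [Fintype A] [Finite Φ] [DecidableEq V]
    (c : A → ℚ) (hc : ∀ x, ∑ a, ((if G.head a = x then 1 else 0) -
      (if G.tail a = x then (1 : ℚ) else 0)) * c a = 0) : ∃ h, G.IsPotential h c := by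
  classical
  have := Fintype.ofFinite V
  have := Fintype.ofFinite Φ
  let M : Matrix V A ℚ := fun x a =>
    (if G.head a = x then 1 else 0) - (if G.tail a = x then (1 : ℚ) else 0)
  have hM : ∀ c', M.mulVecLin c' = 0 ↔ ∀ x, ∑ a, ((if G.head a = x then 1 else 0) -
      (if G.tail a = x then (1 : ℚ) else 0)) * c' a = 0 := fun c' => by
    rw [funext_iff]; rfl
  let δ : (Φ → ℚ) →ₗ[ℚ] (A → ℚ) :=
    { toFun := fun h a => h (G.leftFace a) - h (G.rightFace a)
      map_add' := fun h h' => by funext a; simp only [Pi.add_apply]; ring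
      map_smul' := fun r h => by
        funext a; simp only [Pi.smul_apply, smul_eq_mul, RingHom.id_apply]; ring }
  have hle : LinearMap.range δ ≤ LinearMap.ker M.mulVecLin := by
    rintro _ ⟨h, rfl⟩
    exact LinearMap.mem_ker.2 ((hM _).2 fun x => sum_jump h x)
  -- the kernel of `δ` consists of the constant functions
  have hδ : Module.finrank ℚ (LinearMap.ker δ) ≤ 1 := by
    have : LinearMap.ker δ ≤ Submodule.span ℚ {fun _ => (1 : ℚ)} := by
      intro h hh
      rw [Submodule.mem_span_singleton]
      refine ⟨h G.outer, ?_⟩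
      funext f
      have e : ∀ a, h (G.leftFace a) - h (G.rightFace a) = 0 := fun a =>
        congrFun (LinearMap.mem_ker.1 hh) a
      simp only [Pi.smul_apply, smul_eq_mul, mul_one]
      induction G.face_connected G.outer f with
      | refl => rfl
      | tail _ hd ih =>
        obtain ⟨⟨a, b⟩, rfl, rfl⟩ := hd
        have h₁ := e a
        simp only [leftFace, rightFace] at h₁
        cases b <;> simp only [Bool.not_true, Bool.not_false] at * <;> linarith
    exact (Submodule.finrank_mono this).trans
      (finrank_span_singleton (fun h₀ => one_ne_zero (congrFun h₀ G.outer))).le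
  -- the kernel of the transpose consists of the functions that are constant on the components
  have hT : Module.finrank ℚ (LinearMap.ker M.transpose.mulVecLin) ≤
      Nat.card (Quot fun x y : V => ∃ a : A, G.tail a = x ∧ G.head a = y) := by
    let r := fun x y : V => ∃ a : A, G.tail a = x ∧ G.head a = y
    have hker : LinearMap.ker M.transpose.mulVecLin ≤
        LinearMap.range (LinearMap.funLeft ℚ ℚ (Quot.mk r)) := by
      intro g hg
      have e : ∀ a, g (G.head a) - g (G.tail a) = 0 := fun a => by
        have : ∑ x, ((if G.head a = x then 1 else 0) - (if G.tail a = x then (1 : ℚ) else 0)) *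
            g x = 0 := congrFun (LinearMap.mem_ker.1 hg) a
        simpa [sub_mul, Finset.sum_sub_distrib] using this
      refine ⟨Quot.lift g ?_, rfl⟩
      rintro _ _ ⟨a, rfl, rfl⟩
      linarith [e a]
    have := Fintype.ofFinite (Quot r)
    calc _ ≤ _ := Submodule.finrank_mono hker
      _ ≤ _ := LinearMap.finrank_range_le _
      _ = Nat.card (Quot r) := by
        rw [Module.finrank_fintype_fun_eq_card, Nat.card_eq_fintype_card]
  have r₁ := LinearMap.finrank_range_add_finrank_ker δ
  have r₂ := LinearMap.finrank_range_add_finrank_ker M.mulVecLin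
  have r₃ := LinearMap.finrank_range_add_finrank_ker M.transpose.mulVecLin
  have r₄ : Module.finrank ℚ (LinearMap.range M.transpose.mulVecLin) =
      Module.finrank ℚ (LinearMap.range M.mulVecLin) := M.rank_transpose
  have r₅ := G.euler
  rw [Nat.card_eq_fintype_card, Nat.card_eq_fintype_card, Nat.card_eq_fintype_card] at r₅
  rw [Module.finrank_fintype_fun_eq_card] at r₁ r₂ r₃
  -- By rank-nullity and Euler's formula, the circulations have dimension at most |A| - |V| +
  -- #components = |Φ| - 1, which is at most the dimension of the range of `δ`.
  have heq := Submodule.eq_of_le_of_finrank_le hle (by omega)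
  have hmem : c ∈ LinearMap.range δ := heq ▸ LinearMap.mem_ker.2 ((hM c).2 hc)
  obtain ⟨h, rfl⟩ := hmem
  refine ⟨fun f => h f - h G.outer, by simp, fun a => ?_⟩
  change _ = h (G.leftFace a) - h (G.rightFace a)
  ring

/-- The divergences of the two walks cancel, so their difference is a circulation. -/
theorem exists_potential [Finite V] [Finite A] [Finite Φ] {u v : V} {p q : List A}
    (hp : G.IsWalk u p v) (hq : G.IsWalk u q v) :
    ∃ h, G.IsPotential h (fun a => mult p a - mult q a) := by
  classical
  have := Fintype.ofFinite A
  refine exists_potential_of_circulation _ fun x => ?_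
  simp only [mul_sub, Finset.sum_sub_distrib, hp.sum_mult, hq.sum_mult, sub_self]

theorem exists_potential_closed [Finite V] [Finite A] [Finite Φ] {u : V} {p : List A}
    (hp : G.IsWalk u p u) : ∃ h, G.IsPotential h (mult p) := by
  obtain ⟨h, hh⟩ := exists_potential hp (show G.IsWalk u [] u from rfl)
  exact ⟨h, hh.1, fun a => by rw [hh.2]; simp⟩

/-! ### Turning around a vertex -/

/-- The dart `d` traversed in the opposite direction. -/
abbrev rev (d : A × Bool) : A × Bool := (d.1, !d.2)

@[simp] theorem rev_rev (d : A × Bool) : rev (rev d) = d := by simp [rev]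

theorem base_true (a : A) : G.base (a, true) = G.tail a := rfl

theorem base_false (a : A) : G.base (a, false) = G.head a := rfl

/-- No arc at the vertex `x` separates faces with different values of `g`. -/
def Flat {α : Type*} (G : PlaneDigraph V A Φ) (g : Φ → α) (x : V) : Prop :=
  ∀ d, G.base d = x → g (G.face d) = g (G.face (rev d))

theorem sameCycle_of_base {d e : A × Bool} (h : G.base d = G.base e) : G.rot.SameCycle d e :=
  (G.rot_sameCycle d e).2 h

theorem base_rot_pow (n : ℕ) (d : A × Bool) : G.base ((G.rot ^ n) d) = G.base d := by
  induction n with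
  | zero => rfl
  | succ n ih => rw [pow_succ', Equiv.Perm.mul_apply, base_rot, ih]

/-- If only the darts `d` and `e` at a vertex may separate faces with different values of `g`,
then the values to the left of `d` and to the right of `e` are the same. -/
theorem face_eq_of_two [Finite A] {α : Type*} (g : Φ → α) {d e : A × Bool}
    (hb : G.base d = G.base e) (hne : d ≠ e)
    (hflat : ∀ x, G.base x = G.base d → x ≠ d → x ≠ e → g (G.face x) = g (G.face (rev x))) :
    g (G.face d) = g (G.face (rev e)) := by
  classical
  obtain ⟨m, hm⟩ : ∃ m : ℕ, (G.rot ^ m) d = e := (sameCycle_of_base hb).exists_nat_pow_eq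
  have hex : ∃ m : ℕ, (G.rot ^ m) d = e := ⟨m, hm⟩
  -- Turning counterclockwise from `d`, `n` is the first time that `e` is met; every dart passed
  -- strictly in between is flat for `g`.
  obtain ⟨n, hn, hmin⟩ : ∃ n : ℕ, (G.rot ^ n) d = e ∧ ∀ j < n, (G.rot ^ j) d ≠ e :=
    ⟨Nat.find hex, Nat.find_spec hex, fun j hj => Nat.find_min hex hj⟩
  have key : ∀ j < n, g (G.face ((G.rot ^ j) d)) = g (G.face d) := by
    intro j
    induction j with
    | zero => intro _; rfl
    | succ j ih =>
      intro hj
      rw [← ih (by omega)]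
      rw [hflat _ (base_rot_pow _ _) ?_ (hmin _ hj), pow_succ', Equiv.Perm.mul_apply]
      · exact congrArg g (G.face_rot _)
      · intro h
        -- Coming back to `d` before `e` would allow skipping a full turn, against the minimality of
        -- `n`.
        refine hmin (n - (j + 1)) (by omega) ?_
        rw [← hn]
        conv_rhs => rw [show n = (n - (j + 1)) + (j + 1) by omega, pow_add, Equiv.Perm.mul_apply, h]
  have hn0 : n ≠ 0 := fun h => hne (by rw [h] at hn; exact hn)
  obtain ⟨k, hk⟩ := Nat.exists_eq_succ_of_ne_zero hn0
  rw [← key k (by omega), ← hn, hk, pow_succ', Equiv.Perm.mul_apply]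
  exact (congrArg g (G.face_rot _)).symm

theorem Flat.face_eq [Finite A] {α : Type*} {g : Φ → α} {x : V} (h : G.Flat g x) {d e : A × Bool}
    (hd : G.base d = x) (he : G.base e = x) : g (G.face d) = g (G.face e) := by
  by_cases hne : d = e
  · rw [hne]
  · rw [h e he]
    exact face_eq_of_two g (hd.trans he.symm) hne fun y hy _ _ => h y (hy.trans hd)

theorem Flat.face_rev_eq [Finite A] {α : Type*} {g : Φ → α} {x : V} (h : G.Flat g x)
    {d e : A × Bool} (hd : G.base d = x) (he : G.base e = x) :
    g (G.face d) = g (G.face (rev e)) := by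
  rw [← h e he]; exact h.face_eq hd he

/-- Along a walk all of whose tails are flat, the value of `g` does not change. -/
theorem IsWalk.flat_tails [Finite A] {α : Type*} {g : Φ → α} {u v : V} {p : List A}
    (hp : G.IsWalk u p v) (h : ∀ a ∈ p, G.Flat g (G.tail a)) {d : A × Bool} (hd : G.base d = u) :
    ∀ a ∈ p, g (G.leftFace a) = g (G.face d) ∧ g (G.rightFace a) = g (G.face d) := by
  induction p generalizing u d with
  | nil => simp
  | cons b p ih =>
    have hb : G.Flat g u := hp.1 ▸ h b (by simp)
    have h₁ : g (G.leftFace b) = g (G.face d) := hb.face_eq hp.1 hd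
    have h₂ : g (G.rightFace b) = g (G.face d) := (hb.face_rev_eq hd (e := (b, true)) hp.1).symm
    intro a ha
    rcases List.mem_cons.1 ha with rfl | ha
    · exact ⟨h₁, h₂⟩
    · obtain ⟨h₃, h₄⟩ := ih hp.2 (fun a ha => h a (by simp [ha])) (d := (b, false)) rfl a ha
      have h₅ : g (G.face (b, false)) = g (G.face d) := h₂
      exact ⟨h₃.trans h₅, h₄.trans h₅⟩

/-- Along a walk all of whose heads are flat, the value of `g` does not change. -/
theorem IsWalk.flat_heads [Finite A] {α : Type*} {g : Φ → α} {u v : V} {p : List A}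
    (hp : G.IsWalk u p v) (h : ∀ a ∈ p, G.Flat g (G.head a)) {d : A × Bool} (hd : G.base d = v) :
    ∀ a ∈ p, g (G.leftFace a) = g (G.face d) ∧ g (G.rightFace a) = g (G.face d) := by
  induction p using List.reverseRecOn generalizing v d with
  | nil => simp
  | append_singleton p b ih =>
    obtain ⟨hp', hbv⟩ := isWalk_concat.1 hp
    have hb : G.Flat g v := hbv ▸ h b (by simp)
    have h₁ : g (G.rightFace b) = g (G.face d) := hb.face_eq hbv hd
    have h₂ : g (G.leftFace b) = g (G.face d) := (hb.face_rev_eq hd (e := (b, false)) hbv).symm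
    intro a ha
    rcases List.mem_append.1 ha with ha | ha
    · obtain ⟨h₃, h₄⟩ := ih hp' (fun a ha => h a (by simp [ha])) (d := (b, true)) rfl a ha
      have h₅ : g (G.face (b, true)) = g (G.face d) := h₂
      exact ⟨h₃.trans h₅, h₄.trans h₅⟩
    · rw [List.mem_singleton.1 ha]
      exact ⟨h₂, h₁⟩

/-! ### Regions -/

/-- The face `g` can be reached from the face `f` without crossing an arc in `K`. -/
def Joined (G : PlaneDigraph V A Φ) (K : Set A) (f g : Φ) : Prop :=
  Relation.ReflTransGen
    (fun x y => ∃ d : A × Bool, d.1 ∉ K ∧ G.face d = x ∧ G.face (rev d) = y) f g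

theorem Joined.symm {K : Set A} {f g : Φ} (h : G.Joined K f g) : G.Joined K g f := by
  induction h with
  | refl => exact .refl
  | tail _ hd ih =>
    obtain ⟨d, hd, rfl, rfl⟩ := hd
    exact .head ⟨rev d, hd, rfl, by rw [rev_rev]⟩ ih

theorem Joined.trans {K : Set A} {f g k : Φ} (h : G.Joined K f g) (h' : G.Joined K g k) :
    G.Joined K f k := Relation.ReflTransGen.trans h h'

theorem joined_rev {K : Set A} {d : A × Bool} (hd : d.1 ∉ K) :
    G.Joined K (G.face d) (G.face (rev d)) := .single ⟨d, hd, rfl, rfl⟩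

theorem Joined.eq_of_flat {α : Type*} {K : Set A} {f g : Φ} (h : G.Joined K f g) (φ : Φ → α)
    (hφ : ∀ a ∉ K, φ (G.leftFace a) = φ (G.rightFace a)) : φ f = φ g := by
  induction h with
  | refl => rfl
  | tail _ hd ih =>
    obtain ⟨⟨a, b⟩, ha, rfl, rfl⟩ := hd
    rw [ih]
    cases b
    · exact (hφ a ha).symm
    · exact hφ a ha

theorem inOuterRegion_rev {K : Set A} {d : A × Bool} (hd : d.1 ∉ K) :
    G.InOuterRegion K (G.face d) ↔ G.InOuterRegion K (G.face (rev d)) :=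
  ⟨fun h => Joined.trans h (joined_rev hd), fun h => Joined.trans h (joined_rev hd).symm⟩

theorem inOuterRegion_left_iff_right {K : Set A} {a : A} (ha : a ∉ K) :
    G.InOuterRegion K (G.leftFace a) ↔ G.InOuterRegion K (G.rightFace a) :=
  inOuterRegion_rev (d := (a, true)) ha

theorem inOuterRegion_outer (K : Set A) : G.InOuterRegion K G.outer := Relation.ReflTransGen.refl

/-- Shrinking a set of arcs enlarges the outer region; more generally, it may be replaced by a set
of arcs that are in the closed region enclosed by it. -/
theorem InOuterRegion.mono {K L : Set A} {f : Φ} (h : G.InOuterRegion K f)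
    (hL : ∀ a ∈ L, a ∉ K → ¬ G.InOuterRegion K (G.leftFace a) ∨
      ¬ G.InOuterRegion K (G.rightFace a)) : G.InOuterRegion L f := by
  induction h with
  | refl => exact inOuterRegion_outer L
  | @tail x y hx hd ih =>
    obtain ⟨d, hK, rfl, rfl⟩ := hd
    have hx' : G.InOuterRegion K (G.face d) := hx
    -- If the crossed arc were in `L`, it would have a side enclosed by `K`; but both its sides are
    -- in the outer region of `K`.
    refine (inOuterRegion_rev fun hdL => ?_).1 ih
    have hy := (inOuterRegion_rev hK).1 hx'
    obtain ⟨a, b⟩ := d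
    rcases hL a hdL hK with h | h <;> cases b
    exacts [h hy, h hx', h hx', h hy]

theorem Flat.of_notMem {K : Set A} {x : V} (h : ∀ d, G.base d = x → d.1 ∉ K) :
    G.Flat (G.InOuterRegion K) x := fun d hd => propext (inOuterRegion_rev (h d hd))

theorem IsPotential.flat {h : Φ → ℚ} {c : A → ℚ} (H : G.IsPotential h c) {x : V}
    (hx : ∀ d, G.base d = x → c d.1 = 0) : G.Flat h x := by
  rintro ⟨a, b⟩ hd
  have h₁ := H.2 a
  rw [show c a = 0 from hx _ hd] at h₁
  simp only [leftFace, rightFace] at h₁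
  cases b <;> simp only [rev, Bool.not_true, Bool.not_false] <;> linarith

/-! ### The Jordan curve theorem -/

/-- The list of darts `p` is a walk from `u` to `v`. -/
def IsDartWalk (G : PlaneDigraph V A Φ) : V → List (A × Bool) → V → Prop
  | u, [], v => u = v
  | u, d :: p, v => G.base d = u ∧ IsDartWalk G (G.base (rev d)) p v

theorem IsDartWalk.append {u v w : V} {p q : List (A × Bool)} (hp : G.IsDartWalk u p v)
    (hq : G.IsDartWalk v q w) : G.IsDartWalk u (p ++ q) w := by
  induction p generalizing u with
  | nil => cases hp; exact hq
  | cons a p ih => exact ⟨hp.1, ih hp.2⟩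

theorem IsWalk.darts {u v : V} {p : List A} (hp : G.IsWalk u p v) :
    G.IsDartWalk u (p.map fun a => (a, true)) v := by
  induction p generalizing u with
  | nil => exact hp
  | cons a p ih => exact ⟨hp.1, ih hp.2⟩

theorem IsWalk.darts_reverse {u v : V} {p : List A} (hp : G.IsWalk u p v) :
    G.IsDartWalk v (p.reverse.map fun a => (a, false)) u := by
  induction p generalizing u with
  | nil => exact hp.symm
  | cons a p ih =>
    rw [List.reverse_cons, List.map_append]
    exact (ih hp.2).append ⟨rfl, hp.1⟩

theorem IsDartWalk.bases {u v : V} {p : List (A × Bool)} (hp : G.IsDartWalk u p v) :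
    u :: p.map (fun d => G.base (rev d)) = p.map G.base ++ [v] := by
  induction p generalizing u with
  | nil => cases hp; rfl
  | cons d p ih => rw [List.map_cons, List.map_cons, ih hp.2, hp.1]; rfl

/-- The Jordan curve theorem for the simple closed curve that is formed by the darts in `D`: it has
two sides, the one where a potential with jump `1` across the curve vanishes is the outer one. -/
theorem jordan [Finite A] {u : V} {D : List (A × Bool)} (hw : G.IsDartWalk u D u) (hD : D ≠ [])
    (hbase : (D.map G.base).Nodup) (harc : (D.map Prod.fst).Nodup) {K : Set A}
    (hK : ∀ a, a ∈ K ↔ ∃ d ∈ D, d.1 = a) {h : Φ → ℚ} (h₀ : h G.outer = 0)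
    (h₁ : ∀ d ∈ D, h (G.face d) - h (G.face (rev d)) = 1)
    (h₂ : ∀ a ∉ K, h (G.leftFace a) = h (G.rightFace a)) :
    (∀ f, h f = 0 ↔ G.InOuterRegion K f) ∧
      ((∀ f, h f = 0 ∨ h f = 1) ∨ ∀ f, h f = 0 ∨ h f = -1) := by
  -- The end vertices of the darts are a cyclic shift of their start vertices.
  have hend : (D.map fun d => G.base (rev d)).Nodup := by
    have h := hw.bases
    have : (D.map fun d => G.base (rev d)).Perm (D.map G.base) := by
      have h' : (u :: D.map fun d => G.base (rev d)).Perm (u :: D.map G.base) := by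
        rw [h]; exact List.perm_append_singleton _ _
      exact h'.cons_inv
    exact this.nodup_iff.2 hbase
  -- consecutive darts have the same left-hand side and the same right-hand side
  have two : ∀ d ∈ D, ∀ e ∈ D, G.base (rev d) = G.base e → ∀ x, G.base x = G.base e →
      x ≠ e → x ≠ rev d → x.1 ∉ K := by
    intro d hd e he hde x hx hxe hxd hxK
    obtain ⟨y, hy, hyx⟩ := (hK _).1 hxK
    have : x = y ∨ x = rev y := by
      obtain ⟨a, b⟩ := x; obtain ⟨a', b'⟩ := y
      cases hyx
      cases b <;> cases b' <;> simp [rev]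
    rcases this with rfl | rfl
    · exact hxe (List.inj_on_of_nodup_map hbase hy he hx)
    · refine hxd (congrArg rev (List.inj_on_of_nodup_map hend hy hd ?_))
      exact hx.trans hde.symm
  have hne : ∀ d ∈ D, ∀ e ∈ D, rev d ≠ e := by
    intro d hd e he h
    have : d = e := List.inj_on_of_nodup_map harc hd he (by rw [← h])
    subst this
    have := congrArg Prod.snd h
    simp at this
  have left_step : ∀ d ∈ D, ∀ e ∈ D, G.base (rev d) = G.base e → ∀ f,
      G.Joined K f (G.face d) = G.Joined K f (G.face e) := by
    intro d hd e he hde f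
    have := face_eq_of_two (G.Joined K f) (d := e) (e := rev d) hde.symm (hne d hd e he).symm ?_
    · rw [rev_rev] at this; exact this.symm
    · intro x hx hxe hxd
      have hxK := two d hd e he hde x hx hxe hxd
      exact propext ⟨fun h => h.trans (joined_rev hxK), fun h => h.trans (joined_rev hxK).symm⟩
  have right_step : ∀ d ∈ D, ∀ e ∈ D, G.base (rev d) = G.base e → ∀ f,
      G.Joined K f (G.face (rev d)) = G.Joined K f (G.face (rev e)) := by
    intro d hd e he hde f
    refine face_eq_of_two (G.Joined K f) (d := rev d) (e := e) hde (hne d hd e he) ?_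
    intro x hx hxd hxe
    have hxK := two d hd e he hde x (hx.trans hde) hxe hxd
    exact propext ⟨fun h => h.trans (joined_rev hxK), fun h => h.trans (joined_rev hxK).symm⟩
  obtain ⟨d₀, D', rfl⟩ := List.exists_cons_of_ne_nil hD
  have chain : ∀ (E : List (A × Bool)) (d : A × Bool), d ∈ d₀ :: D' → (∀ e ∈ E, e ∈ d₀ :: D') →
      (∃ v, G.IsDartWalk (G.base (rev d)) E v) → ∀ f, ∀ e ∈ E,
        G.Joined K f (G.face d) = G.Joined K f (G.face e) ∧
        G.Joined K f (G.face (rev d)) = G.Joined K f (G.face (rev e)) := by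
    intro E
    induction E with
    | nil => intro d _ _ _ f e he; simp at he
    | cons b E ih =>
      rintro d hd hE ⟨v, hv⟩ f e he
      have hb := hE b (by simp)
      have hl := left_step d hd b hb hv.1.symm f
      have hr := right_step d hd b hb hv.1.symm f
      rcases List.mem_cons.1 he with rfl | he
      · exact ⟨hl, hr⟩
      · obtain ⟨h₃, h₄⟩ := ih b hb (fun e he => hE e (by simp [he])) ⟨v, hv.2⟩ f e he
        exact ⟨hl.trans h₃, hr.trans h₄⟩
  have sides : ∀ e ∈ d₀ :: D', G.Joined K (G.face e) (G.face d₀) ∧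
      G.Joined K (G.face (rev e)) (G.face (rev d₀)) := by
    intro e he
    rcases List.mem_cons.1 he with rfl | he'
    · exact ⟨.refl, .refl⟩
    · have := chain D' d₀ (by simp) (fun e he => by simp [he]) ⟨u, hw.2⟩
      exact ⟨(this (G.face e) e he').1 ▸ .refl, (this (G.face (rev e)) e he').2 ▸ .refl⟩
  -- A sequence of faces from `x` to `f` either never crosses the curve, or both its ends are
  -- connected to a side of the curve. All arcs of the curve have the same two sides as `d₀`, so
  -- there are at most two regions.
  have classify : ∀ x f, G.Joined K x f ∨
      ((G.Joined K x (G.face d₀) ∨ G.Joined K x (G.face (rev d₀))) ∧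
        (G.Joined K f (G.face d₀) ∨ G.Joined K f (G.face (rev d₀)))) := by
    intro x f
    induction G.face_connected x f with
    | refl => exact Or.inl .refl
    | @tail y z _ hd ih =>
      obtain ⟨d, rfl, rfl⟩ := hd
      change _ ∨ (_ ∧ (G.Joined K (G.face (rev d)) _ ∨ G.Joined K (G.face (rev d)) _))
      by_cases hdK : d.1 ∈ K
      · obtain ⟨e, he, hed⟩ := (hK _).1 hdK
        have hde : d = e ∨ d = rev e := by
          obtain ⟨a, b⟩ := d; obtain ⟨a', b'⟩ := e
          cases hed
          cases b <;> cases b' <;> simp [rev]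
        obtain ⟨hl, hr⟩ := sides e he
        right
        rcases hde with rfl | rfl
        · refine ⟨?_, Or.inr hr⟩
          rcases ih with ih | ih
          · exact Or.inl (ih.trans hl)
          · exact ih.1
        · rw [rev_rev]
          refine ⟨?_, Or.inl hl⟩
          rcases ih with ih | ih
          · exact Or.inr (ih.trans hr)
          · exact ih.1
      · rcases ih with ih | ih
        · exact Or.inl (ih.trans (joined_rev hdK))
        · exact Or.inr ⟨ih.1, ih.2.imp (fun h => (joined_rev hdK).symm.trans h)
            (fun h => (joined_rev hdK).symm.trans h)⟩
  have hout : G.Joined K G.outer (G.face d₀) ∨ G.Joined K G.outer (G.face (rev d₀)) := by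
    rcases classify G.outer (G.face d₀) with h | h
    · exact Or.inl h
    · exact h.1
  have hall : ∀ f, G.Joined K f (G.face d₀) ∨ G.Joined K f (G.face (rev d₀)) := by
    intro f
    rcases classify G.outer f with h | h
    · exact hout.imp (fun h' => h.symm.trans h') (fun h' => h.symm.trans h')
    · exact h.2
  have hj : ∀ {f g}, G.Joined K f g → h f = h g := fun hfg => hfg.eq_of_flat h h₂
  have hd₀ := h₁ d₀ (by simp)
  -- The side that contains the outer face has value 0; the unit jump at `d₀` gives the other side
  -- the value -1 or 1, so the sides are indeed different regions.
  rcases hout with ho | ho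
  · have e₁ : h (G.face d₀) = 0 := by rw [← hj ho, h₀]
    have e₂ : h (G.face (rev d₀)) = -1 := by linarith
    refine ⟨fun f => ⟨fun hf => ?_, fun hf => by rw [← hj hf, h₀]⟩, Or.inr fun f => ?_⟩
    · rcases hall f with h' | h'
      · exact ho.trans h'.symm
      · have := hj h'; rw [hf, e₂] at this; norm_num at this
    · exact (hall f).imp (fun h' => (hj h').trans e₁) (fun h' => (hj h').trans e₂)
  · have e₁ : h (G.face (rev d₀)) = 0 := by rw [← hj ho, h₀]
    have e₂ : h (G.face d₀) = 1 := by linarith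
    refine ⟨fun f => ⟨fun hf => ?_, fun hf => by rw [← hj hf, h₀]⟩, Or.inl fun f => ?_⟩
    · rcases hall f with h' | h'
      · have := hj h'; rw [hf, e₂] at this; norm_num at this
      · exact ho.trans h'.symm
    · exact ((hall f).imp (fun h' => (hj h').trans e₂) (fun h' => (hj h').trans e₁)).symm

/-- In a plane graph without clockwise cycles, the potential of a simple cycle is the indicator
function of its interior. -/
theorem IsCycle.potential [Finite A] (hcw : ∀ c : List A, ¬ G.IsClockwiseCycle c) {c : List A}
    (hc : G.IsCycle c) {h : Φ → ℚ} (H : G.IsPotential h (mult c)) :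
    (∀ f, h f = 0 ↔ G.InOuterRegion {a | a ∈ c} f) ∧ ∀ f, h f = 0 ∨ h f = 1 := by
  obtain ⟨hne, ⟨u, hw⟩, hnd⟩ := hc
  have hc' : c.Nodup := hnd.of_map
  have h₁ : ∀ a ∈ c, h (G.leftFace a) - h (G.rightFace a) = 1 := fun a ha => by
    rw [H.2, mult_of_mem hc' ha]
  obtain ⟨J₁, J₂⟩ := jordan (h := h) (K := {a | a ∈ c}) hw.darts (by simpa using hne)
    (by simpa [List.map_map, Function.comp_def, base_true] using hnd)
    (by simpa [List.map_map, Function.comp_def] using hc') (by simp) H.1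
    (by
      intro d hd
      obtain ⟨a, ha, rfl⟩ := List.mem_map.1 hd
      exact h₁ a ha)
    (fun a ha => by have := H.2 a; rw [mult_of_notMem ha] at this; linarith)
  -- An interior value of -1 would put the outer region on the left of every arc, making the cycle
  -- clockwise.
  refine ⟨J₁, J₂.resolve_right fun hn => hcw c ⟨⟨hne, ⟨u, hw⟩, hnd⟩, fun a ha => ?_⟩⟩
  rw [← J₁]
  have := h₁ a ha
  rcases hn (G.leftFace a) with h' | h'
  · exact h'
  · rcases hn (G.rightFace a) with h'' | h'' <;> rw [h', h''] at this <;> norm_num at this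

/-- In a plane graph without clockwise cycles, the potential of a closed walk is nonnegative. -/
theorem IsWalk.exists_nonneg_potential [Finite V] [Finite A] [Finite Φ]
    (hcw : ∀ c : List A, ¬ G.IsClockwiseCycle c) {u : V} {p : List A} (hp : G.IsWalk u p u) :
    ∃ h, G.IsPotential h (mult p) ∧ ∀ f, 0 ≤ h f := by
  induction hn : p.length using Nat.strong_induction_on generalizing u p with
  | _ n ih =>
    subst hn
    by_cases hnd : (p.map G.tail).Nodup
    · obtain ⟨h, H⟩ := exists_potential_closed hp
      refine ⟨h, H, fun f => ?_⟩
      by_cases hne : p = []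
      · subst hne
        have : h = 0 := H.unique ⟨rfl, fun a => by simp⟩
        simp [this]
      · rcases (IsCycle.potential hcw ⟨hne, ⟨u, hp⟩, hnd⟩ H).2 f with h' | h' <;> rw [h']
        norm_num
    -- A repeated vertex splits off a closed walk `p₂`. It and the remaining closed walk `p₁ ++ p₃`
    -- are both shorter, as `p₂` and `p₃` are nonempty, and their potentials add up.
    · obtain ⟨x, p₁, p₂, p₃, e, hx⟩ : ∃ x, ∃ p₁ p₂ p₃ : List A, p = p₁ ++ p₂ ++ p₃ ∧
          (G.IsWalk u p₁ x ∧ G.IsWalk x p₂ x ∧ G.IsWalk x p₃ u) ∧ p₂ ≠ [] ∧ p₃ ≠ [] := by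
        clear ih
        revert hnd hp
        generalize u = v
        suffices ∀ w, G.IsWalk w p v → ¬ (p.map G.tail).Nodup → ∃ x, ∃ p₁ p₂ p₃ : List A,
            p = p₁ ++ p₂ ++ p₃ ∧ (G.IsWalk w p₁ x ∧ G.IsWalk x p₂ x ∧ G.IsWalk x p₃ v) ∧
              p₂ ≠ [] ∧ p₃ ≠ [] from fun h => this v h
        induction p with
        | nil => intro w _ h; simp at h
        | cons a p ih =>
          intro w hw hnd
          by_cases ha : G.tail a ∈ p.map G.tail
          · obtain ⟨b, hb, hba⟩ := List.mem_map.1 ha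
            obtain ⟨q, r, rfl⟩ := List.append_of_mem hb
            obtain ⟨y, h₁, h₂⟩ := isWalk_append.1 hw.2
            have : y = w := h₂.1.symm.trans (hba.trans hw.1)
            subst this
            exact ⟨y, [], a :: q, b :: r, by simp, ⟨rfl, ⟨hw.1, h₁⟩, h₂⟩, by simp, by simp⟩
          · obtain ⟨x, p₁, p₂, p₃, rfl, ⟨h₁, h₂, h₃⟩, h₄⟩ := ih _ hw.2 fun h =>
              hnd (by rw [List.map_cons]; exact List.nodup_cons.2 ⟨ha, h⟩)
            exact ⟨x, a :: p₁, p₂, p₃, by simp, ⟨⟨hw.1, h₁⟩, h₂, h₃⟩, h₄⟩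
      obtain ⟨⟨w₁, w₂, w₃⟩, n₂, n₃⟩ := hx
      have l₂ := List.length_pos_iff.2 n₂
      have l₃ := List.length_pos_iff.2 n₃
      have hl : p.length = p₁.length + p₂.length + p₃.length := by
        rw [e, List.length_append, List.length_append]
      obtain ⟨h, H, hh⟩ := ih _ (by omega) w₂ rfl
      obtain ⟨h', H', hh'⟩ := ih (p₁ ++ p₃).length (by rw [List.length_append]; omega)
        (w₁.append w₃) rfl
      refine ⟨h + h', ?_, fun f => add_nonneg (hh f) (hh' f)⟩
      convert H.add H' using 1
      funext a
      simp only [e, mult_append, Pi.add_apply]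
      ring

/-! ### Backward links on simple paths from the source to the sink -/

theorem const_of_step {α : Type*} (f : A → α) {a : A} {p : List A}
    (h : ∀ q b c r, a :: p = q ++ b :: c :: r → f b = f c) : ∀ b ∈ a :: p, f b = f a := by
  induction p generalizing a with
  | nil => simp
  | cons c p ih =>
    intro b hb
    rcases List.mem_cons.1 hb with rfl | hb
    · rfl
    · rw [ih (fun q b c r e => h (a :: q) b c r (by rw [e]; rfl)) b hb]
      exact (h [] a c p rfl).symm

theorem IsPath.eq_of_tail {u v : V} {p : List A} (h : G.IsPath u p v) {a b : A} (ha : a ∈ p)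
    (hb : b ∈ p) (hab : G.tail a = G.tail b) : a = b := by
  have := h.2
  rw [h.1.verts_eq] at this
  exact List.inj_on_of_nodup_map this.of_append_left ha hb hab

theorem IsPath.eq_of_head {u v : V} {p : List A} (h : G.IsPath u p v) {a b : A} (ha : a ∈ p)
    (hb : b ∈ p) (hab : G.head a = G.head b) : a = b :=
  List.inj_on_of_nodup_map (List.nodup_cons.1 h.2).2 ha hb hab

theorem IsWalk.notMem_of_base {u v x : V} {p : List A} (hp : G.IsWalk u p v)
    (hx : x ∉ G.verts u p) {d : A × Bool} (hd : G.base d = x) : d.1 ∉ p := by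
  obtain ⟨a, b⟩ := d
  intro ha
  cases b
  · exact hx (hd ▸ head_mem_verts ha)
  · exact hx (hd ▸ hp.tail_mem_verts ha)

/-- A potential that jumps only across arcs of `C` is constant on the unbounded face of `C`, in
which `s` lies. -/
theorem LiesOutside.exists_dart {C : Set V} {s : V} (hs : G.LiesOutside C s) :
    ∃ d, G.base d = s ∧ ∀ (h : Φ → ℚ) (c : A → ℚ), G.IsPotential h c →
      (∀ a ∉ G.arcsOf C, c a = 0) → h (G.face d) = 0 := by
  obtain ⟨-, d, hd, ho⟩ := hs
  refine ⟨d, hd, fun h c H hc => ?_⟩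
  rw [← H.1]
  refine (Joined.eq_of_flat ho h fun a ha => ?_).symm
  have := H.2 a
  rw [hc a ha] at this
  linarith

/-- A simple path from `s` to `t` cannot run through a path `L` whose start `u` is on a walk to `t`
and whose end `v` is on a walk from `s` that is disjoint from the former, if `L` is on the left of
these walks. -/
theorem no_backward_link [Finite V] [Finite A] [Finite Φ]
    (hcw : ∀ c : List A, ¬ G.IsClockwiseCycle c) {C : Set V} (hC : G.IsSCC C) {s t : V}
    (hs : G.LiesOutside C s) (ht : G.OnOuterFace t) {u v : V} (hu : u ∈ C)
    {P₁ L P₂ B₀ B₁ : List A} {l l' o i : A}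
    (hP : G.IsPath s (P₁ ++ (L ++ P₂)) t) (hP₁ : G.IsWalk s P₁ u) (hL : G.IsWalk u L v)
    (hP₂ : G.IsWalk v P₂ t) (hB₀ : G.IsWalk s (B₀ ++ [i]) v) (hB₁ : G.IsWalk u (o :: B₁) t)
    (hl : L.head? = some l) (hl' : L.getLast? = some l')
    (disj : ∀ x ∈ G.verts s (B₀ ++ [i]), x ∉ G.verts u (o :: B₁))
    (hvB : ∀ a ∈ B₀ ++ [i], G.tail a ≠ v)
    (hLi : ∀ x ∈ G.internalVerts L, x ∉ G.verts s (B₀ ++ [i]) ∧ x ∉ G.verts u (o :: B₁))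
    (locu : ∀ k, G.head k = u → G.leftFace l = G.leftFace k)
    (loco : G.rightFace l = G.leftFace o) (loci : G.rightFace l' = G.leftFace i) : False := by
  obtain ⟨L₁, rfl⟩ : ∃ L₁, L = l :: L₁ := by
    cases L with
    | nil => simp at hl
    | cons a L => simp only [List.head?_cons, Option.some.injEq] at hl; exact ⟨L, by rw [hl]⟩
  have hl'L : l' ∈ l :: L₁ := List.mem_of_getLast? hl'
  have hl'v : G.head l' = v := by
    obtain ⟨L₂, a, e⟩ := (List.eq_nil_or_concat' (l :: L₁)).resolve_left (by simp)
    rw [e] at hl' hL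
    simp only [List.getLast?_append, List.getLast?_singleton, Option.some_or,
      Option.some.injEq] at hl'
    rw [← hl']; exact (isWalk_concat.1 hL).2
  have hLP₂ : G.IsPath u (l :: L₁ ++ P₂) t := hP.of_append_right hP₁
  have hPu : G.IsPath s P₁ u := hP.of_append_left hP₁
  have hLp : G.IsPath u (l :: L₁) v := hLP₂.of_append_left hL
  have huv : u ≠ v := hLp.ne (by simp)
  have D₁ : ∀ x ∈ G.verts s P₁, x ∈ G.verts u (l :: L₁ ++ P₂) → x = u :=
    fun x h h' => hP.eq_of_mem_mem hP₁ h h'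
  have D₂ : ∀ x ∈ G.verts u (l :: L₁), x ∈ G.verts v P₂ → x = v :=
    fun x h h' => hLP₂.eq_of_mem_mem hL h h'
  have sub₁ : ∀ {x}, x ∈ G.verts u (l :: L₁) → x ∈ G.verts u (l :: L₁ ++ P₂) :=
    fun h => (verts_append hL).2 (Or.inl h)
  have sub₂ : ∀ {x}, x ∈ G.verts v P₂ → x ∈ G.verts u (l :: L₁ ++ P₂) :=
    fun h => (verts_append hL).2 (Or.inr h)
  have huB₀ : u ∉ G.verts s (B₀ ++ [i]) := fun h => disj _ h start_mem_verts
  have hvB₁ : v ∉ G.verts u (o :: B₁) := disj _ hB₀.end_mem_verts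
  -- Tails on one walk and heads on the other: the junctions `v` and `u` with `L` are not counted as
  -- hits merely for being the end of the first walk and the start of the second.
  let H : V → Prop := fun x => (∃ a ∈ B₀ ++ [i], G.tail a = x) ∨ ∃ a ∈ o :: B₁, G.head a = x
  have Hs : H s := by
    left
    obtain ⟨a, q, e⟩ := List.exists_cons_of_ne_nil (l := B₀ ++ [i]) (by simp)
    rw [e] at hB₀ ⊢
    exact ⟨a, by simp, hB₀.1⟩
  have Ht : H t := by
    right
    obtain ⟨q, a, e, -, h⟩ := hB₁.concat_of_ne_nil (by simp)
    exact ⟨a, by rw [e]; simp, h⟩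
  obtain ⟨q₁, q₂, z, rfl, hq₁, hq₂, hz, hq⟩ := hP₁.exists_last H Hs
  obtain ⟨p₁, p₂, y, rfl, hp₁, hp₂, hy, hp⟩ := hP₂.exists_first H Ht
  have subq : ∀ {x}, x ∈ G.verts z q₂ → x ∈ G.verts s (q₁ ++ q₂) :=
    fun h => (verts_append hq₁).2 (Or.inr h)
  have subp : ∀ {x}, x ∈ G.verts v p₁ → x ∈ G.verts v (p₁ ++ p₂) :=
    fun h => (verts_append hp₁).2 (Or.inl h)
  have hqx : ∀ x ∈ G.verts z q₂, x = z ∨ ¬ H x := by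
    intro x hx
    rcases mem_verts.1 hx with rfl | ⟨a, ha, rfl⟩
    · exact Or.inl rfl
    · exact Or.inr (hq a ha)
  have hpx : ∀ x ∈ G.verts v p₁, x = y ∨ ¬ H x := by
    intro x hx
    rcases hp₁.mem_verts.1 hx with rfl | ⟨a, ha, rfl⟩
    · exact Or.inl rfl
    · exact Or.inr (hp a ha)
  have HB₀ : ∀ {x}, (∃ a ∈ B₀ ++ [i], G.tail a = x) → x ∈ G.verts s (B₀ ++ [i]) := by
    rintro _ ⟨a, ha, rfl⟩; exact hB₀.tail_mem_verts ha
  have HB₁ : ∀ {x}, (∃ a ∈ o :: B₁, G.head a = x) → x ∈ G.verts u (o :: B₁) := by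
    rintro _ ⟨a, ha, rfl⟩; exact head_mem_verts ha
  have zero_outside : ∀ {x : V} {Z : List A}, x ∈ C → G.IsWalk x Z x → ∀ a ∉ G.arcsOf C,
      mult Z a = 0 := fun hx hZ a ha =>
    mult_of_notMem fun h => ha (hC.arcs_of_walk hZ hx hx h)
  -- the last hit of the first part is not on the walk to `t`
  have hz' : ∃ a ∈ B₀ ++ [i], G.tail a = z := by
    refine hz.resolve_right fun hz₁ => ?_
    obtain ⟨a, ha, haz⟩ := hz₁
    obtain ⟨b, b', e⟩ := List.append_of_mem ha
    have hob : o ∈ b ++ [a] := by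
      cases b with
      | nil => simp only [List.nil_append, List.cons.injEq] at e; simp [e.1]
      | cons c b => simp only [List.cons_append, List.cons.injEq] at e; simp [e.1]
    have hb : G.IsWalk u (b ++ [a]) z := by
      rw [e] at hB₁
      obtain ⟨w, h₁, h₂⟩ := isWalk_append.1 hB₁
      exact h₁.append ⟨h₂.1, haz⟩
    have hbs : ∀ c ∈ b ++ [a], c ∈ o :: B₁ := by
      intro c hc; rw [e]; simp only [List.mem_append, List.mem_cons] at hc ⊢; grind
    -- This closed walk goes from `u` along the second walk to `z` and back to `u` along the path.
    -- Its potential is 0 at `s`; this value is carried along the first walk to `v` and backward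
    -- along `L` to the right of `l`, which is the left of `o`. The jump across `o` is at least 1,
    -- so the right of `o` has a negative value.
    have hZ := hb.append hq₂
    obtain ⟨h, hh, hpos⟩ := hZ.exists_nonneg_potential hcw
    have hfl : ∀ x, x ∉ G.verts u (o :: B₁) → x ∉ G.verts z q₂ → G.Flat h x := by
      intro x hx hx'
      refine hh.flat fun d hd => mult_of_notMem fun hm => ?_
      rcases List.mem_append.1 hm with hm | hm
      · exact hB₁.notMem_of_base hx hd (hbs _ hm)
      · exact hq₂.notMem_of_base hx' hd hm
    obtain ⟨d, hd, hd₀⟩ := hs.exists_dart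
    have h₀ := hd₀ h _ hh (zero_outside hu hZ)
    have h₁ := hB₀.flat_tails (g := h) (fun c hc => hfl _ (disj _ (HB₀ ⟨c, hc, rfl⟩)) fun hx => by
      rcases hqx _ hx with hcz | hcz
      · exact disj _ (HB₀ ⟨c, hc, rfl⟩) (hcz ▸ HB₁ ⟨a, ha, haz⟩)
      · exact hcz (Or.inl ⟨c, hc, rfl⟩)) hd i (by simp)
    have hi : G.base (i, false) = v := (isWalk_concat.1 hB₀).2
    have h₂ := hL.flat_heads (g := h) (fun c hc => by
      rcases hL.head_cases hc with hcv | hcv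
      · rw [hcv]
        exact hfl _ hvB₁ fun hx => huv (D₁ _ (subq hx) (sub₁ hL.end_mem_verts)).symm
      · exact hfl _ (hLi _ hcv).2 fun hx =>
          (hLp.internal_ne hcv).1 (D₁ _ (subq hx) (sub₁ (head_mem_verts hc)))) hi l (by simp)
    have h₃ := hh.2 o
    have h₄ := one_le_mult (List.mem_append_left q₂ hob)
    have h₅ : h (G.rightFace l) = h (G.rightFace i) := h₂.2
    have h₆ := hpos (G.rightFace o)
    rw [← loco, h₅, h₁.2, h₀] at h₃
    linarith
  -- the first hit of the last part is not on the walk from `s`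
  have hy' : ∃ a ∈ o :: B₁, G.head a = y := by
    refine hy.resolve_left fun hy₁ => ?_
    obtain ⟨a, ha, hay⟩ := hy₁
    obtain ⟨b, b', e⟩ := List.append_of_mem ha
    have hib : i ∈ a :: b' := by
      have := congrArg List.getLast? e
      rw [List.getLast?_append_of_ne_nil _ (by simp), List.getLast?_append_of_ne_nil _ (by simp),
        List.getLast?_singleton] at this
      exact List.mem_of_getLast? this.symm
    have hb : G.IsWalk y (a :: b') v := by
      rw [e] at hB₀
      obtain ⟨w, h₁, h₂⟩ := isWalk_append.1 hB₀
      exact ⟨hay, h₂.2⟩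
    have hbs : ∀ c ∈ a :: b', c ∈ B₀ ++ [i] := by
      intro c hc; rw [e]; exact List.mem_append_right _ hc
    -- The mirror image of the previous case: the value 0 at `t` is carried backward along the
    -- second walk to `u`, then along `L` to the right of `l'`, which is the left of `i`.
    have hZ := hp₁.append hb
    obtain ⟨h, hh, hpos⟩ := hZ.exists_nonneg_potential hcw
    have hfl : ∀ x, x ∉ G.verts s (B₀ ++ [i]) → x ∉ G.verts v p₁ → G.Flat h x := by
      intro x hx hx'
      refine hh.flat fun d hd => mult_of_notMem fun hm => ?_
      rcases List.mem_append.1 hm with hm | hm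
      · exact hp₁.notMem_of_base hx' hd hm
      · exact hB₀.notMem_of_base hx hd (hbs _ hm)
    obtain ⟨d, hd, hdo⟩ := ht
    have h₀ : h (G.face d) = 0 := by rw [hdo, hh.1]
    have h₁ := hB₁.flat_heads (g := h) (fun c hc =>
      hfl _ (fun hx => disj _ hx (HB₁ ⟨c, hc, rfl⟩)) fun hx => by
        rcases hpx _ hx with hcy | hcy
        · exact disj y (HB₀ ⟨a, ha, hay⟩) (hcy ▸ HB₁ ⟨c, hc, rfl⟩)
        · exact hcy (Or.inr ⟨c, hc, rfl⟩)) hd o (by simp)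
    have ho : G.base (o, true) = u := hB₁.1
    have h₂ := hL.flat_tails (g := h) (fun c hc => by
      rcases hL.tail_cases hc with hcu | hcu
      · rw [hcu]
        exact hfl _ huB₀ fun hx => huv (D₂ _ start_mem_verts (subp hx))
      · exact hfl _ (hLi _ hcu).1 fun hx =>
          (hLp.internal_ne hcu).2 (D₂ _ (hL.tail_mem_verts hc) (subp hx))) ho l' hl'L
    have h₃ := hh.2 i
    have h₄ := one_le_mult (List.mem_append_right p₁ hib)
    have h₅ : h (G.rightFace l') = h (G.leftFace o) := h₂.2
    have h₆ := hpos (G.rightFace i)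
    rw [← loci, h₅, h₁.1, h₀] at h₃
    linarith
  -- the curve that is formed by the two walks from `u` to `y`
  obtain ⟨a, ha, haz⟩ := hz'
  obtain ⟨a', ha', hay⟩ := hy'
  obtain ⟨b, b', e⟩ := List.append_of_mem ha
  obtain ⟨c, c', e'⟩ := List.append_of_mem ha'
  have hib : i ∈ a :: b' := by
    have := congrArg List.getLast? e
    rw [List.getLast?_append_of_ne_nil _ (by simp), List.getLast?_append_of_ne_nil _ (by simp),
      List.getLast?_singleton] at this
    exact List.mem_of_getLast? this.symm
  have hb : G.IsWalk z (a :: b') v := by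
    rw [e] at hB₀
    obtain ⟨w, h₁, h₂⟩ := isWalk_append.1 hB₀
    exact ⟨haz, h₂.2⟩
  have hbs : ∀ x ∈ a :: b', x ∈ B₀ ++ [i] := by
    intro x hx; rw [e]; exact List.mem_append_right _ hx
  have hc : G.IsWalk u (c ++ [a']) y := by
    rw [e'] at hB₁
    obtain ⟨w, h₁, h₂⟩ := isWalk_append.1 hB₁
    exact h₁.append ⟨h₂.1, hay⟩
  have hcs : ∀ x ∈ c ++ [a'], x ∈ o :: B₁ := by
    intro x hx; rw [e']; simp only [List.mem_append, List.mem_cons] at hx ⊢; grind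
  -- The jumps are positive along the walk `c ++ [a']` to `y` and negative along `L` and `p₁`.
  obtain ⟨h, hh⟩ := exists_potential hc (hL.append hp₁)
  have zB₀ := HB₀ ⟨a, ha, haz⟩
  have yB₁ := HB₁ ⟨a', ha', hay⟩
  have hfl : ∀ x, x ∉ G.verts u (o :: B₁) → x ∉ G.verts u (l :: L₁) → x ∉ G.verts v p₁ →
      G.Flat h x := by
    intro x h₁ h₂ h₃
    refine hh.flat fun d hd => ?_
    rw [mult_of_notMem fun hm => hB₁.notMem_of_base h₁ hd (hcs _ hm), mult_append,
      mult_of_notMem (hL.notMem_of_base h₂ hd), mult_of_notMem (hp₁.notMem_of_base h₃ hd)]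
    ring
  -- the values on the left of `l` and on the right of `l'` are both equal to the value at `z`
  have hzu : z ≠ u := fun hzu => huB₀ (hzu ▸ zB₀)
  obtain ⟨q₃, k, rfl, hq₃, hk⟩ := hq₂.concat_of_ne_nil (by rintro rfl; exact hzu hq₂)
  -- Before reaching `u`, the path avoids both parts of the curve: after `z` there is no hit, `z`
  -- itself is on the walk disjoint from the second one, and simplicity keeps it off `L` and `p₁`.
  have h₁ := hq₂.flat_tails (g := h) (fun x hx => by
    have hxu : G.tail x ≠ u := hPu.end_notMem (List.mem_append_right _ hx)
    have hxv := hq₂.tail_mem_verts hx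
    refine hfl _ (fun hm => ?_) (fun hm => hxu (D₁ _ (subq hxv) (sub₁ hm)))
      (fun hm => hxu (D₁ _ (subq hxv) (sub₂ (subp hm))))
    rcases mem_verts.1 hm with hm | hm
    · exact hxu hm
    · rcases hqx _ hxv with hxz | hxz
      · exact disj _ zB₀ (hxz ▸ HB₁ hm)
      · exact hxz (Or.inr hm)) (d := (a, true)) haz k (by simp)
  have h₂ := hb.flat_tails (g := h) (fun x hx => by
    have hxB := HB₀ ⟨x, hbs x hx, rfl⟩
    refine hfl _ (disj _ hxB) (fun hm => ?_) (fun hm => ?_)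
    · rcases hL.mem_verts_iff_internal.1 hm with hm | hm | hm
      · exact huB₀ (hm ▸ hxB)
      · exact hvB x (hbs x hx) hm
      · exact (hLi _ hm).1 hxB
    · rcases hpx _ hm with hm | hm
      · exact disj y (hm ▸ hxB) yB₁
      · exact hm (Or.inl ⟨x, hbs x hx, rfl⟩)) (d := (a, true)) haz i hib
  -- the left-hand side of the curve is the same along `L`
  have hLp₁ : G.IsPath u (l :: L₁ ++ p₁) y := by
    have : G.IsPath u ((l :: L₁ ++ p₁) ++ p₂) t := by simpa using hLP₂
    exact this.of_append_left (hL.append hp₁)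
  have h₃ := const_of_step (fun x => h (G.leftFace x)) (a := l) (p := L₁) (by
    intro q g g' r eq
    have hw : G.head g = G.tail g' ∧ G.head g ∈ G.internalVerts (l :: L₁) := by
      rw [eq] at hL
      obtain ⟨w, h₁, h₂⟩ := isWalk_append.1 hL
      refine ⟨h₂.2.1.symm, ?_⟩
      rw [eq, show q ++ g :: g' :: r = (q ++ [g]) ++ (g' :: r) by simp]
      exact head_mem_internalVerts (by simp) (by simp)
    have hg : g ∈ l :: L₁ ++ p₁ := List.mem_append_left _ (by rw [eq]; simp)
    have hg' : g' ∈ l :: L₁ ++ p₁ := List.mem_append_left _ (by rw [eq]; simp)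
    -- At an internal vertex of `L` the two consecutive arcs of `L` are the only arcs with a nonzero
    -- jump.
    refine (face_eq_of_two h (d := (g', true)) (e := (g, false)) hw.1.symm (by simp) ?_).symm
    rintro ⟨x, β⟩ hx hx₁ hx₂
    have hx' : G.base (x, β) = G.head g := hx.trans hw.1.symm
    have hm₁ : x ∉ c ++ [a'] := fun hm =>
      hB₁.notMem_of_base (hLi _ hw.2).2 hx' (hcs _ hm)
    have hm₂ : x ∉ l :: L₁ ++ p₁ := by
      intro hm
      cases β
      · exact hx₂ (by rw [hLp₁.eq_of_head hm hg hx'])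
      · exact hx₁ (by rw [hLp₁.eq_of_tail hm hg' hx])
    have := hh.2 x
    beta_reduce at this
    rw [mult_of_notMem hm₁, mult_of_notMem hm₂] at this
    simp only [leftFace, rightFace] at this
    cases β <;> simp only [rev, Bool.not_true, Bool.not_false] <;> linarith) l' hl'L
  -- The jump across `l'` is -1, whereas the value on its left, equal to that on the left of `l`,
  -- and the value on its right are both the value at `z`.
  have h₄ := hh.2 l'
  beta_reduce at h₄
  rw [mult_of_notMem (fun hm => hvB₁ (hl'v ▸ head_mem_verts (hcs _ hm))),
    mult_of_mem hLp₁.nodup (List.mem_append_left _ hl'L)] at h₄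
  have h₅ := locu k hk
  have e₁ := h₁.1
  have e₂ := h₂.1
  beta_reduce at h₃
  rw [← h₅] at e₁
  rw [← loci] at e₂
  linarith

/-! ### Vertices of degree three -/

theorem eq_of_three [Finite A] {x : V} (hx : G.degree x = 3) {d₁ d₂ d₃ : A × Bool}
    (h₁ : G.base d₁ = x) (h₂ : G.base d₂ = x) (h₃ : G.base d₃ = x) (h₁₂ : d₁ ≠ d₂) (h₁₃ : d₁ ≠ d₃)
    (h₂₃ : d₂ ≠ d₃) {d : A × Bool} (hd : G.base d = x) : d = d₁ ∨ d = d₂ ∨ d = d₃ := by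
  classical
  have hc : ({d₁, d₂, d₃} : Set (A × Bool)).ncard = 3 := by
    rw [Set.ncard_eq_toFinset_card']
    simp [h₁₂, h₁₃, h₂₃]
  have hs : ({d₁, d₂, d₃} : Set (A × Bool)) ⊆ {d | G.base d = x} := by
    rintro e (rfl | rfl | rfl) <;> assumption
  have heq := Set.eq_of_subset_of_ncard_le hs (by
    rw [hc]
    exact (show Nat.card {d : A × Bool // G.base d = x} = 3 from hx).le) (Set.toFinite _)
  have : d ∈ ({d₁, d₂, d₃} : Set (A × Bool)) := by rw [heq]; exact hd
  simpa using this

/-- At a vertex of degree three with the darts `d₁`, `d₂`, `d₃`, the cyclic order of these darts is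
determined by a region that contains the face to the left of `d₁` and the face to the right of `d₂`
but does not contain both sides of `d₃`. -/
theorem rot_of_three [Finite A] {x : V} (hx : G.degree x = 3) {d₁ d₂ d₃ : A × Bool}
    (h₁ : G.base d₁ = x) (h₂ : G.base d₂ = x) (h₃ : G.base d₃ = x) (h₁₂ : d₁ ≠ d₂) (h₁₃ : d₁ ≠ d₃)
    (h₂₃ : d₂ ≠ d₃) {R : Φ → Prop} (r₁ : R (G.face d₁)) (r₂ : R (G.face (rev d₂)))
    (r₃ : ¬ (R (G.face d₃) ∧ R (G.face (rev d₃)))) :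
    G.rot d₁ = d₂ ∧ G.rot d₂ = d₃ ∧ G.rot d₃ = d₁ := by
  have key : ∀ {d}, G.base d = x → d = d₁ ∨ d = d₂ ∨ d = d₃ := fun hd =>
    eq_of_three hx h₁ h₂ h₃ h₁₂ h₁₃ h₂₃ hd
  have fix : ∀ {d e}, G.base d = x → G.base e = x → d ≠ e → G.rot d ≠ d := by
    intro d e hd he hde hfix
    exact hde ((sameCycle_of_base (hd.trans he.symm)).eq_of_left hfix)
  have b : ∀ {d}, G.base d = x → G.base (G.rot d) = x := fun hd => (base_rot _).trans hd
  have f : ∀ d e, G.rot d = e → G.face (rev e) = G.face d := by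
    rintro d _ rfl; exact G.face_rot d
  have i : ∀ {d e}, G.rot d = G.rot e → d = e := fun h => G.rot.injective h
  have n₁ := fix h₁ h₂ h₁₂
  have n₂ := fix h₂ h₁ h₁₂.symm
  have n₃ := fix h₃ h₁ h₁₃.symm
  rcases key (b h₁) with e₁ | e₁ | e₁
  · exact absurd e₁ n₁
  · rcases key (b h₂) with e₂ | e₂ | e₂
    · rcases key (b h₃) with e₃ | e₃ | e₃
      · exact absurd (i (e₃.trans e₂.symm)) h₂₃.symm
      · exact absurd (i (e₃.trans e₁.symm)) h₁₃.symm
      · exact absurd e₃ n₃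
    · exact absurd e₂ n₂
    · rcases key (b h₃) with e₃ | e₃ | e₃
      · exact ⟨e₁, e₂, e₃⟩
      · exact absurd (i (e₃.trans e₁.symm)) h₁₃.symm
      · exact absurd e₃ n₃
  · rcases key (b h₃) with e₃ | e₃ | e₃
    · rcases key (b h₂) with e₂ | e₂ | e₂
      · exact absurd (i (e₂.trans e₃.symm)) h₂₃
      · exact absurd e₂ n₂
      · exact absurd (i (e₂.trans e₁.symm)) h₁₂.symm
    -- In the opposite cyclic order, `d₃` would have the left face of `d₁` on its right and the
    -- right face of `d₂` on its left.
    · exact absurd ⟨by rw [← f _ _ e₃]; exact r₂, by rw [f _ _ e₁]; exact r₁⟩ r₃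
    · exact absurd e₃ n₃

/-! ### The shape of a strip -/

/-- The floor and the ceiling of the strip `S` form a simple closed curve in the component `C`. -/
structure Shape (G : PlaneDigraph V A Φ) (C : Set V) (Q : List A) (S : Strip V A) : Prop where
  floor_path : G.IsPath S.start S.floor S.finish
  floor_ne : S.floor ≠ []
  floor_arcs : ∀ a ∈ S.floor, a ∈ G.arcsOf C
  some_path : ∀ U, S.ceiling = some U → G.IsPath S.start U S.finish
  some_arcs : ∀ U, S.ceiling = some U → ∀ a ∈ U, a ∈ G.arcsOf C
  some_internal : ∀ U, S.ceiling = some U → ∀ x ∈ G.internalVerts U, x ∉ G.verts S.start S.floor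
  some_disjoint : ∀ U, S.ceiling = some U → ∀ a ∈ U, a ∉ S.floor
  none_path : S.ceiling = none → G.IsPath S.finish Q S.start
  none_arcs : ∀ a ∈ Q, a ∈ G.arcsOf C
  none_internal : S.ceiling = none → ∀ x ∈ G.internalVerts Q, x ∉ G.verts S.start S.floor

/-- The jump across the arcs of the curve that encloses the strip `S`. -/
noncomputable def stripJump (Q : List A) (S : Strip V A) (a : A) : ℚ :=
  mult S.floor a + S.ceiling.elim (mult Q a) (fun U => -mult U a)

/-- The curve that encloses the strip `S` has the strip on the left of the floor. -/
def Region (G : PlaneDigraph V A Φ) (Q : List A) (S : Strip V A) : Prop :=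
  ∃ h, G.IsPotential h (stripJump Q S) ∧
    (∀ f, h f = 0 ↔ G.InOuterRegion (stripCurve Q S) f) ∧ ∀ f, h f = 0 ∨ h f = 1

theorem mem_stripCurve_some {Q U : List A} {S : Strip V A} (h : S.ceiling = some U) {a : A} :
    a ∈ stripCurve Q S ↔ a ∈ S.floor ∨ a ∈ U := by simp [stripCurve, h]

theorem mem_stripCurve_none {Q : List A} {S : Strip V A} (h : S.ceiling = none) {a : A} :
    a ∈ stripCurve Q S ↔ a ∈ S.floor ∨ a ∈ Q := by simp [stripCurve, h]

namespace Shape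

variable {C : Set V} {Q : List A} {S : Strip V A}

theorem start_ne (H : G.Shape C Q S) : S.start ≠ S.finish := H.floor_path.ne H.floor_ne

theorem some_ne (H : G.Shape C Q S) {U : List A} (hU : S.ceiling = some U) : U ≠ [] := by
  rintro rfl
  exact H.start_ne (H.some_path _ hU).1

theorem none_ne (H : G.Shape C Q S) (hU : S.ceiling = none) : Q ≠ [] := by
  rintro rfl
  exact H.start_ne (H.none_path hU).1.symm

theorem curve_arcs (H : G.Shape C Q S) {a : A} (ha : a ∈ stripCurve Q S) : a ∈ G.arcsOf C := by
  rcases ha with ha | ha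
  · exact H.floor_arcs a ha
  · cases hU : S.ceiling with
    | none => rw [hU] at ha; exact H.none_arcs a ha
    | some U => rw [hU] at ha; exact H.some_arcs U hU a ha

theorem none_disjoint (H : G.Shape C Q S) (hU : S.ceiling = none) {a : A} (ha : a ∈ Q) :
    a ∉ S.floor := by
  intro hf
  rcases (H.none_path hU).1.tail_cases ha with h | h
  · exact H.floor_path.end_notMem hf h
  · exact H.none_internal hU _ h (H.floor_path.1.tail_mem_verts hf)

theorem jump_floor (H : G.Shape C Q S) {a : A} (ha : a ∈ S.floor) : stripJump Q S a = 1 := by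
  rw [stripJump, mult_of_mem H.floor_path.nodup ha]
  cases hU : S.ceiling with
  | none => simp [mult_of_notMem fun h => H.none_disjoint hU h ha]
  | some U => simp [mult_of_notMem fun h => H.some_disjoint U hU a h ha]

theorem jump_some (H : G.Shape C Q S) {U : List A} (hU : S.ceiling = some U) {a : A}
    (ha : a ∈ U) : stripJump Q S a = -1 := by
  rw [stripJump, mult_of_notMem (H.some_disjoint U hU a ha), hU]
  simp [mult_of_mem (H.some_path U hU).nodup ha]

theorem jump_none (H : G.Shape C Q S) (hU : S.ceiling = none) {a : A}
    (ha : a ∈ Q) : stripJump Q S a = 1 := by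
  rw [stripJump, mult_of_notMem (H.none_disjoint hU ha), hU]
  simp [mult_of_mem (H.none_path hU).nodup ha]

theorem jump_notMem {a : A} (ha : a ∉ stripCurve Q S) : stripJump Q S a = 0 := by
  have h₁ : a ∉ S.floor := fun h => ha (Or.inl h)
  have h₂ : a ∉ S.ceiling.getD Q := fun h => ha (Or.inr h)
  rw [stripJump, mult_of_notMem h₁]
  cases hU : S.ceiling with
  | none => rw [hU] at h₂; simpa using mult_of_notMem h₂
  | some U => rw [hU] at h₂; simpa using mult_of_notMem h₂

theorem exists_potential [Finite V] [Finite A] [Finite Φ] (H : G.Shape C Q S) :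
    ∃ h, G.IsPotential h (stripJump Q S) := by
  cases hU : S.ceiling with
  | none =>
    obtain ⟨h, hh⟩ := exists_potential_closed (H.floor_path.1.append (H.none_path hU).1)
    exact ⟨h, hh.1, fun a => by rw [hh.2, mult_append, stripJump, hU]; rfl⟩
  | some U =>
    obtain ⟨h, hh⟩ := PlaneDigraph.exists_potential H.floor_path.1 (H.some_path U hU).1
    exact ⟨h, hh.1, fun a => by rw [hh.2, stripJump, hU]; exact sub_eq_add_neg _ _⟩

/-- The Jordan curve theorem for the curve that encloses a strip. -/
theorem jordan [Finite A] (H : G.Shape C Q S) {h : Φ → ℚ} (hh : G.IsPotential h (stripJump Q S)) :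
    (∀ f, h f = 0 ↔ G.InOuterRegion (stripCurve Q S) f) ∧
      ((∀ f, h f = 0 ∨ h f = 1) ∨ ∀ f, h f = 0 ∨ h f = -1) := by
  have hz : ∀ a ∉ stripCurve Q S, h (G.leftFace a) = h (G.rightFace a) := fun a ha => by
    have := hh.2 a
    rw [jump_notMem ha] at this
    linarith
  have hfl : ∀ a ∈ S.floor, h (G.leftFace a) - h (G.rightFace a) = 1 := fun a ha => by
    rw [hh.2, H.jump_floor ha]
  have hnd : (S.floor.map G.tail).Nodup := by
    have := H.floor_path.2
    rw [H.floor_path.1.verts_eq] at this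
    exact this.of_append_left
  cases hU : S.ceiling with
  | none =>
    have hQ := H.none_path hU
    have hnd' : ((S.floor ++ Q).map G.tail).Nodup := by
      rw [List.map_append, List.nodup_append]
      refine ⟨hnd, ?_, ?_⟩
      · have := hQ.2
        rw [hQ.1.verts_eq] at this
        exact this.of_append_left
      · rintro _ hx _ hy rfl
        obtain ⟨a, ha, hax⟩ := List.mem_map.1 hx
        obtain ⟨b, hb, hba⟩ := List.mem_map.1 hy
        rcases hQ.1.tail_cases hb with h | h
        · exact H.floor_path.end_notMem ha (hax.trans (hba.symm.trans h))
        · exact H.none_internal hU _ h (hba ▸ hax ▸ H.floor_path.1.tail_mem_verts ha)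
    refine PlaneDigraph.jordan (H.floor_path.1.append hQ.1).darts ?_ ?_ ?_ ?_ hh.1 ?_ hz
    · simp [H.floor_ne]
    · simpa only [List.map_map, Function.comp_def, base_true] using hnd'
    · simpa only [List.map_map, Function.comp_def, List.map_id'] using hnd'.of_map
    · intro a
      rw [mem_stripCurve_none hU]
      simp
    · intro d hd
      obtain ⟨a, ha, rfl⟩ := List.mem_map.1 hd
      rcases List.mem_append.1 ha with ha | ha
      · exact hfl a ha
      · have := hh.2 a
        rw [H.jump_none hU ha] at this
        exact this
  | some U =>
    have hP := H.some_path U hU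
    -- A real ceiling is traversed backward, whence its jump of -1; the dummy case traverses `Q`
    -- forward.
    refine PlaneDigraph.jordan (H.floor_path.1.darts.append hP.1.darts_reverse) ?_ ?_ ?_ ?_
      hh.1 ?_ hz
    · simp [H.floor_ne]
    · simp only [List.map_append, List.map_map, Function.comp_def, base_true, base_false]
      rw [List.nodup_append]
      refine ⟨hnd, ?_, ?_⟩
      · rw [List.map_reverse, List.nodup_reverse]
        exact (List.nodup_cons.1 hP.2).2
      · rintro _ hx _ hy rfl
        obtain ⟨a, ha, hax⟩ := List.mem_map.1 hx
        obtain ⟨b, hb, hba⟩ := List.mem_map.1 hy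
        rcases hP.1.head_cases (List.mem_reverse.1 hb) with h | h
        · exact H.floor_path.end_notMem ha (hax.trans (hba.symm.trans h))
        · exact H.some_internal U hU _ h (hba ▸ hax ▸ H.floor_path.1.tail_mem_verts ha)
    · simp only [List.map_append, List.map_map, Function.comp_def, List.map_id']
      rw [List.nodup_append]
      refine ⟨H.floor_path.nodup, List.nodup_reverse.2 hP.nodup, ?_⟩
      rintro a ha _ hb rfl
      exact H.some_disjoint U hU a (List.mem_reverse.1 hb) ha
    · intro a
      rw [mem_stripCurve_some hU]
      simp [or_comm]
    · intro d hd
      rcases List.mem_append.1 hd with hd | hd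
      · obtain ⟨a, ha, rfl⟩ := List.mem_map.1 hd
        exact hfl a ha
      · obtain ⟨a, ha, rfl⟩ := List.mem_map.1 hd
        have := hh.2 a
        rw [H.jump_some hU (List.mem_reverse.1 ha)] at this
        simp only [leftFace, rightFace] at this
        simp only [rev, Bool.not_false]
        linarith

/-- The region of a strip is on the left of its floor if this is so at one arc of the curve. -/
theorem region_of_left [Finite V] [Finite A] [Finite Φ] (H : G.Shape C Q S) {a : A}
    (ha : stripJump Q S a = 1) (hr : G.InOuterRegion (stripCurve Q S) (G.rightFace a)) :
    G.Region Q S := by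
  obtain ⟨h, hh⟩ := H.exists_potential
  obtain ⟨J₁, J₂⟩ := H.jordan hh
  refine ⟨h, hh, J₁, J₂.resolve_right fun hn => ?_⟩
  have := hh.2 a
  rw [ha, (J₁ _).2 hr] at this
  rcases hn (G.leftFace a) with h' | h' <;> rw [h'] at this <;> norm_num at this

/-- Used at a ceiling arc, whose orientation is opposite to that of the closed curve: there the
outer side must be the left one. -/
theorem region_of_right [Finite V] [Finite A] [Finite Φ] (H : G.Shape C Q S) {a : A}
    (ha : stripJump Q S a = -1) (hr : G.InOuterRegion (stripCurve Q S) (G.leftFace a)) :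
    G.Region Q S := by
  obtain ⟨h, hh⟩ := H.exists_potential
  obtain ⟨J₁, J₂⟩ := H.jordan hh
  refine ⟨h, hh, J₁, J₂.resolve_right fun hn => ?_⟩
  have := hh.2 a
  rw [ha, (J₁ _).2 hr] at this
  rcases hn (G.rightFace a) with h' | h' <;> rw [h'] at this <;> norm_num at this

end Shape

/-- With values 0 and 1 only, a jump of 1 leads from 0 on the right to 1 on the left. -/
theorem Region.of_left {Q : List A} {S : Strip V A} (R : G.Region Q S) {a : A}
    (ha : stripJump Q S a = 1) : G.InOuterRegion (stripCurve Q S) (G.rightFace a) ∧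
      ¬ G.InOuterRegion (stripCurve Q S) (G.leftFace a) := by
  obtain ⟨h, hh, J₁, J₂⟩ := R
  have := hh.2 a
  rw [← J₁, ← J₁]
  rcases J₂ (G.leftFace a) with h' | h' <;> rcases J₂ (G.rightFace a) with h'' | h'' <;>
    rw [h', h'', ha] at this <;> norm_num at this
  exact ⟨h'', by rw [h']; norm_num⟩

theorem Region.of_right {Q : List A} {S : Strip V A} (R : G.Region Q S) {a : A}
    (ha : stripJump Q S a = -1) : G.InOuterRegion (stripCurve Q S) (G.leftFace a) ∧
      ¬ G.InOuterRegion (stripCurve Q S) (G.rightFace a) := by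
  obtain ⟨h, hh, J₁, J₂⟩ := R
  have := hh.2 a
  rw [← J₁, ← J₁]
  rcases J₂ (G.leftFace a) with h' | h' <;> rcases J₂ (G.rightFace a) with h'' | h'' <;>
    rw [h', h'', ha] at this <;> norm_num at this
  exact ⟨h', by rw [h'']; norm_num⟩

/-- The assumptions on the plane graph, the component `C` and the part `Q` of its boundary. -/
structure Setting (G : PlaneDigraph V A Φ) (s t : V) (C : Set V) (Q : List A) : Prop where
  no_clockwise : ∀ c : List A, ¬ G.IsClockwiseCycle c
  degree : ∀ x ∈ C, G.degree x = 3
  scc : G.IsSCC C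
  source : G.LiesOutside C s
  sink : G.OnOuterFace t
  sink_notMem : t ∉ C
  internal : ∀ x ∈ G.internalVerts Q, ¬ G.IsEntrance s C x ∧ ¬ G.IsExit t C x

/-- The vertices of a strip. -/
def stripVerts (G : PlaneDigraph V A Φ) (C : Set V) (Q : List A) (S : Strip V A) : Set V :=
  {x | ∃ d, G.base d = x ∧ d.1 ∈ G.stripArcs C Q S}

/-- The walk `E₀` from `s` to the start of the strip and the walk `E₁` from the end of the strip to
`t` are disjoint and run outside the strip. -/
structure Approach (G : PlaneDigraph V A Φ) (s t : V) (C : Set V) (Q : List A) (S : Strip V A)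
    (E₀ E₁ : List A) : Prop where
  walk₀ : G.IsWalk s E₀ S.start
  walk₁ : G.IsWalk S.finish E₁ t
  disjoint : ∀ x ∈ G.verts s E₀, x ∉ G.verts S.finish E₁
  avoid₀ : ∀ x ∈ G.verts s E₀, x ∈ G.stripVerts C Q S → x = S.start
  avoid₁ : ∀ x ∈ G.verts S.finish E₁, x ∈ G.stripVerts C Q S → x = S.finish
  simple₀ : ∀ a ∈ E₀, G.tail a ≠ S.start
  simple₁ : ∀ a ∈ E₁, G.head a ≠ S.finish
  right₀ : ∀ a ∈ E₀, G.InOuterRegion (stripCurve Q S) (G.rightFace a)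
  right₁ : ∀ a ∈ E₁, G.InOuterRegion (stripCurve Q S) (G.rightFace a)

/-- The strip `S` is enclosed by a simple closed curve, with the strip on the left of its floor. -/
structure Solid (G : PlaneDigraph V A Φ) (C : Set V) (Q : List A) (S : Strip V A) : Prop where
  shape : G.Shape C Q S
  region : G.Region Q S

/-- The properties of a strip that are preserved by every slicing. -/
structure Regular (G : PlaneDigraph V A Φ) (s t : V) (C : Set V) (Q : List A) (S : Strip V A) :
    Prop extends Solid G C Q S where
  none_strip : S.ceiling = none → ∀ x ∈ G.internalVerts Q, ∀ d, G.base d = x →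
    d.1 ∈ G.arcsOf C → d.1 ∈ G.stripArcs C Q S
  approach : ∃ E₀ E₁, G.Approach s t C Q S E₀ E₁

theorem stripVerts_subset {C : Set V} {Q : List A} {S : Strip V A} {x : V}
    (hx : x ∈ G.stripVerts C Q S) : x ∈ C := by
  obtain ⟨⟨a, b⟩, rfl, ha⟩ := hx
  cases b
  · exact ha.1.2
  · exact ha.1.1

theorem tail_mem_stripVerts {C : Set V} {Q : List A} {S : Strip V A} {a : A}
    (ha : a ∈ G.stripArcs C Q S) : G.tail a ∈ G.stripVerts C Q S := ⟨(a, true), rfl, ha⟩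

theorem head_mem_stripVerts {C : Set V} {Q : List A} {S : Strip V A} {a : A}
    (ha : a ∈ G.stripArcs C Q S) : G.head a ∈ G.stripVerts C Q S := ⟨(a, false), rfl, ha⟩

theorem ceiling_boundary {S : Strip V A} {U : List A} (hU : S.ceiling = some U) {a : A}
    (ha : a ∈ U) : a ∈ boundaryArcs S := Or.inr ⟨U, by rw [hU]; rfl, ha⟩

theorem mem_boundaryArcs {S : Strip V A} {a : A} :
    a ∈ boundaryArcs S ↔ a ∈ S.floor ∨ ∃ U, S.ceiling = some U ∧ a ∈ U := Iff.rfl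

theorem mem_ceilingInnerVerts {S : Strip V A} {x : V} :
    x ∈ G.ceilingInnerVerts S ↔ ∃ U, S.ceiling = some U ∧ x ∈ G.internalVerts U := Iff.rfl

theorem boundary_curve {Q : List A} {S : Strip V A} {a : A} (ha : a ∈ boundaryArcs S) :
    a ∈ stripCurve Q S := by
  rcases mem_boundaryArcs.1 ha with h | ⟨U, hU, h⟩
  · exact Or.inl h
  · exact (mem_stripCurve_some hU).2 (Or.inr h)

/-! ### Sides of the boundary, and closed walks inside a strip -/

namespace Solid

variable {s t : V} {C : Set V} {Q : List A} {S : Strip V A}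

theorem floor_sides (I : G.Solid C Q S) {a : A} (ha : a ∈ S.floor) :
    G.InOuterRegion (stripCurve Q S) (G.rightFace a) ∧
      ¬ G.InOuterRegion (stripCurve Q S) (G.leftFace a) :=
  I.region.of_left (I.shape.jump_floor ha)

theorem ceiling_sides (I : G.Solid C Q S) {U : List A} (hU : S.ceiling = some U) {a : A}
    (ha : a ∈ U) : G.InOuterRegion (stripCurve Q S) (G.leftFace a) ∧
      ¬ G.InOuterRegion (stripCurve Q S) (G.rightFace a) :=
  I.region.of_right (I.shape.jump_some hU ha)

theorem dummy_sides (I : G.Solid C Q S) (hU : S.ceiling = none) {a : A}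
    (ha : a ∈ Q) : G.InOuterRegion (stripCurve Q S) (G.rightFace a) ∧
      ¬ G.InOuterRegion (stripCurve Q S) (G.leftFace a) :=
  I.region.of_left (I.shape.jump_none hU ha)

theorem curve_strip (I : G.Solid C Q S) {a : A} (ha : a ∈ stripCurve Q S) :
    a ∈ G.stripArcs C Q S := by
  refine ⟨I.shape.curve_arcs ha, ?_⟩
  rcases ha with h | h
  · exact Or.inl (I.floor_sides h).2
  · cases hU : S.ceiling with
    | none => rw [hU] at h; exact Or.inl (I.dummy_sides hU h).2
    | some U => rw [hU] at h; exact Or.inr (I.ceiling_sides hU h).2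

theorem boundary_strip (I : G.Solid C Q S) {a : A} (ha : a ∈ boundaryArcs S) :
    a ∈ G.stripArcs C Q S := I.curve_strip (boundary_curve ha)

theorem floorVerts_strip (I : G.Solid C Q S) {x : V} (hx : x ∈ G.verts S.start S.floor) :
    x ∈ G.stripVerts C Q S := by
  rcases mem_verts.1 hx with rfl | ⟨a, ha, rfl⟩
  · obtain ⟨a, p, e, h, -⟩ := I.shape.floor_path.1.cons_of_ne I.shape.start_ne
    exact h ▸ tail_mem_stripVerts (I.boundary_strip (Or.inl (by rw [e]; simp)))
  · exact head_mem_stripVerts (I.boundary_strip (Or.inl ha))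

theorem ceilingVerts_strip (I : G.Solid C Q S) {U : List A} (hU : S.ceiling = some U)
    {x : V} (hx : x ∈ G.verts S.start U) : x ∈ G.stripVerts C Q S := by
  rcases mem_verts.1 hx with rfl | ⟨a, ha, rfl⟩
  · exact I.floorVerts_strip start_mem_verts
  · exact head_mem_stripVerts (I.boundary_strip (ceiling_boundary hU ha))

theorem boundaryVerts_strip (I : G.Solid C Q S) {x : V} (hx : x ∈ G.boundaryVerts S) :
    x ∈ G.stripVerts C Q S := by
  rcases hx with hx | hx
  · exact I.floorVerts_strip hx
  · obtain ⟨U, hU, hx⟩ := mem_ceilingInnerVerts.1 hx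
    exact I.ceilingVerts_strip hU ((I.shape.some_path U hU).1.mem_verts_iff_internal.2
      (Or.inr (Or.inr hx)))

theorem mem_boundaryVerts_of_ceiling (I : G.Solid C Q S) {U : List A}
    (hU : S.ceiling = some U) {x : V} (hx : x ∈ G.verts S.start U) : x ∈ G.boundaryVerts S := by
  rcases (I.shape.some_path U hU).1.mem_verts_iff_internal.1 hx with rfl | rfl | h
  · exact Or.inl start_mem_verts
  · exact Or.inl I.shape.floor_path.1.end_mem_verts
  · exact Or.inr (mem_ceilingInnerVerts.2 ⟨U, hU, h⟩)

theorem curve_base (I : G.Solid C Q S) {d : A × Bool} (hd : d.1 ∈ stripCurve Q S) :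
    G.base d ∈ G.boundaryVerts S ∨ S.ceiling = none ∧ G.base d ∈ G.internalVerts Q := by
  have base_mem : ∀ {u v : V} {p : List A}, G.IsWalk u p v → d.1 ∈ p → G.base d ∈ G.verts u p := by
    intro u v p hp h
    by_contra hx
    exact hp.notMem_of_base hx rfl h
  rcases hd with h | h
  · exact Or.inl (Or.inl (base_mem I.shape.floor_path.1 h))
  · cases hU : S.ceiling with
    | none =>
      rw [hU] at h
      rcases (I.shape.none_path hU).1.mem_verts_iff_internal.1
        (base_mem (I.shape.none_path hU).1 h) with h' | h' | h'
      · rw [h']; exact Or.inl (Or.inl I.shape.floor_path.1.end_mem_verts)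
      · rw [h']; exact Or.inl (Or.inl start_mem_verts)
      · exact Or.inr ⟨rfl, h'⟩
    | some U =>
      rw [hU] at h
      exact Or.inl (I.mem_boundaryVerts_of_ceiling hU (base_mem (I.shape.some_path U hU).1 h))

/-- No closed walk inside a strip uses an arc of its ceiling. -/
theorem no_closed_walk [Finite V] [Finite A] [Finite Φ] (H : G.Setting s t C Q)
    (I : G.Solid C Q S) {x : V} {p : List A} (hp : G.IsWalk x p x)
    (hin : ∀ a ∈ p, a ∈ G.stripArcs C Q S) {U : List A} (hU : S.ceiling = some U) {a : A}
    (ha : a ∈ U) : a ∉ p := by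
  intro hap
  obtain ⟨h, hh, hpos⟩ := hp.exists_nonneg_potential H.no_clockwise
  -- The walk is enclosed by the strip, so the left face of the ceiling arc is outside the walk and
  -- has value 0. The jump of at least 1 would give its right face a negative value.
  have h₁ : G.InOuterRegion {b | b ∈ p} (G.leftFace a) :=
    (I.ceiling_sides hU ha).1.mono fun b hb _ => (hin b hb).2
  have h₂ : h G.outer = h (G.leftFace a) := Joined.eq_of_flat h₁ h fun b hb => by
    have := hh.2 b
    rw [mult_of_notMem hb] at this
    linarith
  have h₃ := hh.2 a
  have h₄ := one_le_mult hap
  have h₅ := hpos (G.rightFace a)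
  rw [← h₂, hh.1] at h₃
  linarith

end Solid

/-! ### Inner arcs at the boundary, and links -/

namespace Regular

variable {s t : V} {C : Set V} {Q : List A} {S : Strip V A}

/-- Inside the floor or the ceiling the two boundary arcs will do. At the start and the end of the
strip the missing arc comes from the approaching walks, which are nonempty because `s` and `t` are
not in `C`. With degree three, this leaves room for one inner dart. -/
theorem exists_notInner (H : G.Setting s t C Q) (I : G.Regular s t C Q S) {x : V}
    (hx : x ∈ G.boundaryVerts S) : ∃ a b, G.head a = x ∧ G.tail b = x ∧
      a ∉ G.innerArcs C Q S ∧ b ∉ G.innerArcs C Q S := by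
  obtain ⟨E₀, E₁, hE⟩ := I.approach
  rcases hx with hx | hx
  · obtain ⟨p₁, p₂, e, h₁, h₂⟩ := I.shape.floor_path.1.split_mem hx
    obtain ⟨a, ha, ha'⟩ : ∃ a, G.head a = x ∧ a ∉ G.innerArcs C Q S := by
      rcases List.eq_nil_or_concat' p₁ with rfl | ⟨q, a, rfl⟩
      · have hsx : S.start = x := h₁
        have hne : E₀ ≠ [] := by
          rintro rfl
          have : s = S.start := hE.walk₀
          exact H.source.1 (stripVerts_subset (this ▸ I.floorVerts_strip start_mem_verts))
        obtain ⟨q, a, rfl, h₃, h₄⟩ := hE.walk₀.concat_of_ne_nil hne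
        refine ⟨a, h₄.trans hsx, fun hin => hE.simple₀ a (by simp) ?_⟩
        exact hE.avoid₀ _ (hE.walk₀.tail_mem_verts (by simp)) (tail_mem_stripVerts hin.1)
      · exact ⟨a, (isWalk_concat.1 h₁).2, fun hin => hin.2 (Or.inl (by rw [e]; simp))⟩
    obtain ⟨b, hb, hb'⟩ : ∃ b, G.tail b = x ∧ b ∉ G.innerArcs C Q S := by
      cases p₂ with
      | nil =>
        have hfx : x = S.finish := h₂
        cases E₁ with
        | nil =>
          have : S.finish = t := hE.walk₁
          exact absurd (stripVerts_subset
            (this ▸ I.floorVerts_strip I.shape.floor_path.1.end_mem_verts)) H.sink_notMem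
        | cons b q =>
          refine ⟨b, hE.walk₁.1.trans hfx.symm, fun hin => hE.simple₁ b (by simp) ?_⟩
          exact hE.avoid₁ _ (head_mem_verts (by simp)) (head_mem_stripVerts hin.1)
      | cons b q => exact ⟨b, h₂.1, fun hin => hin.2 (Or.inl (by rw [e]; simp))⟩
    exact ⟨a, b, ha, hb, ha', hb'⟩
  · obtain ⟨U, hU, hx⟩ := mem_ceilingInnerVerts.1 hx
    obtain ⟨p₁, p₂, n₁, n₂, e, h₁, h₂⟩ := (mem_internalVerts (I.shape.some_path U hU).1).1 hx
    obtain ⟨q, a, rfl, -, ha⟩ := h₁.concat_of_ne_nil n₁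
    obtain ⟨b, r, rfl⟩ := List.exists_cons_of_ne_nil n₂
    exact ⟨a, b, ha, h₂.1, fun hin => hin.2 (ceiling_boundary hU (by rw [e]; simp)),
      fun hin => hin.2 (ceiling_boundary hU (by rw [e]; simp))⟩

/-- At most one inner arc is incident to a boundary vertex. -/
theorem inner_unique [Finite A] (H : G.Setting s t C Q) (I : G.Regular s t C Q S) {x : V}
    (hx : x ∈ G.boundaryVerts S) {d e : A × Bool} (hd : G.base d = x) (he : G.base e = x)
    (hd' : d.1 ∈ G.innerArcs C Q S) (he' : e.1 ∈ G.innerArcs C Q S) : d = e := by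
  obtain ⟨a, b, ha, hb, ha', hb'⟩ := I.exists_notInner H hx
  have hdeg := H.degree x (stripVerts_subset (I.boundaryVerts_strip hx))
  have na : ∀ {c : A × Bool}, c.1 ∈ G.innerArcs C Q S → (a, false) ≠ c := by
    rintro c hc rfl; exact ha' hc
  have nb : ∀ {c : A × Bool}, c.1 ∈ G.innerArcs C Q S → (b, true) ≠ c := by
    rintro c hc rfl; exact hb' hc
  rcases eq_of_three hdeg (d₁ := (a, false)) (d₂ := (b, true)) ha hb hd (by simp) (na hd') (nb hd')
    he with h | h | h
  · exact absurd h.symm (na he')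
  · exact absurd h.symm (nb he')
  · exact h.symm

/-- Passing through a boundary vertex would use two inner darts there. So any path of inner arcs
between boundary vertices is a link. -/
theorem internal_inner [Finite A] (H : G.Setting s t C Q) (I : G.Regular s t C Q S) {u v : V}
    {p : List A} (hp : G.IsWalk u p v) (hin : ∀ a ∈ p, a ∈ G.innerArcs C Q S) {x : V}
    (hx : x ∈ G.internalVerts p) : x ∉ G.boundaryVerts S := by
  intro hb
  obtain ⟨p₁, p₂, n₁, n₂, rfl, h₁, h₂⟩ := (mem_internalVerts hp).1 hx
  obtain ⟨q, a, rfl, -, ha⟩ := h₁.concat_of_ne_nil n₁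
  obtain ⟨b, r, rfl⟩ := List.exists_cons_of_ne_nil n₂
  have := I.inner_unique H hb (d := (a, false)) (e := (b, true)) ha h₂.1 (hin a (by simp))
    (hin b (by simp))
  simp at this

theorem isLink [Finite A] (H : G.Setting s t C Q) (I : G.Regular s t C Q S) {u v : V}
    {p : List A} (hp : G.IsPath u p v) (hne : p ≠ []) (hin : ∀ a ∈ p, a ∈ G.innerArcs C Q S)
    (hu : u ∈ G.boundaryVerts S) (hv : v ∈ G.boundaryVerts S) : G.IsLink C Q S u p v :=
  ⟨hne, hp, hin, hu, hv, fun _ hx => I.internal_inner H hp.1 hin hx⟩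

/-- At a vertex that is not a boundary vertex, either all or none of the arcs of the component are
inner arcs; in the former case no face at the vertex is outside the strip, unless the vertex is an
internal vertex of `Q`. -/
theorem inner_of_inner [Finite A] (I : G.Regular s t C Q S) {x : V}
    (hx : x ∉ G.boundaryVerts S) {d e : A × Bool} (hd : G.base d = x) (he : G.base e = x)
    (hd' : d.1 ∈ G.innerArcs C Q S) :
    (S.ceiling = none ∧ x ∈ G.internalVerts Q ∨
      ¬ G.InOuterRegion (stripCurve Q S) (G.face e)) ∧
    (e.1 ∈ G.arcsOf C → e.1 ∈ G.innerArcs C Q S) := by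
  have hb : ∀ {e : A × Bool}, G.base e = x → e.1 ∉ boundaryArcs S := by
    rintro e rfl h
    rcases mem_boundaryArcs.1 h with h | ⟨U, hU, h⟩
    · by_contra
      exact I.shape.floor_path.1.notMem_of_base (fun h' => hx (Or.inl h')) rfl h
    · exact (I.shape.some_path U hU).1.notMem_of_base
        (fun h' => hx (I.mem_boundaryVerts_of_ceiling hU h')) rfl h
  -- Internal vertices of `Q` under the dummy ceiling are on the curve without being boundary
  -- vertices; `none_strip` deals with them. Elsewhere no arc of the curve is incident to `x`, so
  -- all faces at `x` are on the same side.
  by_cases hQ : S.ceiling = none ∧ x ∈ G.internalVerts Q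
  · exact ⟨Or.inl hQ, fun hC => ⟨I.none_strip hQ.1 x hQ.2 e he hC, hb he⟩⟩
  · have hflat : G.Flat (G.InOuterRegion (stripCurve Q S)) x := Flat.of_notMem fun c hc h => by
      rcases I.curve_base h with h' | h'
      · exact hx (hc ▸ h')
      · exact hQ (hc ▸ h')
    have e₁ := hflat.face_eq hd he
    have e₂ := hflat.face_rev_eq he hd
    have e₃ := hflat e he
    have hout : ¬ G.InOuterRegion (stripCurve Q S) (G.face e) := by
      intro h
      have k₁ : G.InOuterRegion (stripCurve Q S) (G.face d) := by rw [e₁]; exact h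
      have k₂ : G.InOuterRegion (stripCurve Q S) (G.face (rev d)) := by rw [← e₂]; exact h
      obtain ⟨a, b⟩ := d
      rcases hd'.1.2 with h' | h' <;> cases b
      exacts [h' k₂, h' k₁, h' k₁, h' k₂]
    refine ⟨Or.inr hout, fun hC => ⟨⟨hC, ?_⟩, hb he⟩⟩
    obtain ⟨a, b⟩ := e
    cases b
    · exact Or.inr hout
    · exact Or.inl hout

theorem inner_of_walk [Finite A] (I : G.Regular s t C Q S) {y : V} {a : A} {p : List A}
    (hp : G.IsWalk (G.head a) p y) (ha : a ∈ G.innerArcs C Q S)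
    (hb : ∀ b ∈ p, G.tail b ∉ G.boundaryVerts S) (hC : ∀ b ∈ p, b ∈ G.arcsOf C) :
    ∀ b ∈ p, b ∈ G.innerArcs C Q S := by
  induction p generalizing a with
  | nil => simp
  | cons c p ih =>
    have hc : c ∈ G.innerArcs C Q S :=
      (I.inner_of_inner (hb c (by simp)) (d := (a, false)) (e := (c, true)) hp.1.symm rfl ha).2
        (hC c (by simp))
    intro b hb'
    rcases List.mem_cons.1 hb' with rfl | hb'
    · exact hc
    · exact ih hp.2 hc (fun b h => hb b (by simp [h])) (fun b h => hC b (by simp [h])) b hb'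

/-- An inner arc that leaves a boundary vertex is the first arc of a link. -/
theorem exists_link [Finite A] (H : G.Setting s t C Q) (I : G.Regular s t C Q S) {a : A}
    (ha : a ∈ G.innerArcs C Q S) (hx : G.tail a ∈ G.boundaryVerts S) :
    ∃ p y, G.IsLink C Q S (G.tail a) (a :: p) y := by
  have hsC : S.start ∈ C := stripVerts_subset (I.floorVerts_strip start_mem_verts)
  -- Strong connectivity leads from `a` back to the start of the strip, hence to a first boundary
  -- vertex; up to there all arcs stay inner.
  obtain ⟨w, hw⟩ := H.scc.reaches ha.1.1.2 hsC
  obtain ⟨q, hq, -⟩ := hw.exists_path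
  have hqC := fun b hb => H.scc.arcs_of_walk hq.1 ha.1.1.2 hsC (a := b) hb
  obtain ⟨p, q', y, rfl, hp, -, hy, hpb⟩ := hq.1.exists_first (· ∈ G.boundaryVerts S)
    (Or.inl start_mem_verts)
  have hin := I.inner_of_walk hp ha hpb fun b hb => hqC b (by simp [hb])
  have hin' : ∀ b ∈ a :: p, b ∈ G.innerArcs C Q S := by
    intro b hb
    rcases List.mem_cons.1 hb with rfl | hb
    · exact ha
    · exact hin b hb
  have hw' : G.IsWalk (G.tail a) (a :: p) y := ⟨rfl, hp⟩
  refine ⟨p, y, I.isLink H ⟨hw', ?_⟩ (by simp) hin' hx hy⟩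
  have e : G.verts (G.tail a) (a :: p) = G.tail a :: G.verts (G.head a) p := by simp [verts]
  rw [e, List.nodup_cons]
  -- A return to the tail of `a` would enter this boundary vertex through a second inner dart.
  refine ⟨fun hmem => ?_, (hq.of_append_left hp).2⟩
  rcases hp.mem_verts.1 hmem with h | ⟨b, hb, h⟩
  · obtain ⟨r, c, e', -, hc⟩ := hw'.concat_of_ne_nil (by simp)
    have := I.inner_unique H hx (d := (a, true)) (e := (c, false)) rfl (hc.trans h.symm) ha
      (hin' c (by rw [e']; simp))
    simp at this
  · exact hpb b hb (h ▸ hx)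

end Regular

/-! ### Strips inside strips -/

theorem IsPath.internal_append {u v w x : V} {p q : List A} (h : G.IsPath u (p ++ q) w)
    (hp : G.IsWalk u p v) (hx : x ∈ G.internalVerts (p ++ q)) :
    x ∈ G.internalVerts p ∨ x = v ∨ x ∈ G.internalVerts q := by
  obtain ⟨hu, hw⟩ := h.internal_ne hx
  have hq := (h.of_append_right hp).1
  rcases (verts_append hp).1 (h.1.mem_verts_iff_internal.2 (Or.inr (Or.inr hx))) with h' | h'
  · rcases hp.mem_verts_iff_internal.1 h' with h' | h' | h'
    · exact absurd h' hu
    · exact Or.inr (Or.inl h')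
    · exact Or.inl h'
  · rcases hq.mem_verts_iff_internal.1 h' with h' | h' | h'
    · exact Or.inr (Or.inl h')
    · exact absurd h' hw
    · exact Or.inr (Or.inr h')

theorem internal_append_left {u v w x : V} {p q : List A} (hp : G.IsWalk u p v)
    (hq : G.IsWalk v q w) (hx : x ∈ G.internalVerts p) : x ∈ G.internalVerts (p ++ q) := by
  obtain ⟨p₁, p₂, n₁, n₂, rfl, h₁, h₂⟩ := (mem_internalVerts hp).1 hx
  exact (mem_internalVerts (hp.append hq)).2
    ⟨p₁, p₂ ++ q, n₁, by simp [n₂], by simp, h₁, h₂.append hq⟩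

theorem internal_append_right {u v w x : V} {p q : List A} (hp : G.IsWalk u p v)
    (hq : G.IsWalk v q w) (hx : x ∈ G.internalVerts q) : x ∈ G.internalVerts (p ++ q) := by
  obtain ⟨p₁, p₂, n₁, n₂, rfl, h₁, h₂⟩ := (mem_internalVerts hq).1 hx
  exact (mem_internalVerts (hp.append hq)).2
    ⟨p ++ p₁, p₂, by simp [n₁], n₂, by simp, hp.append h₁, h₂⟩

theorem internal_middle {u v w : V} {p q : List A} (hp : G.IsWalk u p v)
    (hq : G.IsWalk v q w) (hp' : p ≠ []) (hq' : q ≠ []) : v ∈ G.internalVerts (p ++ q) :=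
  (mem_internalVerts (hp.append hq)).2 ⟨p, q, hp', hq', rfl, hp, hq⟩

/-- The curve of the strip `S'` is in the strip `S`. -/
def Inside (G : PlaneDigraph V A Φ) (C : Set V) (Q : List A) (S' S : Strip V A) : Prop :=
  ∀ a ∈ stripCurve Q S', a ∉ stripCurve Q S → a ∈ G.stripArcs C Q S

namespace Inside

variable {s t : V} {C : Set V} {Q : List A} {S S' : Strip V A}

theorem outer (h : G.Inside C Q S' S) {f : Φ} (hf : G.InOuterRegion (stripCurve Q S) f) :
    G.InOuterRegion (stripCurve Q S') f := hf.mono fun a ha ha' => (h a ha ha').2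

theorem strip (h : G.Inside C Q S' S) {a : A} (ha : a ∈ G.stripArcs C Q S') :
    a ∈ G.stripArcs C Q S :=
  ⟨ha.1, ha.2.imp (fun h' h'' => h' (h.outer h'')) (fun h' h'' => h' (h.outer h''))⟩

theorem stripVerts (h : G.Inside C Q S' S) {x : V} (hx : x ∈ G.stripVerts C Q S') :
    x ∈ G.stripVerts C Q S := by
  obtain ⟨d, hd, hd'⟩ := hx
  exact ⟨d, hd, h.strip hd'⟩

/-- A boundary arc of `S` has an outer side, which is outside `S'` too. If the arc is off the curve
of `S'`, both its sides are then outside `S'`. On that curve it is a boundary arc of `S'`, except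
possibly on `Q` under a dummy ceiling; `hn` then makes `Q` disjoint from the boundary of `S` as
well. -/
theorem inner (h : G.Inside C Q S' S) (I : G.Solid C Q S)
    (hn : S'.ceiling = none → S.ceiling = none) {a : A} (ha : a ∈ G.innerArcs C Q S') :
    a ∈ G.innerArcs C Q S := by
  refine ⟨h.strip ha.1, fun hb => ?_⟩
  by_cases hc : a ∈ stripCurve Q S'
  · cases hU : S'.ceiling with
    | none =>
      rcases (mem_stripCurve_none hU).1 hc with h' | h'
      · exact ha.2 (Or.inl h')
      · rcases mem_boundaryArcs.1 hb with h'' | ⟨U, hU', -⟩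
        · exact I.shape.none_disjoint (hn hU) h' h''
        · rw [hn hU] at hU'; simp at hU'
    | some U =>
      rcases (mem_stripCurve_some hU).1 hc with h' | h'
      · exact ha.2 (Or.inl h')
      · exact ha.2 (ceiling_boundary hU h')
  · have := inOuterRegion_left_iff_right (G := G) hc
    have hout : G.InOuterRegion (stripCurve Q S') (G.leftFace a) := by
      rcases mem_boundaryArcs.1 hb with h' | ⟨U, hU, h'⟩
      · exact this.2 (h.outer (I.floor_sides h').1)
      · exact h.outer (I.ceiling_sides hU h').1
    rcases ha.1.2 with h' | h'
    · exact h' hout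
    · exact h' (this.1 hout)

end Inside

/-- A vertex that is not on the curve of a strip and is incident to a face outside the strip is
not a vertex of the strip. -/
theorem notMem_stripVerts [Finite A] {C : Set V} {Q : List A} {S : Strip V A} {x : V}
    (hx : ∀ d, G.base d = x → d.1 ∉ stripCurve Q S) {d : A × Bool} (hd : G.base d = x)
    (ho : G.InOuterRegion (stripCurve Q S) (G.face d)) : x ∉ G.stripVerts C Q S := by
  rintro ⟨e, he, he'⟩
  have hflat : G.Flat (G.InOuterRegion (stripCurve Q S)) x := Flat.of_notMem hx
  have e₁ := hflat.face_eq hd he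
  have e₂ := hflat.face_rev_eq hd he
  have k₁ : G.InOuterRegion (stripCurve Q S) (G.face e) := by rw [← e₁]; exact ho
  have k₂ : G.InOuterRegion (stripCurve Q S) (G.face (rev e)) := by rw [← e₂]; exact ho
  obtain ⟨a, b⟩ := e
  rcases he'.2 with h' | h' <;> cases b
  exacts [h' k₂, h' k₁, h' k₁, h' k₂]

theorem Shape.notMem_curve {C : Set V} {Q : List A} {S : Strip V A} (H : G.Shape C Q S)
    {U : List A} (hU : S.ceiling = some U) {x : V} (hf : x ∉ G.verts S.start S.floor)
    (hc : x ∉ G.verts S.start U) (d : A × Bool) (hd : G.base d = x) :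
    d.1 ∉ stripCurve Q S := by
  intro h
  rcases (mem_stripCurve_some hU).1 h with h | h
  · exact H.floor_path.1.notMem_of_base hf hd h
  · exact (H.some_path U hU).1.notMem_of_base hc hd h

theorem Solid.start_strip {C : Set V} {Q : List A} {S : Strip V A} (I : G.Solid C Q S) :
    S.start ∈ G.stripVerts C Q S := I.floorVerts_strip start_mem_verts

theorem Solid.finish_strip {C : Set V} {Q : List A} {S : Strip V A} (I : G.Solid C Q S) :
    S.finish ∈ G.stripVerts C Q S := I.floorVerts_strip I.shape.floor_path.1.end_mem_verts

/-- The walks that approach a strip, extended along its boundary to the start and from the end of a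
strip inside it. -/
theorem Approach.extend {s t : V} {C : Set V} {Q : List A} {S S' : Strip V A} {E₀ E₁ : List A}
    (hE : G.Approach s t C Q S E₀ E₁) (I' : G.Solid C Q S') (hin : G.Inside C Q S' S)
    {A₀ A₁ : List A} (w₀ : G.IsWalk S.start A₀ S'.start) (w₁ : G.IsWalk S'.finish A₁ S.finish)
    (s₀ : ∀ x ∈ G.verts S.start A₀, x ∈ G.stripVerts C Q S)
    (s₁ : ∀ x ∈ G.verts S'.finish A₁, x ∈ G.stripVerts C Q S)
    (disj : ∀ x ∈ G.verts S.start A₀, x ∉ G.verts S'.finish A₁)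
    (a₀ : ∀ a ∈ A₀, G.tail a ∉ G.stripVerts C Q S')
    (a₁ : ∀ a ∈ A₁, G.head a ∉ G.stripVerts C Q S')
    (r₀ : ∀ a ∈ A₀, G.InOuterRegion (stripCurve Q S') (G.rightFace a))
    (r₁ : ∀ a ∈ A₁, G.InOuterRegion (stripCurve Q S') (G.rightFace a)) :
    G.Approach s t C Q S' (E₀ ++ A₀) (A₁ ++ E₁) := by
  have m₀ : ∀ x ∈ G.verts S.start A₀, x ∈ G.stripVerts C Q S' → x = S'.start := by
    intro x hx hx'
    rcases w₀.mem_verts.1 hx with h | ⟨a, ha, rfl⟩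
    · exact h
    · exact absurd hx' (a₀ a ha)
  have m₁ : ∀ x ∈ G.verts S'.finish A₁, x ∈ G.stripVerts C Q S' → x = S'.finish := by
    intro x hx hx'
    rcases mem_verts.1 hx with h | ⟨a, ha, rfl⟩
    · exact h
    · exact absurd hx' (a₁ a ha)
  refine ⟨hE.walk₀.append w₀, w₁.append hE.walk₁, ?_, ?_, ?_, ?_, ?_, ?_, ?_⟩
  · intro x hx hx'
    rcases (verts_append hE.walk₀).1 hx with h | h <;> rcases (verts_append w₁).1 hx' with h' | h'
    · have := hE.avoid₀ x h (s₁ x h')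
      exact disj x (this ▸ start_mem_verts) h'
    · exact hE.disjoint x h h'
    · exact disj x h h'
    · have := hE.avoid₁ x h' (s₀ x h)
      exact disj x h (this ▸ w₁.end_mem_verts)
  · intro x hx hx'
    rcases (verts_append hE.walk₀).1 hx with h | h
    · have := hE.avoid₀ x h (hin.stripVerts hx')
      exact m₀ x (this ▸ start_mem_verts) hx'
    · exact m₀ x h hx'
  · intro x hx hx'
    rcases (verts_append w₁).1 hx with h | h
    · exact m₁ x h hx'
    · have := hE.avoid₁ x h (hin.stripVerts hx')
      exact m₁ x (this ▸ w₁.end_mem_verts) hx'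
  · intro a ha h
    rcases List.mem_append.1 ha with ha | ha
    · exact hE.simple₀ a ha (hE.avoid₀ _ (hE.walk₀.tail_mem_verts ha)
        (h ▸ hin.stripVerts I'.start_strip))
    · exact a₀ a ha (h ▸ I'.start_strip)
  · intro a ha h
    rcases List.mem_append.1 ha with ha | ha
    · exact a₁ a ha (h ▸ I'.finish_strip)
    · exact hE.simple₁ a ha (hE.avoid₁ _ (head_mem_verts ha)
        (h ▸ hin.stripVerts I'.finish_strip))
  · intro a ha
    rcases List.mem_append.1 ha with ha | ha
    · exact hin.outer (hE.right₀ a ha)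
    · exact r₀ a ha
  · intro a ha
    rcases List.mem_append.1 ha with ha | ha
    · exact r₁ a ha
    · exact hin.outer (hE.right₁ a ha)

/-- The strip is covered by two strips whose jumps sum up to its jump. -/
theorem strip_cover {C : Set V} {Q : List A} {S S₁ S₂ : Strip V A} (R : G.Region Q S)
    (R₁ : G.Region Q S₁) (R₂ : G.Region Q S₂)
    (hj : ∀ a, stripJump Q S a = stripJump Q S₁ a + stripJump Q S₂ a) {a : A}
    (ha : a ∈ G.stripArcs C Q S) : a ∈ G.stripArcs C Q S₁ ∨ a ∈ G.stripArcs C Q S₂ := by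
  obtain ⟨h, hh, J, -⟩ := R
  obtain ⟨h₁, hh₁, J₁, -⟩ := R₁
  obtain ⟨h₂, hh₂, J₂, -⟩ := R₂
  -- A face outside both parts gets the value 0 + 0 and is therefore outside `S`.
  have e : h = h₁ + h₂ := hh.unique (by
    convert hh₁.add hh₂ using 1
    exact funext hj)
  have key : ∀ f, ¬ G.InOuterRegion (stripCurve Q S) f →
      ¬ G.InOuterRegion (stripCurve Q S₁) f ∨ ¬ G.InOuterRegion (stripCurve Q S₂) f := by
    intro f hf
    by_contra! hc
    rw [← J₁, ← J₂] at hc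
    exact hf ((J f).1 (by rw [e, Pi.add_apply, hc.1, hc.2]; norm_num))
  rcases ha.2 with h' | h'
  · rcases key _ h' with h'' | h''
    exacts [Or.inl ⟨ha.1, Or.inl h''⟩, Or.inr ⟨ha.1, Or.inl h''⟩]
  · rcases key _ h' with h'' | h''
    exacts [Or.inl ⟨ha.1, Or.inr h''⟩, Or.inr ⟨ha.1, Or.inr h''⟩]

theorem IsLink.inside {C : Set V} {Q p : List A} {u v : V} {S S' : Strip V A}
    (hp : G.IsLink C Q S u p v) (h : ∀ a ∈ stripCurve Q S', a ∈ p ∨ a ∈ stripCurve Q S) :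
    G.Inside C Q S' S := by
  intro a ha hn
  rcases h a ha with h | h
  · exact (hp.2.2.1 a h).1
  · exact absurd h hn

section Slicing

variable {s t : V} {C : Set V} {Q : List A} {s' t' u v : V}
  {f : A} {p : List A}

/-! ### Slicing by a forward path -/

section Forward

variable {U : Option (List A)} {F₁ F₂ F₃ : List A}

theorem forward_inside₁
    (hp : G.IsLink C Q ⟨s', t', U, F₁ ++ (f :: F₂) ++ F₃⟩ u p v) :
    G.Inside C Q ⟨s', t', U, F₁ ++ p ++ F₃⟩ ⟨s', t', U, F₁ ++ (f :: F₂) ++ F₃⟩ := by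
  refine hp.inside fun a ha => ?_
  rcases ha with ha | ha
  · simp only [List.mem_append] at ha
    rcases ha with (ha | ha) | ha
    · exact Or.inr (Or.inl (by simp [ha]))
    · exact Or.inl ha
    · exact Or.inr (Or.inl (by simp [ha]))
  · exact Or.inr (Or.inr ha)

theorem forward_inside₂
    (hp : G.IsLink C Q ⟨s', t', U, F₁ ++ (f :: F₂) ++ F₃⟩ u p v) :
    G.Inside C Q ⟨u, v, some p, f :: F₂⟩ ⟨s', t', U, F₁ ++ (f :: F₂) ++ F₃⟩ := by
  refine hp.inside fun a ha => ?_
  rcases (mem_stripCurve_some rfl).1 ha with ha | ha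
  · exact Or.inr (Or.inl (List.mem_append_left _ (List.mem_append_right _ ha)))
  · exact Or.inl ha

variable [Finite V] [Finite A] [Finite Φ]

/-- The orientation is inherited at `f`, a floor arc of both strips, whose right side stays outside.
-/
theorem forward_solid₂ (I : G.Solid C Q ⟨s', t', U, F₁ ++ (f :: F₂) ++ F₃⟩)
    (hp : G.IsLink C Q ⟨s', t', U, F₁ ++ (f :: F₂) ++ F₃⟩ u p v)
    (h₁ : G.IsWalk s' F₁ u) (h₂ : G.IsWalk u (f :: F₂) v) :
    G.Solid C Q ⟨u, v, some p, f :: F₂⟩ := by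
  have hF : G.IsPath s' (F₁ ++ (f :: F₂) ++ F₃) t' := I.shape.floor_path
  have hsub : ∀ a ∈ f :: F₂, a ∈ F₁ ++ (f :: F₂) ++ F₃ := fun a ha =>
    List.mem_append_left _ (List.mem_append_right _ ha)
  have hv : ∀ x ∈ G.verts u (f :: F₂), x ∈ G.verts s' (F₁ ++ (f :: F₂) ++ F₃) := fun x hx =>
    (verts_append (h₁.append h₂)).2 (Or.inl ((verts_append h₁).2 (Or.inr hx)))
  have H : G.Shape C Q ⟨u, v, some p, f :: F₂⟩ :=
    { floor_path := (hF.of_append_left (h₁.append h₂)).of_append_right h₁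
      floor_ne := by simp
      floor_arcs := fun a ha => I.shape.floor_arcs a (hsub a ha)
      some_path := by rintro _ ⟨⟩; exact hp.2.1
      some_arcs := by rintro _ ⟨⟩ a ha; exact (hp.2.2.1 a ha).1.1
      some_internal := by
        rintro _ ⟨⟩ x hx hx'
        exact hp.2.2.2.2.2 x hx (Or.inl (hv x hx'))
      some_disjoint := by
        rintro _ ⟨⟩ a ha ha'
        exact (hp.2.2.1 a ha).2 (Or.inl (hsub a ha'))
      none_path := by rintro ⟨⟩
      none_arcs := I.shape.none_arcs
      none_internal := by rintro ⟨⟩ }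
  exact ⟨H, H.region_of_left (a := f) (H.jump_floor (by simp))
    ((forward_inside₂ hp).outer (I.floor_sides (hsub f (by simp))).1)⟩

/-- A forward path in a strip with dummy ceiling does not meet `Q`. -/
theorem forward_disjoint (H : G.Setting s t C Q) {F₁ F₂ F₃ : List A}
    (I : G.Solid C Q ⟨s', t', none, F₁ ++ (f :: F₂) ++ F₃⟩)
    (hp : G.IsLink C Q ⟨s', t', none, F₁ ++ (f :: F₂) ++ F₃⟩ u p v)
    (h₁ : G.IsWalk s' F₁ u) (h₂ : G.IsWalk u (f :: F₂) v) {x : V} (hx : x ∈ G.internalVerts Q)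
    (hx' : x ∈ G.verts u p) : False := by
  have I₂ := forward_solid₂ I hp h₁ h₂
  have hQ : G.IsPath t' Q s' := I.shape.none_path rfl
  have hF := I.shape.none_internal rfl x hx
  -- As a ceiling arc of the down-strip, an arc of `p` has its right side enclosed; an arc of `Q`
  -- has its right side outside.
  have harc : ∀ a ∈ p, a ∉ Q := fun a ha haQ =>
    (I₂.ceiling_sides rfl ha).2 ((forward_inside₂ hp).outer (I.dummy_sides rfl haQ).1)
  have hnb : ∀ y ∈ G.boundaryVerts (⟨s', t', none, F₁ ++ (f :: F₂) ++ F₃⟩ : Strip V A), x ≠ y := by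
    rintro y (hy | hy) rfl
    · exact hF hy
    · obtain ⟨U, hU, -⟩ := mem_ceilingInnerVerts.1 hy
      simp at hU
  rcases hp.2.1.1.mem_verts_iff_internal.1 hx' with h | h | h
  · exact hnb u hp.2.2.2.1 h
  · exact hnb v hp.2.2.2.2.1 h
  · obtain ⟨p₁, p₂, n₁, n₂, rfl, k₁, k₂⟩ := (mem_internalVerts hp.2.1.1).1 h
    obtain ⟨q₁, q₂, m₁, m₂, rfl, l₁, l₂⟩ := (mem_internalVerts hQ.1).1 hx
    obtain ⟨p₁, a, rfl, -, ha⟩ := k₁.concat_of_ne_nil n₁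
    obtain ⟨q₁, b, rfl, -, hb⟩ := l₁.concat_of_ne_nil m₁
    obtain ⟨a', p₂, rfl⟩ := List.exists_cons_of_ne_nil n₂
    obtain ⟨b', q₂, rfl⟩ := List.exists_cons_of_ne_nil m₂
    have hxC : x ∈ C := hb ▸ (I.shape.none_arcs b (by simp)).2
    -- A common internal vertex would have four darts, two of `p` and two of `Q`.
    rcases eq_of_three (H.degree x hxC) (d₁ := (a, false)) (d₂ := (a', true)) (d₃ := (b, false))
      (d := (b', true)) ha k₂.1 hb (by simp)
      (fun h => harc a (by simp) (by
        have e : a = b := congrArg Prod.fst h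
        simp [e])) (by simp) l₂.1 with h | h | h
    · simp at h
    · exact harc a' (by simp) (by
        have e : b' = a' := congrArg Prod.fst h
        simp [← e])
    · simp at h

/-- The orientation is read off at an arc above the floor that survives the slicing: a ceiling arc,
or an arc of `Q` if the ceiling is the dummy one. In the latter case `forward_disjoint` keeps the
new floor away from `Q`. -/
theorem forward_solid₁ (H : G.Setting s t C Q)
    (I : G.Solid C Q ⟨s', t', U, F₁ ++ (f :: F₂) ++ F₃⟩)
    (hp : G.IsLink C Q ⟨s', t', U, F₁ ++ (f :: F₂) ++ F₃⟩ u p v)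
    (h₁ : G.IsWalk s' F₁ u) (h₂ : G.IsWalk u (f :: F₂) v) :
    G.Solid C Q ⟨s', t', U, F₁ ++ p ++ F₃⟩ := by
  have hF : G.IsPath s' (F₁ ++ (f :: F₂) ++ F₃) t' := I.shape.floor_path
  have hF' : G.IsPath s' (F₁ ++ ((f :: F₂) ++ F₃)) t' := by rwa [List.append_assoc] at hF
  have h₁₂ := h₁.append h₂
  have m₁ : ∀ x ∈ G.verts s' F₁, x ∈ G.verts s' (F₁ ++ (f :: F₂) ++ F₃) := fun x hx =>
    (verts_append h₁₂).2 (Or.inl ((verts_append h₁).2 (Or.inl hx)))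
  have m₃ : ∀ x ∈ G.verts v F₃, x ∈ G.verts s' (F₁ ++ (f :: F₂) ++ F₃) := fun x hx =>
    (verts_append h₁₂).2 (Or.inr hx)
  have hpint : ∀ x ∈ G.internalVerts p, x ∉ G.verts s' (F₁ ++ (f :: F₂) ++ F₃) := fun x hx hx' =>
    hp.2.2.2.2.2 x hx (Or.inl hx')
  have hP₁ : G.IsPath s' F₁ u := hF'.of_append_left h₁
  have hP₃ : G.IsPath v F₃ t' := hF.of_append_right h₁₂
  have d₁₃ : ∀ a ∈ F₃, G.head a ∉ G.verts s' (F₁ ++ (f :: F₂)) := fun a ha => hF.append_disjoint ha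
  have d₁₃' : ∀ a ∈ F₃, G.head a ∉ G.verts s' F₁ := fun a ha h =>
    d₁₃ a ha ((verts_append h₁).2 (Or.inl h))
  have hv₁ : v ∉ G.verts s' F₁ := by
    obtain ⟨r, b, e, -, hb⟩ := h₂.concat_of_ne_nil (by simp)
    rw [← hb]
    exact (hF.of_append_left h₁₂).append_disjoint (by rw [e]; simp)
  have hpF : G.IsPath u (p ++ F₃) t' := by
    refine hp.2.1.append hP₃ fun a ha hx => ?_
    rcases hp.2.1.1.mem_verts_iff_internal.1 hx with h | h | h
    · exact d₁₃' a ha (h ▸ h₁.end_mem_verts)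
    · exact hP₃.start_notMem ha h
    · exact hpint _ h (m₃ _ (head_mem_verts ha))
  have hfl : G.IsPath s' (F₁ ++ p ++ F₃) t' := by
    rw [List.append_assoc]
    refine hP₁.append hpF fun a ha hx => ?_
    rcases List.mem_append.1 ha with ha | ha
    · rcases hp.2.1.1.head_cases ha with h | h
      · exact hv₁ (h ▸ hx)
      · exact hpint _ h (m₁ _ hx)
    · exact d₁₃' a ha hx
  have hmem : ∀ x, x ∈ G.verts s' (F₁ ++ p ++ F₃) →
      x ∈ G.verts s' (F₁ ++ (f :: F₂) ++ F₃) ∨ x ∈ G.verts u p := by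
    intro x hx
    rcases (verts_append (h₁.append hp.2.1.1)).1 hx with h | h
    · rcases (verts_append h₁).1 h with h | h
      · exact Or.inl (m₁ x h)
      · exact Or.inr h
    · exact Or.inl (m₃ x h)
  have Sh : G.Shape C Q ⟨s', t', U, F₁ ++ p ++ F₃⟩ :=
    { floor_path := hfl
      floor_ne := by simp [hp.1]
      floor_arcs := fun a ha => by
        simp only [List.mem_append] at ha
        rcases ha with (ha | ha) | ha
        · exact I.shape.floor_arcs a (by simp [ha])
        · exact (hp.2.2.1 a ha).1.1
        · exact I.shape.floor_arcs a (by simp [ha])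
      some_path := fun W hW => I.shape.some_path W hW
      some_arcs := fun W hW => I.shape.some_arcs W hW
      some_internal := fun W hW x hx hx' => by
        rcases hmem x hx' with h | h
        · exact I.shape.some_internal W hW x hx h
        · rcases hp.2.1.1.mem_verts_iff_internal.1 h with h | h | h
          · exact I.shape.some_internal W hW x hx (m₁ x (h ▸ h₁.end_mem_verts))
          · exact I.shape.some_internal W hW x hx (m₃ x (h ▸ start_mem_verts))
          · exact hp.2.2.2.2.2 x h (Or.inr ⟨W, hW, hx⟩)
      some_disjoint := fun W hW a ha ha' => by
        simp only [List.mem_append] at ha'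
        rcases ha' with (h | h) | h
        · exact I.shape.some_disjoint W hW a ha (by simp [h])
        · exact (hp.2.2.1 a h).2 (Or.inr ⟨W, hW, ha⟩)
        · exact I.shape.some_disjoint W hW a ha (by simp [h])
      none_path := fun hW => I.shape.none_path hW
      none_arcs := I.shape.none_arcs
      none_internal := fun hW x hx hx' => by
        rcases hmem x hx' with h | h
        · exact I.shape.none_internal hW x hx h
        · cases hW
          exact forward_disjoint H I hp h₁ h₂ hx h }
  refine ⟨Sh, ?_⟩
  cases U with
  | none =>
    obtain ⟨a, q, hq⟩ := List.exists_cons_of_ne_nil (I.shape.none_ne rfl)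
    have ha : a ∈ Q := by rw [hq]; simp
    exact Sh.region_of_left (Sh.jump_none rfl ha)
      ((forward_inside₁ hp).outer (I.dummy_sides rfl ha).1)
  | some W =>
    obtain ⟨a, q, hq⟩ := List.exists_cons_of_ne_nil (I.shape.some_ne (U := W) rfl)
    have ha : a ∈ W := by rw [hq]; simp
    exact Sh.region_of_right (Sh.jump_some rfl ha)
      ((forward_inside₁ hp).outer (I.ceiling_sides rfl ha).1)

theorem forward_regular (H : G.Setting s t C Q)
    (I : G.Regular s t C Q ⟨s', t', U, F₁ ++ (f :: F₂) ++ F₃⟩)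
    (hp : G.IsLink C Q ⟨s', t', U, F₁ ++ (f :: F₂) ++ F₃⟩ u p v)
    (h₁ : G.IsWalk s' F₁ u) (h₂ : G.IsWalk u (f :: F₂) v) (h₃ : G.IsWalk v F₃ t') :
    (∀ a ∈ G.stripArcs C Q ⟨s', t', U, F₁ ++ (f :: F₂) ++ F₃⟩,
      a ∈ G.stripArcs C Q ⟨s', t', U, F₁ ++ p ++ F₃⟩ ∨
      a ∈ G.stripArcs C Q ⟨u, v, some p, f :: F₂⟩) ∧
    G.Regular s t C Q ⟨s', t', U, F₁ ++ p ++ F₃⟩ ∧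
    G.Regular s t C Q ⟨u, v, some p, f :: F₂⟩ := by
  have hF : G.IsPath s' (F₁ ++ (f :: F₂) ++ F₃) t' := I.shape.floor_path
  have h₁₂ := h₁.append h₂
  have S₁ := forward_solid₁ H I.toSolid hp h₁ h₂
  have S₂ := forward_solid₂ I.toSolid hp h₁ h₂
  have i₁ := forward_inside₁ hp
  have i₂ := forward_inside₂ hp
  have cover : ∀ a ∈ G.stripArcs C Q ⟨s', t', U, F₁ ++ (f :: F₂) ++ F₃⟩,
      a ∈ G.stripArcs C Q ⟨s', t', U, F₁ ++ p ++ F₃⟩ ∨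
      a ∈ G.stripArcs C Q ⟨u, v, some p, f :: F₂⟩ := fun a ha =>
    -- The contributions of `p`, floor of one part and ceiling of the other, cancel.
    strip_cover I.region S₁.region S₂.region (fun a => by
      simp only [stripJump, mult_append, Option.elim_some]; ring) ha
  have hpint : ∀ x ∈ G.internalVerts p, x ∉ G.verts s' (F₁ ++ (f :: F₂) ++ F₃) := fun x hx hx' =>
    hp.2.2.2.2.2 x hx (Or.inl hx')
  have m₁ : ∀ x ∈ G.verts s' F₁, x ∈ G.verts s' (F₁ ++ (f :: F₂) ++ F₃) := fun x hx =>
    (verts_append h₁₂).2 (Or.inl ((verts_append h₁).2 (Or.inl hx)))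
  have m₃ : ∀ x ∈ G.verts v F₃, x ∈ G.verts s' (F₁ ++ (f :: F₂) ++ F₃) := fun x hx =>
    (verts_append h₁₂).2 (Or.inr hx)
  have notp : ∀ x ∈ G.verts s' (F₁ ++ (f :: F₂) ++ F₃), x ≠ u → x ≠ v → x ∉ G.verts u p := by
    intro x hx hu hv h
    rcases hp.2.1.1.mem_verts_iff_internal.1 h with h | h | h
    exacts [hu h, hv h, hpint x h hx]
  obtain ⟨E₀, E₁, hE⟩ := I.approach
  refine ⟨cover, { S₁ with none_strip := ?_, approach := ?_ },
    { S₂ with none_strip := by rintro ⟨⟩, approach := ?_ }⟩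
  · intro hU x hx d hd hdC
    cases hU
    -- No arc at `x` belongs to the down-strip: `x` is not on its curve, and the face on the right
    -- of the arc `b` of `Q` entering `x` is outside.
    refine (cover _ (I.none_strip rfl x hx d hd hdC)).resolve_right fun h => ?_
    obtain ⟨q₁, q₂, n₁, n₂, e, k₁, k₂⟩ := (mem_internalVerts (I.shape.none_path rfl).1).1 hx
    obtain ⟨q₁, b, rfl, -, hb⟩ := k₁.concat_of_ne_nil n₁
    have hbQ : b ∈ Q := by rw [e]; simp
    refine notMem_stripVerts (S₂.shape.notMem_curve rfl ?_ ?_) (d := (b, false)) hb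
      (i₂.outer (I.dummy_sides rfl hbQ).1) ⟨d, hd, h⟩
    · intro hx'
      exact I.shape.none_internal rfl x hx
        ((verts_append h₁₂).2 (Or.inl ((verts_append h₁).2 (Or.inr hx'))))
    · exact fun hx' => forward_disjoint H I.toSolid hp h₁ h₂ hx hx'
  -- The up-strip keeps the ends of the strip, so the approaching walks need no extension.
  · have := hE.extend S₁ i₁ (A₀ := []) (A₁ := []) rfl rfl
      (by simpa [verts] using I.toSolid.start_strip) (by simpa [verts] using I.toSolid.finish_strip)
      (by simpa [verts] using I.shape.start_ne) (by simp) (by simp) (by simp) (by simp)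
    exact ⟨_, _, this⟩
  · have hu₂ : ∀ a ∈ F₁, G.tail a ∉ G.verts u ((f :: F₂) ++ F₃) := fun a ha => by
      have hF' : G.IsPath s' (F₁ ++ ((f :: F₂) ++ F₃)) t' := by rwa [List.append_assoc] at hF
      exact hF'.append_disjoint_tail h₁ ha
    have mu : ∀ {x}, x ∈ G.verts u (f :: F₂) → x ∈ G.verts u ((f :: F₂) ++ F₃) := fun h =>
      (verts_append h₂).2 (Or.inl h)
    have dj : ∀ a ∈ F₃, G.head a ∉ G.verts s' (F₁ ++ (f :: F₂)) := fun a ha =>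
      hF.append_disjoint ha
    have hv₁ : v ∉ G.verts s' F₁ := by
      obtain ⟨r, b, e, -, hb⟩ := h₂.concat_of_ne_nil (by simp)
      rw [← hb]
      exact (hF.of_append_left h₁₂).append_disjoint (by rw [e]; simp)
    -- The down-strip from `u` to `v` is approached along the remaining parts `F₁` and `F₃` of the
    -- old floor.
    refine ⟨_, _, hE.extend S₂ i₂ (A₀ := F₁) (A₁ := F₃) h₁ h₃
      (fun x hx => I.floorVerts_strip (m₁ x hx)) (fun x hx => I.floorVerts_strip (m₃ x hx))
      ?_ ?_ ?_ ?_ ?_⟩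
    · intro x hx hx'
      rcases mem_verts.1 hx' with rfl | ⟨a, ha, rfl⟩
      · exact hv₁ hx
      · exact dj a ha ((verts_append h₁).2 (Or.inl hx))
    · intro a ha
      have hat := h₁.tail_mem_verts ha
      refine notMem_stripVerts (S₂.shape.notMem_curve rfl (fun h => hu₂ a ha (mu h))
        (notp _ (m₁ _ hat) ?_ ?_)) (d := (a, true)) rfl ?_
      · exact fun h => hu₂ a ha (h ▸ start_mem_verts)
      · exact fun h => hu₂ a ha (h ▸ mu h₂.end_mem_verts)
      · have hc : a ∉ stripCurve Q ⟨u, v, some p, f :: F₂⟩ :=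
          S₂.shape.notMem_curve rfl (fun h => hu₂ a ha (mu h)) (notp _ (m₁ _ hat)
            (fun h => hu₂ a ha (h ▸ start_mem_verts))
            (fun h => hu₂ a ha (h ▸ mu h₂.end_mem_verts))) (a, true) rfl
        exact (inOuterRegion_left_iff_right hc).2
          (i₂.outer (I.floor_sides (a := a) (by simp [ha])).1)
    · intro a ha
      refine notMem_stripVerts (S₂.shape.notMem_curve rfl
        (fun h => dj a ha ((verts_append h₁).2 (Or.inr h)))
        (notp _ (m₃ _ (head_mem_verts ha)) ?_ ?_)) (d := (a, false)) rfl
        (i₂.outer (I.floor_sides (a := a) (by simp [ha])).1)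
      · exact fun h => dj a ha ((verts_append h₁).2 (Or.inr (h ▸ start_mem_verts)))
      · exact (hF.of_append_right h₁₂).start_notMem ha
    · exact fun a ha => i₂.outer (I.floor_sides (a := a) (by simp [ha])).1
    · exact fun a ha => i₂.outer (I.floor_sides (a := a) (by simp [ha])).1

end Forward

end Slicing

/-! ### Slicing by an up-cross path -/

section UpCross

variable {s t : V} {C : Set V} {Q : List A} {s' t' u v : V}
  {f : A} {p U₁ U₂ F₁ F₂ : List A}

theorem upCross_inside₁
    (hp : G.IsLink C Q ⟨s', t', some (U₁ ++ U₂), F₁ ++ (f :: F₂)⟩ u p v) :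
    G.Inside C Q ⟨s', v, some U₁, F₁ ++ p⟩ ⟨s', t', some (U₁ ++ U₂), F₁ ++ (f :: F₂)⟩ := by
  refine hp.inside fun a ha => ?_
  rcases (mem_stripCurve_some rfl).1 ha with ha | ha
  · rcases List.mem_append.1 ha with ha | ha
    · exact Or.inr (Or.inl (List.mem_append_left _ ha))
    · exact Or.inl ha
  · exact Or.inr (Or.inr (List.mem_append_left _ ha))

theorem upCross_inside₂
    (hp : G.IsLink C Q ⟨s', t', some (U₁ ++ U₂), F₁ ++ (f :: F₂)⟩ u p v) :
    G.Inside C Q ⟨u, t', some (p ++ U₂), f :: F₂⟩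
      ⟨s', t', some (U₁ ++ U₂), F₁ ++ (f :: F₂)⟩ := by
  refine hp.inside fun a ha => ?_
  rcases (mem_stripCurve_some rfl).1 ha with ha | ha
  · exact Or.inr (Or.inl (List.mem_append_right _ ha))
  · rcases List.mem_append.1 ha with ha | ha
    · exact Or.inl ha
    · exact Or.inr (Or.inr (List.mem_append_right _ ha))

/-- The incidences between the end vertices, the floor and the ceiling of a strip that is sliced by
an up-cross path. -/
theorem upCross_incidence (I : G.Solid C Q ⟨s', t', some (U₁ ++ U₂), F₁ ++ (f :: F₂)⟩)
    (hp : G.IsLink C Q ⟨s', t', some (U₁ ++ U₂), F₁ ++ (f :: F₂)⟩ u p v)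
    (h₁ : G.IsWalk s' F₁ u) (h₂ : G.IsWalk u (f :: F₂) t')
    (k₁ : G.IsWalk s' U₁ v) (k₂ : G.IsWalk v U₂ t') (n₁ : U₁ ≠ []) (n₂ : U₂ ≠ []) :
    v ∉ G.verts s' (F₁ ++ (f :: F₂)) ∧ t' ∉ G.verts s' F₁ ∧
    (∀ x ∈ G.internalVerts p, x ∉ G.verts s' (F₁ ++ (f :: F₂)) ∧
      x ∉ G.verts s' (U₁ ++ U₂)) ∧
    ∀ a ∈ U₂, G.head a ∉ G.verts u p ∧ G.head a ∉ G.verts s' F₁ := by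
  have hF : G.IsPath s' (F₁ ++ (f :: F₂)) t' := I.shape.floor_path
  have hU : G.IsPath s' (U₁ ++ U₂) t' := I.shape.some_path _ rfl
  have hUF : ∀ x ∈ G.internalVerts (U₁ ++ U₂), x ∉ G.verts s' (F₁ ++ (f :: F₂)) :=
    I.shape.some_internal _ rfl
  have huF : u ∈ G.verts s' (F₁ ++ (f :: F₂)) := (verts_append h₁).2 (Or.inl h₁.end_mem_verts)
  have hut : u ≠ t' := (hF.of_append_right h₁).ne (by simp)
  have htF : t' ∉ G.verts s' F₁ := fun h =>
    hut (hF.eq_of_mem_mem h₁ h h₂.end_mem_verts).symm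
  have hpb : ∀ x ∈ G.internalVerts p, x ∉ G.verts s' (F₁ ++ (f :: F₂)) ∧
      x ∉ G.verts s' (U₁ ++ U₂) := fun x hx =>
    ⟨fun h => hp.2.2.2.2.2 x hx (Or.inl h),
      fun h => hp.2.2.2.2.2 x hx (I.mem_boundaryVerts_of_ceiling rfl h)⟩
  refine ⟨hUF v (internal_middle k₁ k₂ n₁ n₂), htF, hpb, fun a ha => ⟨fun h => ?_, fun h => ?_⟩⟩
  · rcases hp.2.1.1.mem_verts_iff_internal.1 h with h | h | h
    · rcases k₂.head_cases ha with h' | h'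
      · exact hut (h.symm.trans h')
      · exact hUF _ (internal_append_right k₁ k₂ h') (h ▸ huF)
    · exact (hU.of_append_right k₁).start_notMem ha h
    · exact (hpb _ h).2 ((verts_append k₁).2 (Or.inr (head_mem_verts ha)))
  · rcases k₂.head_cases ha with h' | h'
    · exact htF (h' ▸ h)
    · exact hUF _ (internal_append_right k₁ k₂ h') ((verts_append h₁).2 (Or.inl h))

variable [Finite V] [Finite A] [Finite Φ]

theorem upCross_solid₁ (I : G.Solid C Q ⟨s', t', some (U₁ ++ U₂), F₁ ++ (f :: F₂)⟩)
    (hp : G.IsLink C Q ⟨s', t', some (U₁ ++ U₂), F₁ ++ (f :: F₂)⟩ u p v)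
    (h₁ : G.IsWalk s' F₁ u) (h₂ : G.IsWalk u (f :: F₂) t')
    (k₁ : G.IsWalk s' U₁ v) (k₂ : G.IsWalk v U₂ t') (n₁ : U₁ ≠ []) (n₂ : U₂ ≠ []) :
    G.Solid C Q ⟨s', v, some U₁, F₁ ++ p⟩ := by
  obtain ⟨hvF, -, hpb, -⟩ := upCross_incidence I hp h₁ h₂ k₁ k₂ n₁ n₂
  have hF : G.IsPath s' (F₁ ++ (f :: F₂)) t' := I.shape.floor_path
  have hU : G.IsPath s' (U₁ ++ U₂) t' := I.shape.some_path _ rfl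
  have m₁ : ∀ x ∈ G.verts s' F₁, x ∈ G.verts s' (F₁ ++ (f :: F₂)) := fun x hx =>
    (verts_append h₁).2 (Or.inl hx)
  have Sh : G.Shape C Q ⟨s', v, some U₁, F₁ ++ p⟩ :=
    { floor_path := (hF.of_append_left h₁).append hp.2.1 fun a ha hx => by
        rcases hp.2.1.1.head_cases ha with h | h
        · exact hvF (h ▸ m₁ _ hx)
        · exact (hpb _ h).1 (m₁ _ hx)
      floor_ne := by simp [hp.1]
      floor_arcs := fun a ha => by
        rcases List.mem_append.1 ha with ha | ha
        · exact I.shape.floor_arcs a (List.mem_append_left _ ha)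
        · exact (hp.2.2.1 a ha).1.1
      some_path := by rintro _ ⟨⟩; exact hU.of_append_left k₁
      some_arcs := by rintro _ ⟨⟩ a ha; exact I.shape.some_arcs _ rfl a (List.mem_append_left _ ha)
      some_internal := by
        rintro _ ⟨⟩ x hx hx'
        have hn := I.shape.some_internal _ rfl x (internal_append_left k₁ k₂ hx)
        rcases (verts_append h₁).1 hx' with h | h
        · exact hn (m₁ x h)
        · rcases hp.2.1.1.mem_verts_iff_internal.1 h with h | h | h
          · exact hn (m₁ x (h ▸ h₁.end_mem_verts))
          · exact ((hU.of_append_left k₁).internal_ne hx).2 h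
          · exact (hpb x h).2 ((verts_append k₁).2
              (Or.inl (k₁.mem_verts_iff_internal.2 (Or.inr (Or.inr hx)))))
      some_disjoint := by
        rintro _ ⟨⟩ a ha ha'
        rcases List.mem_append.1 ha' with h | h
        · exact I.shape.some_disjoint _ rfl a (List.mem_append_left _ ha) (List.mem_append_left _ h)
        · exact (hp.2.2.1 a h).2 (ceiling_boundary rfl (List.mem_append_left _ ha))
      none_path := by rintro ⟨⟩
      none_arcs := I.shape.none_arcs
      none_internal := by rintro ⟨⟩ }
  obtain ⟨a, q, hq⟩ := List.exists_cons_of_ne_nil n₁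
  have ha : a ∈ U₁ := by rw [hq]; simp
  exact ⟨Sh, Sh.region_of_right (Sh.jump_some rfl ha)
    ((upCross_inside₁ hp).outer (I.ceiling_sides rfl (List.mem_append_left _ ha)).1)⟩

theorem upCross_solid₂ (I : G.Solid C Q ⟨s', t', some (U₁ ++ U₂), F₁ ++ (f :: F₂)⟩)
    (hp : G.IsLink C Q ⟨s', t', some (U₁ ++ U₂), F₁ ++ (f :: F₂)⟩ u p v)
    (h₁ : G.IsWalk s' F₁ u) (h₂ : G.IsWalk u (f :: F₂) t')
    (k₁ : G.IsWalk s' U₁ v) (k₂ : G.IsWalk v U₂ t') (n₁ : U₁ ≠ []) (n₂ : U₂ ≠ []) :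
    G.Solid C Q ⟨u, t', some (p ++ U₂), f :: F₂⟩ := by
  obtain ⟨hvF, -, hpb, hU₂⟩ := upCross_incidence I hp h₁ h₂ k₁ k₂ n₁ n₂
  have hF : G.IsPath s' (F₁ ++ (f :: F₂)) t' := I.shape.floor_path
  have hU : G.IsPath s' (U₁ ++ U₂) t' := I.shape.some_path _ rfl
  have hpU : G.IsPath u (p ++ U₂) t' :=
    hp.2.1.append (hU.of_append_right k₁) fun a ha => (hU₂ a ha).1
  have Sh : G.Shape C Q ⟨u, t', some (p ++ U₂), f :: F₂⟩ :=
    { floor_path := hF.of_append_right h₁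
      floor_ne := by simp
      floor_arcs := fun a ha => I.shape.floor_arcs a (List.mem_append_right _ ha)
      some_path := by rintro _ ⟨⟩; exact hpU
      some_arcs := by
        rintro _ ⟨⟩ a ha
        rcases List.mem_append.1 ha with ha | ha
        · exact (hp.2.2.1 a ha).1.1
        · exact I.shape.some_arcs _ rfl a (List.mem_append_right _ ha)
      some_internal := by
        rintro _ ⟨⟩ x hx hx'
        have hx' : x ∈ G.verts s' (F₁ ++ (f :: F₂)) := (verts_append h₁).2 (Or.inr hx')
        rcases hpU.internal_append hp.2.1.1 hx with h | h | h
        · exact (hpb x h).1 hx'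
        · exact hvF (h ▸ hx')
        · exact I.shape.some_internal _ rfl x (internal_append_right k₁ k₂ h) hx'
      some_disjoint := by
        rintro _ ⟨⟩ a ha ha'
        rcases List.mem_append.1 ha with h | h
        · exact (hp.2.2.1 a h).2 (Or.inl (List.mem_append_right _ ha'))
        · exact I.shape.some_disjoint _ rfl a (List.mem_append_right _ h)
            (List.mem_append_right _ ha')
      none_path := by rintro ⟨⟩
      none_arcs := I.shape.none_arcs
      none_internal := by rintro ⟨⟩ }
  exact ⟨Sh, Sh.region_of_left (a := f) (Sh.jump_floor (by simp))
    ((upCross_inside₂ hp).outer (I.floor_sides (a := f) (by simp)).1)⟩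

theorem upCross_regular
    (I : G.Regular s t C Q ⟨s', t', some (U₁ ++ U₂), F₁ ++ (f :: F₂)⟩)
    (hp : G.IsLink C Q ⟨s', t', some (U₁ ++ U₂), F₁ ++ (f :: F₂)⟩ u p v)
    (h₁ : G.IsWalk s' F₁ u) (h₂ : G.IsWalk u (f :: F₂) t')
    (k₁ : G.IsWalk s' U₁ v) (k₂ : G.IsWalk v U₂ t') (n₁ : U₁ ≠ []) (n₂ : U₂ ≠ []) :
    (∀ a ∈ G.stripArcs C Q ⟨s', t', some (U₁ ++ U₂), F₁ ++ (f :: F₂)⟩,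
      a ∈ G.stripArcs C Q ⟨s', v, some U₁, F₁ ++ p⟩ ∨
      a ∈ G.stripArcs C Q ⟨u, t', some (p ++ U₂), f :: F₂⟩) ∧
    G.Regular s t C Q ⟨s', v, some U₁, F₁ ++ p⟩ ∧
    G.Regular s t C Q ⟨u, t', some (p ++ U₂), f :: F₂⟩ := by
  obtain ⟨hvF, htF, hpb, hU₂⟩ := upCross_incidence I.toSolid hp h₁ h₂ k₁ k₂ n₁ n₂
  have hF : G.IsPath s' (F₁ ++ (f :: F₂)) t' := I.shape.floor_path
  have hU : G.IsPath s' (U₁ ++ U₂) t' := I.shape.some_path _ rfl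
  have S₁ := upCross_solid₁ I.toSolid hp h₁ h₂ k₁ k₂ n₁ n₂
  have S₂ := upCross_solid₂ I.toSolid hp h₁ h₂ k₁ k₂ n₁ n₂
  have i₁ := upCross_inside₁ hp
  have i₂ := upCross_inside₂ hp
  have m₁ : ∀ x ∈ G.verts s' F₁, x ∈ G.verts s' (F₁ ++ (f :: F₂)) := fun x hx =>
    (verts_append h₁).2 (Or.inl hx)
  obtain ⟨E₀, E₁, hE⟩ := I.approach
  refine ⟨fun a ha => strip_cover I.region S₁.region S₂.region (fun a => by
      simp only [stripJump, mult_append, Option.elim_some]; ring) ha,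
    { S₁ with none_strip := by rintro ⟨⟩, approach := ?_ },
    { S₂ with none_strip := by rintro ⟨⟩, approach := ?_ }⟩
  · have key : ∀ a ∈ U₂, ∀ d, G.base d = G.head a →
        d.1 ∉ stripCurve Q ⟨s', v, some U₁, F₁ ++ p⟩ := fun a ha =>
      S₁.shape.notMem_curve rfl
        (fun h => ((verts_append h₁).1 h).elim (hU₂ a ha).2 (hU₂ a ha).1) (hU.append_disjoint ha)
    have hr : ∀ a ∈ U₂,
        G.InOuterRegion (stripCurve Q ⟨s', v, some U₁, F₁ ++ p⟩) (G.rightFace a) := fun a ha =>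
      (inOuterRegion_left_iff_right (key a ha (a, false) rfl)).1
        (i₁.outer (I.ceiling_sides rfl (List.mem_append_right _ ha)).1)
    -- The up-strip now ends at `v`, and the walk to `t` continues along the rest `U₂` of the old
    -- ceiling.
    refine ⟨_, _, hE.extend S₁ i₁ (A₀ := []) (A₁ := U₂) rfl k₂
      (by simpa [verts] using I.toSolid.start_strip)
      (fun x hx => I.ceilingVerts_strip rfl ((verts_append k₁).2 (Or.inr hx))) ?_ (by simp)
      (fun a ha => notMem_stripVerts (key a ha) (d := (a, false)) rfl (hr a ha)) (by simp) hr⟩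
    intro x hx hx'
    have : x = s' := by simpa [verts] using hx
    subst this
    exact hvF (hU.eq_of_mem_mem k₁ start_mem_verts hx' ▸ start_mem_verts)
  · have key : ∀ a ∈ F₁, ∀ d, G.base d = G.tail a →
        d.1 ∉ stripCurve Q ⟨u, t', some (p ++ U₂), f :: F₂⟩ := by
      intro a ha
      have hn := hF.append_disjoint_tail h₁ ha
      have hm := m₁ _ (h₁.tail_mem_verts ha)
      refine S₂.shape.notMem_curve rfl hn fun h => ?_
      rcases (verts_append hp.2.1.1).1 h with h | h
      · rcases hp.2.1.1.mem_verts_iff_internal.1 h with h | h | h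
        · exact hn (h ▸ start_mem_verts)
        · exact hvF (h ▸ hm)
        · exact (hpb _ h).1 hm
      · rcases k₂.mem_verts_iff_internal.1 h with h | h | h
        · exact hvF (h ▸ hm)
        · exact hn (h ▸ h₂.end_mem_verts)
        · exact I.shape.some_internal _ rfl _ (internal_append_right k₁ k₂ h) hm
    have hr : ∀ a ∈ F₁, G.InOuterRegion (stripCurve Q ⟨u, t', some (p ++ U₂), f :: F₂⟩)
        (G.rightFace a) := fun a ha =>
      i₂.outer (I.floor_sides (List.mem_append_left _ ha)).1
    -- The down-strip now starts at `u`, which is approached along the first part `F₁` of the old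
    -- floor.
    refine ⟨_, _, hE.extend S₂ i₂ (A₀ := F₁) (A₁ := []) h₁ rfl
      (fun x hx => I.floorVerts_strip (m₁ x hx))
      (by simpa [verts] using I.toSolid.finish_strip) ?_
      (fun a ha => notMem_stripVerts (key a ha) (d := (a, true)) rfl
        ((inOuterRegion_left_iff_right (key a ha (a, true) rfl)).2 (hr a ha)))
      (by simp) hr (by simp)⟩
    intro x hx hx'
    have : x = t' := by simpa [verts] using hx'
    exact htF (this ▸ hx)

end UpCross

/-! ### Right-most slicing -/

/-- No inner arc leaves an inner vertex of the ceiling. -/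
def CeilingClosed (G : PlaneDigraph V A Φ) (C : Set V) (Q : List A) (S : Strip V A) : Prop :=
  ∀ a ∈ G.innerArcs C Q S, G.tail a ∉ G.ceilingInnerVerts S

/-- A path along inner arcs from the floor vertex `u` to a later floor vertex is a slicing path. -/
theorem Regular.slices_floor [Finite A] {s t : V} {C : Set V} {Q p : List A} {u v : V} {f : A}
    (H : G.Setting s t C Q) {s' t' y : V} {U : Option (List A)}
    {F F₁ F₂ F₃ : List A} (I : G.Regular s t C Q ⟨s', t', U, F⟩) (e : F = F₁ ++ (f :: F₂) ++ F₃)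
    (h₁ : G.IsWalk s' F₁ u) (h₂ : G.IsWalk u (f :: F₂) v) (h₃ : G.IsWalk v F₃ t')
    (hp : G.IsPath u p y) (hne : p ≠ [])
    (hin : ∀ b ∈ p, b ∈ G.innerArcs C Q ⟨s', t', U, F⟩)
    (hy : y ∈ G.verts u (f :: F₂)) : ∃ T₁ T₂, G.Slices C Q ⟨s', t', U, F⟩ u f p T₁ T₂ := by
  subst e
  have hyu := (hp.ne hne).symm
  have h₁₂ := h₁.append h₂
  have hp := I.isLink H hp hne hin
    (Or.inl ((verts_append h₁₂).2 (Or.inl ((verts_append h₁).2 (Or.inl h₁.end_mem_verts)))))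
    (Or.inl ((verts_append h₁₂).2 (Or.inl ((verts_append h₁).2 (Or.inr hy)))))
  obtain ⟨G₁, G₂, e, l₁, l₂⟩ := h₂.split_mem hy
  -- Since `y` differs from `u`, the piece of the floor from `u` to `y` is nonempty and starts with
  -- `f`.
  cases G₁ with
  | nil => exact absurd l₁.symm hyu
  | cons g G₁ =>
    obtain ⟨rfl, rfl⟩ : f = g ∧ F₂ = G₁ ++ G₂ := by simpa using e
    have e' : F₁ ++ (f :: (G₁ ++ G₂)) ++ F₃ = F₁ ++ (f :: G₁) ++ (G₂ ++ F₃) := by simp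
    rw [e'] at hp ⊢
    exact ⟨_, _, Slices.forward hp h₁ l₁ (l₂.append h₃)⟩

section Rightmost

variable [Finite V] [Finite A] [Finite Φ] {s t : V} {C : Set V} {Q : List A} {u v w : V}
  {f : A} {p W F₂ : List A} {S : Strip V A}

/-- An inner arc of the down-strip that leaves an inner vertex of the slicing path `p` yields a path
that branches off to the right of `p`. -/
theorem exists_branchesRight (H : G.Setting s t C Q) (I : G.Solid C Q S)
    (hp : G.IsLink C Q S u p v) (I₂ : G.Regular s t C Q ⟨u, w, some (p ++ W), f :: F₂⟩)
    (i₂ : G.Inside C Q ⟨u, w, some (p ++ W), f :: F₂⟩ S) {a : A}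
    (ha : a ∈ G.innerArcs C Q ⟨u, w, some (p ++ W), f :: F₂⟩)
    (hx : G.tail a ∈ G.internalVerts p) :
    ∃ p' y, G.IsPath u p' y ∧ p' ≠ [] ∧ (∀ b ∈ p', b ∈ G.innerArcs C Q S) ∧
      G.BranchesRight f p' p ∧
      (y = v ∨ (y ∈ G.verts u (f :: F₂) ∧ y ≠ u) ∨ y ∈ G.internalVerts W) := by
  have hpW : G.IsPath u (p ++ W) w := I₂.shape.some_path _ rfl
  obtain ⟨v', hpv, hW⟩ := isWalk_append.1 hpW.1
  cases hp.2.1.1.unique hpv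
  have hxb : G.tail a ∈ G.boundaryVerts (⟨u, w, some (p ++ W), f :: F₂⟩ : Strip V A) :=
    Or.inr (mem_ceilingInnerVerts.2 ⟨_, rfl, internal_append_left hpv hW hx⟩)
  obtain ⟨L, y, hL⟩ := I₂.exists_link H ha hxb
  obtain ⟨c, r, n₁, n₂, e, k₁, k₂⟩ := (mem_internalVerts hpv).1 hx
  obtain ⟨c₀, i, ec, -, hi⟩ := k₁.concat_of_ne_nil n₁
  obtain ⟨o, r₀, er⟩ := List.exists_cons_of_ne_nil n₂
  have ho : G.tail o = G.tail a := by rw [er] at k₂; exact k₂.1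
  have hci : i ∈ c := by rw [ec]; simp
  have hcp : ∀ b ∈ c, b ∈ p := fun b hb => by rw [e]; exact List.mem_append_left _ hb
  have hrp : ∀ b ∈ r, b ∈ p := fun b hb => by rw [e]; exact List.mem_append_right _ hb
  have hop : o ∈ p := hrp o (by rw [er]; simp)
  have hcb : ∀ b ∈ p, b ∈ boundaryArcs (⟨u, w, some (p ++ W), f :: F₂⟩ : Strip V A) :=
    fun b hb => ceiling_boundary rfl (List.mem_append_left _ hb)
  have hvb : ∀ z ∈ G.verts u p,
      z ∈ G.boundaryVerts (⟨u, w, some (p ++ W), f :: F₂⟩ : Strip V A) := fun z hz =>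
    I₂.mem_boundaryVerts_of_ceiling rfl ((verts_append hpv).2 (Or.inl hz))
  have hvc : ∀ z ∈ G.verts u c, z ∈ G.verts u p := fun z hz => by
    rw [e]; exact (verts_append k₁).2 (Or.inl hz)
  have hvr : ∀ z ∈ G.verts (G.tail a) r, z ∈ G.verts u p := fun z hz => by
    rw [e]; exact (verts_append k₁).2 (Or.inr hz)
  have hout : ∀ b ∈ p, G.InOuterRegion (stripCurve Q ⟨u, w, some (p ++ W), f :: F₂⟩)
      (G.leftFace b) := fun b hb => (I₂.ceiling_sides rfl (List.mem_append_left _ hb)).1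
  have hdeg := H.degree _ (stripVerts_subset (tail_mem_stripVerts ha.1))
  have hne : ∀ b ∈ p, b ≠ a := fun b hb h => ha.2 (h ▸ hcb b hb)
  -- The left of `p` is outside the down-strip while `a` is inside it; hence, counterclockwise, the
  -- arrival dart of `i` is followed by `a` and then by `o`.
  obtain ⟨-, R₂, R₃⟩ := rot_of_three hdeg (d₁ := (o, true)) (d₂ := (i, false)) (d₃ := (a, true))
    ho hi rfl (by simp) (fun h => hne o hop (congrArg Prod.fst h)) (by simp)
    (R := G.InOuterRegion (stripCurve Q ⟨u, w, some (p ++ W), f :: F₂⟩)) (hout o hop)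
    (hout i (hcp i hci)) fun h => ha.1.2.elim (fun h' => h' h.1) (fun h' => h' h.2)
  -- As `c` is nonempty, turning starts from the dart of `i`, not from `f`; one turn gives `a` and
  -- two turns give `o`, whatever follows `a`.
  have branch : ∀ r', G.BranchesRight f (c ++ a :: r') p := by
    intro r'
    refine ⟨c, r₀, r', o, a, rfl, by rw [e, er], 1, 2, by norm_num, by norm_num, ?_, ?_, ?_⟩
    · simp [ec, R₂]
    · simp [ec, pow_two, R₂, R₃]
    · intro j hj hj'
      interval_cases j
      · simp [ec, R₂]
      · simp [ec, pow_two, R₂, R₃]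
  -- Otherwise the link and a piece of `c` form a closed walk in the down-strip that uses one of its
  -- ceiling arcs.
  have hyc : y ∉ G.verts u c := by
    intro hy
    obtain ⟨c₁, c₂, e', l₁, l₂⟩ := k₁.split_mem hy
    have hc₂ : c₂ ≠ [] := by
      rintro rfl
      have : y = G.tail a := l₂
      exact hL.2.1.ne hL.1 this.symm
    obtain ⟨b, q, eq⟩ := List.exists_cons_of_ne_nil hc₂
    have hbc : ∀ b ∈ c₂, b ∈ c := fun b hb => by rw [e']; exact List.mem_append_right _ hb
    have hb : b ∈ c₂ := by rw [eq]; simp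
    refine I₂.no_closed_walk H (l₂.append hL.2.1.1) ?_ rfl
      (List.mem_append_left _ (hcp b (hbc b hb))) (List.mem_append_left _ hb)
    intro b hb
    rcases List.mem_append.1 hb with hb | hb
    · exact I₂.boundary_strip (hcb b (hcp b (hbc b hb)))
    · exact (hL.2.2.1 b hb).1
  have hcL : G.IsPath u (c ++ a :: L) y := by
    refine ((e ▸ hp.2.1).of_append_left k₁).append hL.2.1 fun b hb hz => ?_
    rcases hL.2.1.1.head_cases hb with h | h
    · exact hyc (h ▸ hz)
    · exact hL.2.2.2.2.2 _ h (hvb _ (hvc _ hz))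
  have hcLin : ∀ b ∈ c ++ a :: L, b ∈ G.innerArcs C Q S := by
    intro b hb
    rcases List.mem_append.1 hb with hb | hb
    · exact hp.2.2.1 b (hcp b hb)
    · exact i₂.inner I (by rintro ⟨⟩) (hL.2.2.1 b hb)
  by_cases done : y = v ∨ (y ∈ G.verts u (f :: F₂) ∧ y ≠ u) ∨ y ∈ G.internalVerts W
  · exact ⟨c ++ a :: L, y, hcL, by simp, hcLin, branch L, done⟩
  rcases hL.2.2.2.2.1 with hy | hy
  · exact absurd (Or.inr (Or.inl ⟨hy, fun h => hyc (h ▸ start_mem_verts)⟩)) done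
  · obtain ⟨_, ⟨⟩, hy⟩ := mem_ceilingInnerVerts.1 hy
    rcases hpW.internal_append hpv hy with hy | hy | hy
    -- The link comes back to `p` after it left: the detour then follows the rest of `p` to `v`.
    · have hy := hpv.mem_verts_iff_internal.2 (Or.inr (Or.inr hy))
      rw [e] at hy
      obtain ⟨r₁, r₂, e', l₁, l₂⟩ := k₂.split_mem (((verts_append k₁).1 hy).resolve_left hyc)
      have hcr : G.IsPath u ((c ++ r₁) ++ r₂) v := by
        rw [List.append_assoc, ← e', ← e]; exact hp.2.1
      have hr₂ := hcr.of_append_right (k₁.append l₁)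
      have hbr : ∀ b ∈ r₂, b ∈ r := fun b hb => by rw [e']; exact List.mem_append_right _ hb
      refine ⟨c ++ a :: (L ++ r₂), v, ?_, by simp, ?_, branch _, Or.inl rfl⟩
      · rw [← List.cons_append, ← List.append_assoc]
        refine hcL.append hr₂ fun b hb hz => ?_
        rcases (verts_append k₁).1 hz with hz | hz
        · exact hcr.append_disjoint hb ((verts_append k₁).2 (Or.inl hz))
        · rcases hL.2.1.1.mem_verts_iff_internal.1 hz with h | h | h
          · exact hcr.append_disjoint hb ((verts_append k₁).2 (Or.inl (h ▸ k₁.end_mem_verts)))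
          · exact hr₂.start_notMem hb h
          · exact hL.2.2.2.2.2 _ h (hvb _ (hvr _ (head_mem_verts (hbr b hb))))
      · intro b hb
        rw [← List.cons_append, ← List.append_assoc] at hb
        rcases List.mem_append.1 hb with hb | hb
        · exact hcLin b hb
        · exact hp.2.2.1 b (hrp b (hbr b hb))
    · exact absurd (Or.inl hy) done
    · exact absurd (Or.inr (Or.inr hy)) done

theorem Slices.regular (H : G.Setting s t C Q) {S₁ S₂ : Strip V A}
    (hs : G.Slices C Q S u f p S₁ S₂) (I : G.Regular s t C Q S) :
    (∀ a ∈ G.stripArcs C Q S, a ∈ G.stripArcs C Q S₁ ∨ a ∈ G.stripArcs C Q S₂) ∧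
      G.Regular s t C Q S₁ ∧ G.Regular s t C Q S₂ := by
  cases hs with
  | forward hp h₁ h₂ h₃ => exact forward_regular H I hp h₁ h₂ h₃
  | upCross hp h₁ h₂ k₁ k₂ n₁ n₂ => exact upCross_regular I hp h₁ h₂ k₁ k₂ n₁ n₂

/-- Inner ceiling vertices of the parts are old ones, covered by the hypothesis since inner arcs of
a part are inner in `S`, or internal vertices of `p` on the ceiling of the down-strip. An inner arc
leaving one of the latter gives, by `exists_branchesRight`, a slicing path to the right of `p`. -/
theorem RightmostSlices.ceilingClosed (H : G.Setting s t C Q) {S₁ S₂ : Strip V A}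
    (hs : G.RightmostSlices C Q S p S₁ S₂) (I : G.Regular s t C Q S) (hc : G.CeilingClosed C Q S) :
    G.CeilingClosed C Q S₁ ∧ G.CeilingClosed C Q S₂ := by
  obtain ⟨u, f, hs, hr⟩ := hs
  obtain ⟨-, I₁, I₂⟩ := hs.regular H I
  cases hs with
  | forward hp h₁ h₂ h₃ =>
    refine ⟨fun a ha hx => hc a ((forward_inside₁ hp).inner I.toSolid id ha) hx, fun a ha hx => ?_⟩
    obtain ⟨_, ⟨⟩, hx⟩ := mem_ceilingInnerVerts.1 hx
    obtain ⟨p', y, hp', hne, hin, hb, hy⟩ := exists_branchesRight (W := []) H I.toSolid hp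
      (by simpa using I₂) (by simpa using forward_inside₂ hp) (by simpa using ha) hx
    obtain ⟨T₁, T₂, hT⟩ := I.slices_floor H rfl h₁ h₂ h₃ hp' hne hin (by
        rcases hy with rfl | hy | hy
        · exact h₂.end_mem_verts
        · exact hy.1
        · simp [internalVerts] at hy)
    exact hr p' T₁ T₂ hT hb
  | upCross hp h₁ h₂ k₁ k₂ n₁ n₂ =>
    refine ⟨fun a ha hx => ?_, fun a ha hx => ?_⟩
    · obtain ⟨_, ⟨⟩, hx⟩ := mem_ceilingInnerVerts.1 hx
      exact hc a ((upCross_inside₁ hp).inner I.toSolid (by rintro ⟨⟩) ha)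
        (mem_ceilingInnerVerts.2 ⟨_, rfl, internal_append_left k₁ k₂ hx⟩)
    · rename_i s' t' v U₁ U₂ F₁ F₂
      obtain ⟨_, ⟨⟩, hx⟩ := mem_ceilingInnerVerts.1 hx
      have ha' := (upCross_inside₂ hp).inner I.toSolid (by rintro ⟨⟩) ha
      have hpU := I₂.shape.some_path _ rfl
      rcases hpU.internal_append hp.2.1.1 hx with hx | hx | hx
      · obtain ⟨p', y, hp', hne, hin, hb, hy⟩ := exists_branchesRight H I.toSolid hp
          I₂ (upCross_inside₂ hp) ha hx
        have hyb : y ∈ G.internalVerts (U₁ ++ U₂) → ∃ T₁ T₂,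
            G.Slices C Q ⟨s', t', some (U₁ ++ U₂), F₁ ++ (f :: F₂)⟩ u f p' T₁ T₂ := by
          intro hyi
          have hl := I.isLink H hp' hne hin hp.2.2.2.1
            (Or.inr (mem_ceilingInnerVerts.2 ⟨_, rfl, hyi⟩))
          obtain ⟨W₁, W₂, m₁, m₂, e, l₁, l₂⟩ := (mem_internalVerts (k₁.append k₂)).1 hyi
          rw [e] at hl ⊢
          exact ⟨_, _, Slices.upCross hl h₁ h₂ l₁ l₂ m₁ m₂⟩
        obtain ⟨T₁, T₂, hT⟩ : ∃ T₁ T₂,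
            G.Slices C Q ⟨s', t', some (U₁ ++ U₂), F₁ ++ (f :: F₂)⟩ u f p' T₁ T₂ := by
          rcases hy with rfl | hy | hy
          · exact hyb (internal_middle k₁ k₂ n₁ n₂)
          · exact I.slices_floor (F₃ := []) H (by simp) h₁ h₂ rfl hp' hne hin hy.1
          · exact hyb (internal_append_right k₁ k₂ hy)
        exact hr p' T₁ T₂ hT hb
      · exact hc a ha' (mem_ceilingInnerVerts.2 ⟨_, rfl, hx ▸ internal_middle k₁ k₂ n₁ n₂⟩)
      · exact hc a ha' (mem_ceilingInnerVerts.2 ⟨_, rfl, internal_append_right k₁ k₂ hx⟩)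

end Rightmost

/-! ### The strips of a decomposition -/

theorem Decomposition.regular [Finite V] [Finite A] [Finite Φ] {s t : V} {C : Set V} {Q : List A}
    (H : G.Setting s t C Q) {S : Strip V A} {𝒮 : List (Strip V A)} (hd : G.Decomposition C Q S 𝒮)
    (I : G.Regular s t C Q S) (hc : G.CeilingClosed C Q S) :
    (∀ T ∈ 𝒮, G.Regular s t C Q T ∧ G.CeilingClosed C Q T ∧
      ∀ u f p S₁ S₂, ¬ G.Slices C Q T u f p S₁ S₂) ∧
    ∀ a ∈ G.stripArcs C Q S, ∃ T ∈ 𝒮, a ∈ G.stripArcs C Q T := by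
  induction hd with
  | minimal h => exact ⟨by simpa using ⟨I, hc, h⟩, fun a ha => ⟨_, by simp, ha⟩⟩
  | slice h _ _ ih₁ ih₂ =>
    obtain ⟨c₁, c₂⟩ := h.ceilingClosed H I hc
    obtain ⟨u, f, hs, -⟩ := h
    obtain ⟨cover, I₁, I₂⟩ := hs.regular H I
    obtain ⟨a₁, b₁⟩ := ih₁ I₁ c₁
    obtain ⟨a₂, b₂⟩ := ih₂ I₂ c₂
    refine ⟨fun T hT => (List.mem_append.1 hT).elim (a₁ T) (a₂ T), fun a ha => ?_⟩
    rcases cover a ha with h | h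
    · obtain ⟨T, hT, h⟩ := b₁ a h
      exact ⟨T, List.mem_append_left _ hT, h⟩
    · obtain ⟨T, hT, h⟩ := b₂ a h
      exact ⟨T, List.mem_append_right _ hT, h⟩

/-! ### Paths that enter or leave the component -/

theorem flat_of_notMem {C : Set V} {x : V} (hx : x ∉ C) :
    G.Flat (G.InOuterRegion (G.arcsOf C)) x := by
  refine Flat.of_notMem ?_
  rintro ⟨a, b⟩ rfl h
  cases b
  · exact hx h.2
  · exact hx h.1

/-- Arcs at a vertex outside `C` are not arcs of `C`, so turning around such vertices never leaves
the unbounded face of `C`. -/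
theorem LiesOutside.outer_of_tails [Finite A] {C : Set V} {s v : V} (hs : G.LiesOutside C s)
    {p : List A} (hp : G.IsWalk s p v) (h : ∀ a ∈ p, G.tail a ∉ C) {a : A} (ha : a ∈ p) :
    G.InOuterRegion (G.arcsOf C) (G.leftFace a) ∧
      G.InOuterRegion (G.arcsOf C) (G.rightFace a) := by
  obtain ⟨-, d, hd, ho⟩ := hs
  obtain ⟨h₁, h₂⟩ := hp.flat_tails (fun a ha => flat_of_notMem (h a ha)) hd a ha
  exact ⟨h₁ ▸ ho, h₂ ▸ ho⟩

theorem OnOuterFace.outer_of_heads [Finite A] {C : Set V} {t v : V} (ht : G.OnOuterFace t)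
    {p : List A} (hp : G.IsWalk v p t) (h : ∀ a ∈ p, G.head a ∉ C) {a : A} (ha : a ∈ p) :
    G.InOuterRegion (G.arcsOf C) (G.leftFace a) ∧
      G.InOuterRegion (G.arcsOf C) (G.rightFace a) := by
  obtain ⟨d, hd, ho⟩ := ht
  obtain ⟨h₁, h₂⟩ := hp.flat_heads (fun a ha => flat_of_notMem (h a ha)) hd a ha
  have := inOuterRegion_outer (G := G) (G.arcsOf C)
  rw [← ho] at this
  exact ⟨h₁ ▸ this, h₂ ▸ this⟩

theorem Solid.outer_of_arcsOf {C : Set V} {Q : List A} {S : Strip V A} (I : G.Solid C Q S) {f : Φ}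
    (hf : G.InOuterRegion (G.arcsOf C) f) : G.InOuterRegion (stripCurve Q S) f :=
  hf.mono fun _ ha hn => absurd (I.shape.curve_arcs ha) hn

namespace Regular

variable [Finite A] {s t : V} {C : Set V} {Q : List A} {S : Strip V A}

/-- A path to `t` that runs through an inner arc follows inner arcs to the boundary of the strip. -/
theorem exists_boundary_after (H : G.Setting s t C Q) (I : G.Regular s t C Q S) {a : A}
    {p : List A} (ha : a ∈ G.innerArcs C Q S) (hp : G.IsPath (G.head a) p t) :
    ∃ p₁ p₂ y, p = p₁ ++ p₂ ∧ G.IsWalk (G.head a) p₁ y ∧ G.IsWalk y p₂ t ∧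
      y ∈ G.boundaryVerts S ∧ ∀ b ∈ p₁, b ∈ G.innerArcs C Q S := by
  induction p generalizing a with
  | nil => exact absurd (hp.1 ▸ ha.1.1.2) H.sink_notMem
  | cons b p ih =>
    by_cases hx : G.head a ∈ G.boundaryVerts S
    · exact ⟨[], b :: p, _, rfl, rfl, hp.1, hx, by simp⟩
    · have hb : G.tail b = G.head a := hp.1.1
      obtain ⟨h₁, h₂⟩ := I.inner_of_inner hx (d := (a, false)) (e := (b, true)) rfl hb ha
      by_cases hbC : b ∈ G.arcsOf C
      · have hw : G.IsWalk (G.head a) [b] (G.head b) := ⟨hb, rfl⟩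
        obtain ⟨p₁, p₂, y, rfl, k₁, k₂, hy, hin⟩ := ih (h₂ hbC) (hp.of_append_right (p := [b]) hw)
        refine ⟨b :: p₁, p₂, y, rfl, ⟨hb, k₁⟩, k₂, hy, ?_⟩
        intro c hc
        rcases List.mem_cons.1 hc with rfl | hc
        · exact h₂ hbC
        · exact hin c hc
      · exfalso
        -- Once the path has left a strongly connected component, it cannot come back.
        have hout : ∀ x ∈ G.verts (G.head b) p, x ∉ C := fun x hx hxC => hbC
          ⟨hb ▸ ha.1.1.2, H.scc.mem_of_between (hb ▸ ha.1.1.2 : G.tail b ∈ C) hxC ⟨[b], rfl, rfl⟩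
            (hp.1.2.reaches_of_mem hx).1⟩
        -- Either the vertex is an internal vertex of `Q`, and the rest of the path makes it an
        -- exit; or all its faces are enclosed by the strip, although the rest of the path connects
        -- one of them to the outer face at `t`.
        rcases h₁ with h₁ | h₁
        · refine (H.internal _ h₁.2).2 ⟨ha.1.1.2, b :: p, hp, fun x hx hxC => ?_⟩
          rcases mem_verts.1 hx with h | ⟨c, hc, rfl⟩
          · exact h
          · rcases List.mem_cons.1 hc with rfl | hc
            · exact absurd hxC (hout _ start_mem_verts)
            · exact absurd hxC (hout _ (head_mem_verts hc))
        · refine h₁ (I.outer_of_arcsOf (H.sink.outer_of_heads hp.1 (fun c hc => ?_)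
            (List.mem_cons_self)).1)
          rcases List.mem_cons.1 hc with rfl | hc
          · exact hout _ start_mem_verts
          · exact hout _ (head_mem_verts hc)

/-- A path from `s` that runs through an inner arc comes along inner arcs from the boundary of the
strip. -/
theorem exists_boundary_before (H : G.Setting s t C Q) (I : G.Regular s t C Q S) {a : A}
    {p : List A} (ha : a ∈ G.innerArcs C Q S) (hp : G.IsPath s p (G.tail a)) :
    ∃ p₁ p₂ y, p = p₁ ++ p₂ ∧ G.IsWalk s p₁ y ∧ G.IsWalk y p₂ (G.tail a) ∧
      y ∈ G.boundaryVerts S ∧ ∀ b ∈ p₂, b ∈ G.innerArcs C Q S := by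
  induction p using List.reverseRecOn generalizing a with
  | nil =>
    have h : s = G.tail a := hp.1
    exact absurd (h ▸ ha.1.1.1) H.source.1
  | append_singleton p b ih =>
    by_cases hx : G.tail a ∈ G.boundaryVerts S
    · exact ⟨p ++ [b], [], _, by simp, hp.1, rfl, hx, by simp⟩
    · obtain ⟨hp', hb⟩ := isWalk_concat.1 hp.1
      obtain ⟨h₁, h₂⟩ := I.inner_of_inner hx (d := (a, true)) (e := (b, false)) rfl hb ha
      by_cases hbC : b ∈ G.arcsOf C
      · obtain ⟨p₁, p₂, y, rfl, k₁, k₂, hy, hin⟩ := ih (h₂ hbC) (hp.of_append_left hp')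
        refine ⟨p₁, p₂ ++ [b], y, by simp, k₁, isWalk_concat.2 ⟨k₂, hb⟩, hy, ?_⟩
        intro c hc
        rcases List.mem_append.1 hc with hc | hc
        · exact hin c hc
        · rw [List.mem_singleton.1 hc]; exact h₂ hbC
      · exfalso
        have hbC' : G.head b ∈ C := hb ▸ ha.1.1.1
        have hout : ∀ x ∈ G.verts s p, x ∉ C := fun x hx hxC => hbC
          ⟨H.scc.mem_of_between hxC hbC' (hp'.reaches_of_mem hx).2 ⟨[b], rfl, rfl⟩, hbC'⟩
        -- Now the first part of the path would make an internal vertex of `Q` an entrance, or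
        -- connect an enclosed face to the unbounded face of `C` at `s`.
        rcases h₁ with h₁ | h₁
        · refine (H.internal _ h₁.2).1 ⟨ha.1.1.1, p ++ [b], hp, fun x hx hxC => ?_⟩
          rcases hp.1.mem_verts.1 hx with h | ⟨c, hc, rfl⟩
          · exact h
          · rcases List.mem_append.1 hc with hc | hc
            · exact absurd hxC (hout _ (hp'.tail_mem_verts hc))
            · rw [List.mem_singleton.1 hc] at hxC
              exact absurd hxC (hout _ hp'.end_mem_verts)
        · refine h₁ (I.outer_of_arcsOf (H.source.outer_of_tails hp.1 (fun c hc => ?_)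
            (List.mem_append_right _ (List.mem_singleton_self b))).2)
          rcases List.mem_append.1 hc with hc | hc
          · exact hout _ (hp'.tail_mem_verts hc)
          · rw [List.mem_singleton.1 hc]
            exact hout _ hp'.end_mem_verts

end Regular

theorem Approach.notMem_strip₀ {s t : V} {C : Set V} {Q : List A} {S : Strip V A} {E₀ E₁ : List A}
    (hE : G.Approach s t C Q S E₀ E₁) {a : A} (ha : a ∈ E₀) : a ∉ G.stripArcs C Q S := fun h =>
  hE.simple₀ a ha (hE.avoid₀ _ (hE.walk₀.tail_mem_verts ha) (tail_mem_stripVerts h))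

theorem Approach.notMem_strip₁ {s t : V} {C : Set V} {Q : List A} {S : Strip V A} {E₀ E₁ : List A}
    (hE : G.Approach s t C Q S E₀ E₁) {a : A} (ha : a ∈ E₁) : a ∉ G.stripArcs C Q S := fun h =>
  hE.simple₁ a ha (hE.avoid₁ _ (head_mem_verts ha) (head_mem_stripVerts h))

/-! ### Inner arcs of output strips are useless -/

section Output

variable [Finite V] [Finite A] [Finite Φ] {s t : V} {C : Set V} {Q : List A} {S : Strip V A}

/-- A simple path from `s` to `t` does not use a link that goes backward along the floor. -/
theorem Regular.no_backward (H : G.Setting s t C Q) (I : G.Regular s t C Q S) {u v : V}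
    {P₁ L P₂ F₁ F₂ F₃ : List A} (hP : G.IsPath s (P₁ ++ (L ++ P₂)) t) (hP₁ : G.IsWalk s P₁ u)
    (hL : G.IsLink C Q S u L v) (hP₂ : G.IsWalk v P₂ t) (hF : S.floor = F₁ ++ (F₂ ++ F₃))
    (h₁ : G.IsWalk S.start F₁ v) (h₂ : G.IsWalk v F₂ u) (h₃ : G.IsWalk u F₃ S.finish) : False := by
  obtain ⟨E₀, E₁, hE⟩ := I.approach
  have huC : u ∈ C := stripVerts_subset (I.boundaryVerts_strip hL.2.2.2.1)
  have hvC : v ∈ C := stripVerts_subset (I.boundaryVerts_strip hL.2.2.2.2.1)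
  have huv := hL.2.1.ne hL.1
  have hfl : G.IsPath S.start (F₁ ++ (F₂ ++ F₃)) S.finish := hF ▸ I.shape.floor_path
  have hfl' : G.IsPath S.start ((F₁ ++ F₂) ++ F₃) S.finish := by simpa using hfl
  have h₁₂ := h₁.append h₂
  have n₂ : F₂ ≠ [] := by rintro rfl; exact huv h₂.symm
  have b₁ : ∀ a ∈ F₁, a ∈ S.floor := fun a ha => by rw [hF]; simp [ha]
  have b₂ : ∀ a ∈ F₂, a ∈ S.floor := fun a ha => by rw [hF]; simp [ha]
  have b₃ : ∀ a ∈ F₃, a ∈ S.floor := fun a ha => by rw [hF]; simp [ha]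
  have m₁ : ∀ x ∈ G.verts S.start F₁, x ∈ G.verts S.start S.floor := fun x hx => by
    rw [hF]; exact (verts_append h₁).2 (Or.inl hx)
  have m₃ : ∀ x ∈ G.verts u F₃, x ∈ G.verts S.start S.floor := fun x hx => by
    rw [hF]; exact (verts_append h₁).2 (Or.inr ((verts_append h₂).2 (Or.inr hx)))
  have w₀ := hE.walk₀.append h₁
  have w₁ := h₃.append hE.walk₁
  have right₀ : ∀ a ∈ E₀ ++ F₁, G.InOuterRegion (stripCurve Q S) (G.rightFace a) := fun a ha =>
    (List.mem_append.1 ha).elim (hE.right₀ a) fun h => (I.floor_sides (b₁ a h)).1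
  have right₁ : ∀ a ∈ F₃ ++ E₁, G.InOuterRegion (stripCurve Q S) (G.rightFace a) := fun a ha =>
    (List.mem_append.1 ha).elim (fun h => (I.floor_sides (b₃ a h)).1) (hE.right₁ a)
  have inner₀ : ∀ a ∈ E₀ ++ F₁, a ∉ G.innerArcs C Q S := fun a ha hin =>
    (List.mem_append.1 ha).elim (fun h => hE.notMem_strip₀ h hin.1)
      fun h => hin.2 (Or.inl (b₁ a h))
  have inner₁ : ∀ a ∈ F₃ ++ E₁, a ∉ G.innerArcs C Q S := fun a ha hin =>
    (List.mem_append.1 ha).elim (fun h => hin.2 (Or.inl (b₃ a h)))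
      fun h => hE.notMem_strip₁ h hin.1
  have hvB : ∀ a ∈ E₀ ++ F₁, G.tail a ≠ v := by
    intro a ha h
    rcases List.mem_append.1 ha with ha | ha
    · exact hE.simple₀ a ha (hE.avoid₀ _ (hE.walk₀.tail_mem_verts ha)
        (h ▸ I.boundaryVerts_strip hL.2.2.2.2.1))
    · exact (hfl.of_append_left h₁).end_notMem ha h
  have disj : ∀ x ∈ G.verts s (E₀ ++ F₁), x ∉ G.verts u (F₃ ++ E₁) := by
    intro x hx hx'
    rcases (verts_append hE.walk₀).1 hx with h | h <;> rcases (verts_append h₃).1 hx' with h' | h'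
    · have := hE.avoid₀ x h (I.floorVerts_strip (m₃ x h'))
      exact (hfl'.of_append_left h₁₂).ne (by simp [n₂])
        (hfl'.eq_of_mem_mem h₁₂ start_mem_verts (this ▸ h'))
    · exact hE.disjoint x h h'
    · exact huv (hfl'.eq_of_mem_mem h₁₂ ((verts_append h₁).2 (Or.inl h)) h' ▸
        hfl.eq_of_mem_mem h₁ h ((verts_append h₂).2 (Or.inr h')))
    · have := hE.avoid₁ x h' (I.floorVerts_strip (m₁ x h))
      exact (hfl.of_append_right h₁).ne (by simp [n₂])
        (hfl.eq_of_mem_mem h₁ (this ▸ h) (h₂.append h₃).end_mem_verts).symm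
  have hLi : ∀ x ∈ G.internalVerts L, x ∉ G.verts s (E₀ ++ F₁) ∧ x ∉ G.verts u (F₃ ++ E₁) := by
    intro x hx
    have hxb := hL.2.2.2.2.2 x hx
    have hxs : x ∈ G.stripVerts C Q S := by
      obtain ⟨p₁, p₂, -, k₂, e, -, l₂⟩ := (mem_internalVerts hL.2.1.1).1 hx
      obtain ⟨b, r, rfl⟩ := List.exists_cons_of_ne_nil k₂
      exact l₂.1 ▸ tail_mem_stripVerts (hL.2.2.1 b (by rw [e]; simp)).1
    constructor
    · intro h
      rcases (verts_append hE.walk₀).1 h with h | h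
      · exact hxb (hE.avoid₀ x h hxs ▸ Or.inl start_mem_verts)
      · exact hxb (Or.inl (m₁ x h))
    · intro h
      rcases (verts_append h₃).1 h with h | h
      · exact hxb (Or.inl (m₃ x h))
      · exact hxb (hE.avoid₁ x h hxs ▸ Or.inl I.shape.floor_path.1.end_mem_verts)
  -- The vertices `u` and `v` may be the ends of the strip, so `i` and `o` are taken from the
  -- extended walks and need not be floor arcs.
  obtain ⟨B₀, i, e₀, -, hi⟩ := w₀.concat_of_ne_nil (by
    intro h
    rw [h] at w₀
    exact H.source.1 ((show s = v from w₀) ▸ hvC))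
  obtain ⟨o, B₁, e₁⟩ := List.exists_cons_of_ne_nil (l := F₃ ++ E₁) (by
    intro h
    rw [h] at w₁
    exact H.sink_notMem ((show u = t from w₁) ▸ huC))
  obtain ⟨l, L₁, el⟩ := List.exists_cons_of_ne_nil hL.1
  obtain ⟨L₂, l', el', -, hl'⟩ := hL.2.1.1.concat_of_ne_nil hL.1
  obtain ⟨g, F₄, eg⟩ := List.exists_cons_of_ne_nil n₂
  obtain ⟨F₅, k, ek, -, hk⟩ := h₂.concat_of_ne_nil n₂
  have hiB : i ∈ E₀ ++ F₁ := by rw [e₀]; simp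
  have hoB : o ∈ F₃ ++ E₁ := by rw [e₁]; simp
  have ho : G.tail o = u := by rw [e₁] at w₁; exact w₁.1
  have hg : G.tail g = v := by rw [eg] at h₂; exact h₂.1
  have hlin := hL.2.2.1 l (by rw [el]; simp)
  have hlin' := hL.2.2.1 l' (by rw [el']; simp)
  have hl : G.tail l = u := by have := hL.2.1.1; rw [el] at this; exact this.1
  have hol : (o, true) ≠ (l, true) := fun h =>
    inner₁ o hoB ((show o = l from congrArg Prod.fst h) ▸ hlin)
  have hil : (i, false) ≠ (l', false) := fun h =>
    inner₀ i hiB ((show i = l' from congrArg Prod.fst h) ▸ hlin')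
  -- At `u` and at `v` the right sides of the floor and of the approaching walks are outside the
  -- strip, which forces the link to be on their left. This yields the face identities that
  -- `no_backward_link` needs.
  obtain ⟨-, R₂, R₃⟩ := rot_of_three (H.degree u huC) (d₁ := (k, false)) (d₂ := (o, true))
    (d₃ := (l, true)) hk ho hl (by simp) (by simp) hol (R := G.InOuterRegion (stripCurve Q S))
    (I.floor_sides (b₂ k (by rw [ek]; simp))).1 (right₁ o hoB)
    fun h => hlin.1.2.elim (fun h' => h' h.1) fun h' => h' h.2
  obtain ⟨-, -, T₃⟩ := rot_of_three (H.degree v hvC) (d₁ := (i, false)) (d₂ := (g, true))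
    (d₃ := (l', false)) hi hg hl' (by simp) hil (by simp) (R := G.InOuterRegion (stripCurve Q S))
    (right₀ i hiB) (I.floor_sides (b₂ g (by rw [eg]; simp))).1
    fun h => hlin'.1.2.elim (fun h' => h' h.2) fun h' => h' h.1
  have f₁ := G.face_rot (l, true)
  have f₂ := G.face_rot (o, true)
  have f₃ := G.face_rot (l', false)
  rw [R₃] at f₁
  rw [R₂] at f₂
  rw [T₃] at f₃
  rw [e₀] at w₀ disj hvB hLi
  rw [e₁] at w₁ disj hLi
  refine no_backward_link H.no_clockwise H.scc H.source H.sink huC hP hP₁ hL.2.1.1 hP₂ w₀ w₁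
    (l := l) (l' := l') (by simp [el]) (by simp [el']) disj hvB hLi ?_ f₂ f₃.symm
  intro k' hk'
  rcases eq_of_three (H.degree u huC) (d₁ := (k, false)) (d₂ := (o, true)) (d₃ := (l, true))
    (d := (k', false)) hk ho hl (by simp) (by simp) hol hk' with h | h | h
  · rw [show k' = k from congrArg Prod.fst h]
    exact f₁.symm
  · simp at h
  · simp at h

/-- The inner arcs of a strip without slicing paths are useless. -/
theorem Regular.not_useful (H : G.Setting s t C Q) (I : G.Regular s t C Q S)
    (hc : G.CeilingClosed C Q S) (hm : ∀ u f p S₁ S₂, ¬ G.Slices C Q S u f p S₁ S₂) {e : A}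
    (he : e ∈ G.innerArcs C Q S) : ¬ G.Useful s t e := by
  rintro ⟨P, hP, heP⟩
  obtain ⟨p, q, rfl⟩ := List.append_of_mem heP
  obtain ⟨x, hp, hq⟩ := isWalk_append.1 hP.1
  obtain rfl : G.tail e = x := hq.1
  have hq' : G.IsPath (G.head e) q t :=
    (hP.of_append_right hp).of_append_right (p := [e]) ⟨rfl, rfl⟩
  obtain ⟨P₁, L₁, u, rfl, hP₁, hL₁, hu, hin₁⟩ :=
    I.exists_boundary_before H he (hP.of_append_left hp)
  obtain ⟨L₂, P₂, v, rfl, hL₂, hP₂, hv, hin₂⟩ := I.exists_boundary_after H he hq'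
  have hP' : G.IsPath s (P₁ ++ ((L₁ ++ e :: L₂) ++ P₂)) t := by simpa using hP
  have hLw : G.IsWalk u (L₁ ++ e :: L₂) v := hL₁.append ⟨rfl, hL₂⟩
  have hLp := (hP'.of_append_right hP₁).of_append_left hLw
  have hLin : ∀ a ∈ L₁ ++ e :: L₂, a ∈ G.innerArcs C Q S := by
    intro a ha
    rcases List.mem_append.1 ha with ha | ha
    · exact hin₁ a ha
    · rcases List.mem_cons.1 ha with rfl | ha
      · exact he
      · exact hin₂ a ha
  generalize hLdef : L₁ ++ e :: L₂ = L at hP' hLw hLp hLin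
  have hLne : L ≠ [] := by rw [← hLdef]; simp
  have hL := I.isLink H hLp hLne hLin hu hv
  have huv := hLp.ne hLne
  -- The link starts with an inner arc, which cannot leave an inner vertex of the ceiling.
  have hu' : u ∈ G.verts S.start S.floor := by
    refine hu.resolve_right fun h => ?_
    obtain ⟨l, L', rfl⟩ := List.exists_cons_of_ne_nil hLne
    exact hc l (hLin l (by simp)) (hLw.1 ▸ h)
  obtain ⟨Fa, Fb, hF, ha, hb⟩ := I.shape.floor_path.1.split_mem hu'
  obtain ⟨s', t', U, F⟩ := S
  rcases hv with hv | hv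
  · have hv : v ∈ G.verts s' F := hv
    subst hF
    -- If `v` is on the floor up to `u`, the link goes backward; otherwise it is a forward path.
    rcases (verts_append ha).1 hv with h | h
    · obtain ⟨F₁, F₂, rfl, h₁, h₂⟩ := ha.split_mem h
      exact I.no_backward H hP' hP₁ hL hP₂ (List.append_assoc _ _ _) h₁ h₂ hb
    · cases Fb with
      | nil => simp only [verts, List.map_nil, List.mem_singleton] at h; exact huv h.symm
      | cons f F₂ =>
        obtain ⟨T₁, T₂, hT⟩ := I.slices_floor H (F₃ := []) (by simp) ha hb rfl hLp hLne hLin h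
        exact hm _ _ _ _ _ hT
  · obtain ⟨W, hW, hv'⟩ := mem_ceilingInnerVerts.1 hv
    obtain rfl : U = some W := hW
    have hWp := I.shape.some_path W rfl
    obtain ⟨U₁, U₂, n₁, n₂, rfl, k₁, k₂⟩ := (mem_internalVerts hWp.1).1 hv'
    have hF : F = Fa ++ Fb := hF
    subst hF
    cases Fb with
    | nil =>
      -- From the end of the strip there is no up-cross path, but the link followed by the ceiling
      -- from `v` is a closed walk through a ceiling arc.
      obtain rfl : u = t' := hb
      obtain ⟨b, r, rfl⟩ := List.exists_cons_of_ne_nil n₂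
      refine I.no_closed_walk H (hLw.append k₂) (fun a ha => ?_) rfl (a := b) (by simp) (by simp)
      rcases List.mem_append.1 ha with ha | ha
      · exact (hLin a ha).1
      · exact I.boundary_strip (ceiling_boundary rfl (List.mem_append_right _ ha))
    | cons f F₂ => exact hm _ _ _ _ _ (Slices.upCross hL ha hb k₁ k₂ n₁ n₂)

end Output

/-! ### The component as a strip -/

theorem IsLowestFloor.shape {s t : V} {C : Set V} {sC tC : V} {F Q : List A}
    (h : G.IsLowestFloor s t C sC tC F Q) : G.Shape C Q ⟨sC, tC, none, F⟩ := by
  obtain ⟨⟨hne, -, hnd⟩, hb, hF, hQ, -⟩ := h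
  have hFne : F ≠ [] := by
    rintro rfl
    have e : sC = tC := hF.1
    exact hQ.ne (by simpa using hne) e.symm
  exact
    { floor_path := hF
      floor_ne := hFne
      floor_arcs := fun a ha => ((hb a).1 (List.mem_append_left _ ha)).1
      some_path := by rintro _ ⟨⟩
      some_arcs := by rintro _ ⟨⟩
      some_internal := by rintro _ ⟨⟩
      some_disjoint := by rintro _ ⟨⟩
      none_path := fun _ => hQ
      none_arcs := fun a ha => ((hb a).1 (List.mem_append_right _ ha)).1
      none_internal := fun _ x hx hx' => by
        obtain ⟨q₁, q₂, -, n₂, rfl, -, h₂⟩ := (mem_internalVerts hQ.1).1 hx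
        obtain ⟨b, r, rfl⟩ := List.exists_cons_of_ne_nil n₂
        rcases hF.1.mem_verts.1 hx' with h | ⟨a, ha, h⟩
        · exact (hQ.internal_ne hx).1 h
        · rw [List.map_append, List.nodup_append] at hnd
          exact hnd.2.2 _ (List.mem_map_of_mem ha) _ (List.mem_map_of_mem (a := b) (by simp))
            (h.trans h₂.1.symm) }

/-- The boundary of `C` is a directed cycle, which is not clockwise; hence its interior is on the
left. -/
theorem IsLowestFloor.solid [Finite V] [Finite A] [Finite Φ]
    (hcw : ∀ c : List A, ¬ G.IsClockwiseCycle c) {s t : V} {C : Set V} {sC tC : V} {F Q : List A}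
    (h : G.IsLowestFloor s t C sC tC F Q) : G.Solid C Q ⟨sC, tC, none, F⟩ := by
  obtain ⟨g, hg⟩ := h.shape.exists_potential
  have e : stripCurve Q ⟨sC, tC, none, F⟩ = {a | a ∈ F ++ Q} := by
    ext a; simp [stripCurve]
  obtain ⟨J₁, J₂⟩ := h.1.potential hcw (h := g) (by
    convert hg using 1
    funext a
    simp [stripJump, mult_append])
  exact ⟨h.shape, g, hg, e ▸ J₁, J₂⟩

/-- The outer region of the boundary cycle is contained in the unbounded face of `C`: an arc of `C`
reached from that face is a boundary arc, so it is not crossed. An arc with both sides outside would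
thus be on the cycle, yet arcs of the cycle have an enclosed side. -/
theorem IsLowestFloor.arcs_strip [Finite V] [Finite A] [Finite Φ]
    (hcw : ∀ c : List A, ¬ G.IsClockwiseCycle c) {s t : V} {C : Set V} {sC tC : V} {F Q : List A}
    (h : G.IsLowestFloor s t C sC tC F Q) {a : A} (ha : a ∈ G.arcsOf C) :
    a ∈ G.stripArcs C Q ⟨sC, tC, none, F⟩ := by
  have hcurve : ∀ a, a ∈ stripCurve Q ⟨sC, tC, none, F⟩ ↔ a ∈ G.componentBoundary C := fun a => by
    rw [← h.2.1 a]; simp [stripCurve]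
  have key : ∀ f, G.InOuterRegion (stripCurve Q ⟨sC, tC, none, F⟩) f →
      G.InOuterRegion (G.arcsOf C) f := by
    intro f hf
    induction hf with
    | refl => exact inOuterRegion_outer _
    | tail _ hd ih =>
      obtain ⟨⟨b, β⟩, hb, rfl, rfl⟩ := hd
      refine (inOuterRegion_rev (d := (b, β)) fun hbC => hb ((hcurve b).2 ⟨hbC, ?_⟩)).1 ih
      cases β
      · exact Or.inr ih
      · exact Or.inl ih
  refine ⟨ha, ?_⟩
  by_contra! hc
  have hac := (hcurve a).2 ⟨ha, Or.inl (key _ hc.1)⟩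
  exact ((h.solid hcw).curve_strip hac).2.elim (fun h' => h' hc.1) fun h' => h' hc.2

/-- The approaching walks are the paths that certify the entrance `sC` and the exit `tC`. -/
theorem IsLowestFloor.regular [Finite V] [Finite A] [Finite Φ] {s t : V} {C : Set V} {sC tC : V}
    {F Q : List A} (H : G.Setting s t C Q) (h : G.IsLowestFloor s t C sC tC F Q) :
    G.Regular s t C Q ⟨sC, tC, none, F⟩ := by
  have I := h.solid H.no_clockwise
  have hstrip := fun {a} => h.arcs_strip H.no_clockwise (a := a)
  obtain ⟨-, -, -, -, ⟨hs, E₀, hE₀, hm₀⟩, ⟨ht, E₁, hE₁, hm₁⟩, -⟩ := h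
  refine { I with
    none_strip := fun _ x _ d _ hd => hstrip hd
    approach := ⟨E₀, E₁, hE₀.1, hE₁.1, fun x hx hx' => ?_,
      fun x hx hx' => hm₀ x hx (stripVerts_subset hx'),
      fun x hx hx' => hm₁ x hx (stripVerts_subset hx'),
      fun a ha => hE₀.end_notMem ha, fun a ha => hE₁.start_notMem ha,
      fun a ha => I.outer_of_arcsOf (H.source.outer_of_tails hE₀.1 (fun b hb hbC =>
        hE₀.end_notMem hb (hm₀ _ (hE₀.1.tail_mem_verts hb) hbC)) ha).2,
      fun a ha => I.outer_of_arcsOf (H.sink.outer_of_heads hE₁.1 (fun b hb hbC =>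
        hE₁.start_notMem hb (hm₁ _ (head_mem_verts hb) hbC)) ha).2⟩ }
  -- A common vertex of the two paths is reachable from `tC` and reaches `sC`, so it is in `C` and
  -- coincides with both.
  have hxC := H.scc.mem_of_between ht hs (hE₁.1.reaches_of_mem hx').1 (hE₀.1.reaches_of_mem hx).2
  exact I.shape.start_ne ((hm₀ x hx hxC).symm.trans (hm₁ x hx' hxC))

end PlaneDigraph

theorem mainTheorem4 {V A Φ : Type*} [Finite V] [Finite A] [Finite Φ]
    (G : PlaneDigraph V A Φ) (s t : V)
    (no_clockwise : ∀ c : List A, ¬ G.IsClockwiseCycle c)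
    (source_in : ∀ a : A, G.head a ≠ s)
    (source_out : ∃! a : A, G.tail a = s)
    (degree_three : ∀ v : V, v ≠ s → v ≠ t → G.degree v = 3)
    (sink_outer : G.OnOuterFace t)
    (C : Set V) (component : G.IsSCC C)
    (source_outside : G.LiesOutside C s) (sink_notMem : t ∉ C)
    (sC tC : V) (F Q : List A) (floor : G.IsLowestFloor s t C sC tC F Q)
    (𝒮 : List (Strip V A))
    (decomposition : G.Decomposition C Q ⟨sC, tC, none, F⟩ 𝒮) :
    (∀ S ∈ 𝒮, ∀ e ∈ G.innerArcs C Q S, ¬ G.Useful s t e) ∧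
    (∀ e ∈ G.arcsOf C, G.Useful s t e → ∃ S ∈ 𝒮, e ∈ PlaneDigraph.boundaryArcs S) := by
  have H : G.Setting s t C Q :=
    { no_clockwise := no_clockwise
      degree := fun x hx => degree_three x (fun h => source_outside.1 (h ▸ hx))
        fun h => sink_notMem (h ▸ hx)
      scc := component
      source := source_outside
      sink := sink_outer
      sink_notMem := sink_notMem
      internal := floor.2.2.2.2.2.2 }
  -- The dummy ceiling contains no inner vertices of the graph, so `CeilingClosed` holds vacuously
  -- at the beginning.
  obtain ⟨output, cover⟩ := decomposition.regular H (floor.regular H) fun a _ hx => by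
    obtain ⟨U, hU, -⟩ := PlaneDigraph.mem_ceilingInnerVerts.1 hx
    simp at hU
  have useless : ∀ S ∈ 𝒮, ∀ e ∈ G.innerArcs C Q S, ¬ G.Useful s t e := fun S hS e he =>
    (output S hS).1.not_useful H (output S hS).2.1 (output S hS).2.2 he
  refine ⟨useless, fun e he hu => ?_⟩
  obtain ⟨S, hS, h⟩ := cover e (floor.arcs_strip no_clockwise he)
  exact ⟨S, hS, by_contra fun hb => useless S hS e ⟨h, hb⟩ hu⟩
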